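/- Notation. For $\mathbf z,\mathbf w\in\mathbb C^n$ let $\mathbf z\cdot\mathbf w=\sum_{\ell} z_\ell\overline{w_\ell}$ and $|\mathbf z|=\sqrt{\mathbf z\cdot\mathbf z}$. Let ${}_0\mathrm F_1(b,x)=\sum_{k\ge0}\frac{x^k}{(b)_k\,k!}$, where $(b)_k=b(b+1)\cdots(b+k-1)$, and let $\mathrm K_p(x)=\int_0^\infty e^{-x\cosh t}\cosh(pt)\,\mathrm dt$ ($x>0$) be the MacDonald (modified Bessel) function. For $p>-n$ and $\hbar>0$ define the measure on $\mathbb C^n$ $$\mathrm dm_{n,p}^\hbar(\mathbf w)=\frac{1}{\Gamma(n+p)}\frac{2}{(\pi\hbar^2)^n}\left(\frac{|\mathbf w|}{\hbar}\right)^p\mathrm K_p\!\left(\frac{2|\mathbf w|}{\hbar}\right)\mathrm d\mathbf w\,\mathrm d\overline{\mathbf w},$$ with $\mathrm d\mathbf w\,\mathrm d\overline{\mathbf w}$ Lebesgue measure. Write $\partial_i=\partial/\partial w_i$, $\partial_{\bar j}=\partial/\partial\overline w_j$ (Wirtinger derivatives). Let $g_{i\bar j}=\partial_{\bar j}\partial_i\Phi$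 be the Kähler metric with potential $\Phi(\mathbf w)=2|\mathbf w|$ on $\mathbb C^n\setminus\{0\}$, $g=\det[g_{i\bar j}]$, $g^{\bar j i}$ the $(j,i)$ entry of the inverse of the matrix $[g_{i\bar j}]$, $\mathrm L_1=\sum_{i,j}g^{\bar j i}\partial_i\partial_{\bar j}$ the Laplace–Beltrami operator, $R=\mathrm L_1(\log g)$ the scalar curvature (in this sign convention), and $$\xi_{\mathbf z}^{\nu,\mu}(\mathbf w)=|\mathbf z|^{\mu-\frac12}|\mathbf w|^{p-\frac12}(\mathbf z\cdot\mathbf w)^{-\frac\mu2+\frac14}(\mathbf w\cdot\mathbf z)^{-\frac\nu2+\frac14}$$ with principal branches. Theorem. Let $n\ge2$, $\mathbf z\in\mathbb C^n\setminus\{0\}$, $p\in\mathbb R$ with $p>-n$, and $\mu,\nu\in\mathbb R$ with $\mu,\nu>\frac12$. Let $\beta:\mathbb C^n\to\mathbb C$ be smooth (in the real sense) and integrable with respect to $\mathrm dm_{n,p}^{\hbar_0}$ for some $\hbar_0>0$. Then for all sufficiently small $\hbar>0$ the integral $$\mathbf I(\mathbf z)=\int_{\mathbb C^n}\beta(\mathbf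 w)\,\frac{{}_0\mathrm F_1(\nu,\mathbf w\cdot\mathbf z/\hbar^2)\,{}_0\mathrm F_1(\mu,\mathbf z\cdot\mathbf w/\hbar^2)}{{}_0\mathrm F_1(\mu,|\mathbf z|^2/\hbar^2)}\,\mathrm dm_{n,p}^\hbar(\mathbf w)$$ converges absolutely, and as $\hbar\to0^+$ $$\begin{aligned}\mathbf I(\mathbf z)=\left(\frac{|\mathbf z|}{\hbar}\right)^{n+p-\nu}\frac{\Gamma(\nu)}{\Gamma(n+p)}\Bigg\{&\beta(\mathbf z)+\hbar\Bigg(\frac{(p-\nu+1)(p+\nu-1)}{4|\mathbf z|}\beta(\mathbf z)+\frac R2\beta(\mathbf z)\\&+\sum_{i,j}g^{\bar j i}(\mathbf z)\bigg[\frac{1}{2|\mathbf z|^2}\big(\overline z_i(n+p-\nu)\partial_{\bar j}+z_j(n+p-\mu)\partial_i\big)\beta(\mathbf w)+\partial_i\partial_{\bar j}\beta(\mathbf w)\\&\qquad+\frac{\beta(\mathbf z)}{2|\mathbf z|^{n+p-\nu}}\,\partial_{\bar j}\partial_i\Big(\frac{\xi_{\mathbf z}^{\nu,\mu}}{g}\Big)(\mathbf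 w)\bigg]_{\mathbf w=\mathbf z}\Bigg)+\mathrm O(\hbar^2)\Bigg\},\end{aligned}$$ where $R$ is evaluated at $\mathbf z$. -/

import Mathlib

open MeasureTheory Filter Asymptotics Topology
open scoped ContDiff ComplexConjugate

noncomputable section

namespace BerezinSphere

/-- `ℂⁿ` with its Hermitian norm `|z| = √(∑ |z_l|²)`; its `volume` is Lebesgue measure. -/
abbrev Cn (n : ℕ) : Type := EuclideanSpace ℂ (Fin n)

/-- `z · w = ∑ z_l conj(w_l)`, linear in the first variable. -/
def hdot {n : ℕ} (z w : Cn n) : ℂ := ∑ l, z l * conj (w l)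

/-- The generalized hypergeometric function
`₀F₁(b, x) = ∑ x^k / ((b)_k k!)`, with `(b)_k` the rising factorial. -/
def hyp0F1 (b : ℝ) (x : ℂ) : ℂ :=
  ∑' k : ℕ, x ^ k / ((((ascPochhammer ℝ k).eval b : ℝ) : ℂ) * (k.factorial : ℂ))

/-- The MacDonald (modified Bessel) function of order `p` at `x > 0`:
`K_p(x) = ∫_0^∞ exp(-x cosh t) cosh(p t) dt`. -/
def besselK (p x : ℝ) : ℝ :=
  ∫ t in Set.Ioi (0 : ℝ), Real.exp (-x * Real.cosh t) * Real.cosh (p * t)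

/-- The density of `dm_{n,p}^ħ` with respect to Lebesgue measure. -/
def mDensity (n : ℕ) (p ħ : ℝ) (w : Cn n) : ℝ :=
  1 / Real.Gamma (n + p) * (2 / (Real.pi * ħ ^ 2) ^ n) * (‖w‖ / ħ) ^ p
    * besselK p (2 * ‖w‖ / ħ)

/-- The measure `dm_{n,p}^ħ` on `ℂⁿ`. -/
def mMeasure (n : ℕ) (p ħ : ℝ) : Measure (Cn n) :=
  volume.withDensity fun w => ENNReal.ofReal (mDensity n p ħ w)

/-- The Wirtinger derivative `∂_i = ∂/∂w_i = (∂/∂x_i - √-1 ∂/∂y_i) / 2`. -/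
def dW {n : ℕ} (i : Fin n) (f : Cn n → ℂ) (w : Cn n) : ℂ :=
  (fderiv ℝ f w (EuclideanSpace.single i 1)
    - Complex.I * fderiv ℝ f w (EuclideanSpace.single i Complex.I)) / 2

/-- The Wirtinger derivative `∂_{j̄} = ∂/∂w̄_j = (∂/∂x_j + √-1 ∂/∂y_j) / 2`. -/
def dWbar {n : ℕ} (j : Fin n) (f : Cn n → ℂ) (w : Cn n) : ℂ :=
  (fderiv ℝ f w (EuclideanSpace.single j 1)
    + Complex.I * fderiv ℝ f w (EuclideanSpace.single j Complex.I)) / 2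

/-- The Kähler potential `Φ(w) = 2|w|`. -/
def potential {n : ℕ} (w : Cn n) : ℂ := ((2 * ‖w‖ : ℝ) : ℂ)

/-- The matrix of the Kähler metric: the entry `(i, j)` is `g_{i j̄} = ∂_{j̄} ∂_i Φ`. -/
def metric {n : ℕ} (w : Cn n) : Matrix (Fin n) (Fin n) ℂ :=
  Matrix.of fun i j => dWbar j (dW i potential) w

/-- `g = det [g_{i j̄}]`. -/
def metricDet {n : ℕ} (w : Cn n) : ℂ := (metric w).det

/-- `g^{j̄ i}`: the entry `(j, i)` of the inverse of the matrix `[g_{i j̄}]`. -/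
def metricInv {n : ℕ} (w : Cn n) (j i : Fin n) : ℂ := (metric w)⁻¹ j i

/-- The Laplace–Beltrami operator `L₁ = g^{j̄ i} ∂_i ∂_{j̄}`. -/
def laplaceBeltrami {n : ℕ} (f : Cn n → ℂ) (w : Cn n) : ℂ :=
  ∑ i, ∑ j, metricInv w j i * dW i (dWbar j f) w

/-- The scalar curvature, in the sign convention `R = L₁ (log g)`. -/
def scalarCurvature {n : ℕ} (w : Cn n) : ℂ :=
  laplaceBeltrami (fun u => Complex.log (metricDet u)) w

/-- `ξ_z^{ν,μ}(w) = |z|^(μ-1/2) |w|^(p-1/2) (z·w)^(-μ/2+1/4) (w·z)^(-ν/2+1/4)`,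
with principal branches of the powers. -/
def xi {n : ℕ} (p ν μ : ℝ) (z w : Cn n) : ℂ :=
  ((‖z‖ ^ (μ - 1 / 2) * ‖w‖ ^ (p - 1 / 2) : ℝ) : ℂ)
    * hdot z w ^ ((-μ / 2 + 1 / 4 : ℝ) : ℂ) * hdot w z ^ ((-ν / 2 + 1 / 4 : ℝ) : ℂ)

/-- `β(w) ₀F₁(ν, w·z/ħ²) ₀F₁(μ, z·w/ħ²) / ₀F₁(μ, |z|²/ħ²)`. -/
def integrand {n : ℕ} (ν μ ħ : ℝ) (β : Cn n → ℂ) (z w : Cn n) : ℂ :=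
  β w * (hyp0F1 ν (hdot w z / (ħ : ℂ) ^ 2) * hyp0F1 μ (hdot z w / (ħ : ℂ) ^ 2)
    / hyp0F1 μ ((‖z‖ : ℂ) ^ 2 / (ħ : ℂ) ^ 2))

/-- The coefficient of `ħ` inside the braces of the expansion. -/
def firstCoeff {n : ℕ} (p ν μ : ℝ) (β : Cn n → ℂ) (z : Cn n) : ℂ :=
  1 / (4 * (‖z‖ : ℂ)) * (p - ν + 1) * (p + ν - 1) * β z
    + scalarCurvature z / 2 * β z
    + ∑ i, ∑ j, metricInv z j i *
        (1 / (2 * (‖z‖ : ℂ) ^ 2) *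
            (conj (z i) * (n + p - ν) * dWbar j β z + z j * (n + p - μ) * dW i β z)
          + dW i (dWbar j β) z
          + β z / (2 * ((‖z‖ ^ (n + p - ν) : ℝ) : ℂ)) *
              dWbar j (dW i fun w => xi p ν μ z w / metricDet w) z)

end BerezinSphere

end

/-!
# The first two terms of the `ħ`-expansion of the normalized kernel integral

The integral is evaluated by Laplace's method, carried out in a chart in which the phase is exactly
quadratic.

*Special functions.* For `b > 1/2`, Poisson's integral (`hyp0F1_sq`) represents `₀F₁(b, ζ²)` as an
average of `cosh (2ζt)` over `t ∈ (0, 1)`. It gives the bound `|₀F₁(b, ζ²)| ≤ e^(2|Re ζ|)` and, by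
Watson's lemma, the two-term behaviour for large `ζ` in a sector around the positive axis
(`exists_hyp0F1_bound`). The MacDonald function is treated directly from its defining integral
(`exists_besselK_bound`, `besselK_add_le`).

*The phase.* Write `z = s₀² e` with `|e| = 1`. The exponentials contained in the three special
functions combine to `exp (-(2/ħ) φ(w))` with `φ(w) = |w| + |z| - 2 Re √(w·z)`. For
`y + s₀ e = s e + v`, `v ⊥ e`, the map `y ↦ s² e + √(2|s|² + |v|²) v` sends balls around `0` onto
sublevel sets of `φ` and satisfies `φ = |y|²` (`phase_chart`, `chart_image_ball`); its Jacobian is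
explicit (`setIntegral_phase_lt`). In this chart the integrand is therefore a Gaussian times a smooth
function (`jacobian_mul_integrand`).

*The near region.* Gaussian moments and a Taylor estimate for the even part of a smooth function give
the expansion with a remainder of relative order `ħ²` (`exists_laplace_bound`). The coefficient of
`ħ` is one eighth of the Laplacian of symbol times amplitude at `y = 0`, plus the first-order term of
the special functions. The Laplacian is computed from second-order jets along the coordinate lines
(`sum_fderiv_fderiv_symbol_mul_amp`), and the coefficient in the statement is computed from the
explicit metric `g_{i j̄} = δ_{ij}/|w| - w̄_i w_j/(2|w|³)` (`firstCoeff_eq`); both are the same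
expression in real derivatives of `β` (`trace_add_ratioCoeff_eq`).

*The far region.* Comparing the densities for `ħ` and `ħ₀` bounds density times integrand by
`ħ^(-m) e^(-φ(w)/ħ)` times the integrable function attached to `ħ₀` (`exists_integrand_bound`). This
gives absolute convergence for small `ħ`, and where `φ ≥ δ²` a contribution smaller than any power of
`ħ`.
-/

noncomputable section

namespace BerezinSphere

/-! ### Laplace transforms of powers -/

lemma integrableOn_rpow_mul_exp_neg {a r : ℝ} (ha : 0 < a) (hr : 0 < r) :
    IntegrableOn (fun t : ℝ => t ^ (a - 1) * Real.exp (-r * t)) (Set.Ioi 0) := by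
  simpa using integrableOn_rpow_mul_exp_neg_mul_rpow (p := 1) (s := a - 1) (by linarith) one_pos hr

lemma norm_cexp_neg_mul_ofReal (ζ : ℂ) (t : ℝ) :
    ‖Complex.exp (-ζ * t)‖ = Real.exp (-ζ.re * t) := by
  rw [Complex.norm_exp]; simp

lemma aestronglyMeasurable_ofReal_rpow_mul_cexp (a : ℝ) (ζ : ℂ) (μ : Measure ℝ) :
    AEStronglyMeasurable (fun t : ℝ => ((t ^ a : ℝ) : ℂ) * Complex.exp (-ζ * t)) μ := by
  apply Measurable.aestronglyMeasurable
  fun_prop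

lemma integrableOn_rpow_mul_cexp_neg {a : ℝ} {ζ : ℂ} (ha : 0 < a) (hζ : 0 < ζ.re) :
    IntegrableOn (fun t : ℝ => ((t ^ (a - 1) : ℝ) : ℂ) * Complex.exp (-ζ * t)) (Set.Ioi 0) := by
  refine (integrableOn_rpow_mul_exp_neg ha hζ).mono'
    (aestronglyMeasurable_ofReal_rpow_mul_cexp _ _ _) ?_
  filter_upwards [ae_restrict_mem measurableSet_Ioi] with t ht
  rw [norm_mul, norm_cexp_neg_mul_ofReal, Complex.norm_real, Real.norm_of_nonneg
    (Real.rpow_nonneg (le_of_lt ht) _)]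

/-- Euler's integral for complex `ζ`, by analytic continuation from the positive reals. -/
lemma integral_rpow_mul_cexp_neg {a : ℝ} {ζ : ℂ} (ha : 0 < a) (hζ : 0 < ζ.re) :
    ∫ t in Set.Ioi (0 : ℝ), ((t ^ (a - 1) : ℝ) : ℂ) * Complex.exp (-ζ * t)
      = ζ ^ (-a : ℂ) * (Real.Gamma a : ℂ) := by
  set f : ℂ → ℂ := fun ζ => ∫ t in Set.Ioi (0 : ℝ), ((t ^ (a - 1) : ℝ) : ℂ) * Complex.exp (-ζ * t)
  set U : Set ℂ := {ζ | 0 < ζ.re}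
  have hUo : IsOpen U := isOpen_lt continuous_const Complex.continuous_re
  have hUc : IsPreconnected U := (convex_halfSpace_re_gt 0).isPreconnected
  have hf : DifferentiableOn ℂ f U := by
    intro w hw
    have hw : 0 < w.re := hw
    have h := hasDerivAt_integral_of_dominated_loc_of_deriv_le
      (μ := volume.restrict (Set.Ioi (0:ℝ)))
      (F := fun (ζ : ℂ) (t : ℝ) => ((t ^ (a - 1) : ℝ) : ℂ) * Complex.exp (-ζ * t))
      (F' := fun (ζ : ℂ) (t : ℝ) => ((t ^ (a - 1) : ℝ) : ℂ) * (Complex.exp (-ζ * t) * (-t)))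
      (x₀ := w) (s := {ζ | w.re / 2 < ζ.re})
      (bound := fun t => t ^ (a + 1 - 1) * Real.exp (-(w.re / 2) * t))
      ((isOpen_lt continuous_const Complex.continuous_re).mem_nhds (by simp; linarith))
      (Eventually.of_forall fun ζ => aestronglyMeasurable_ofReal_rpow_mul_cexp _ _ _)
      (integrableOn_rpow_mul_cexp_neg ha hw)
      (by apply Measurable.aestronglyMeasurable; fun_prop)
      ?_ (integrableOn_rpow_mul_exp_neg (by linarith) (by linarith)) ?_
    · exact h.2.differentiableAt.differentiableWithinAt
    · filter_upwards [ae_restrict_mem measurableSet_Ioi] with t ht ζ hζ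
      have ht : 0 < t := ht
      have hζ : w.re / 2 < ζ.re := hζ
      rw [norm_mul, norm_mul, norm_cexp_neg_mul_ofReal, Complex.norm_real, Real.norm_of_nonneg
        (Real.rpow_nonneg (le_of_lt ht) _), norm_neg, Complex.norm_real, Real.norm_of_nonneg ht.le,
        add_sub_right_comm, Real.rpow_add_one ht.ne']
      have : Real.exp (-ζ.re * t) ≤ Real.exp (-(w.re / 2) * t) := by
        apply Real.exp_le_exp.2; nlinarith
      calc _ = t ^ (a - 1) * t * Real.exp (-ζ.re * t) := by ring
        _ ≤ _ := by gcongr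
    · filter_upwards with t ζ hζ
      have h1 : HasDerivAt (fun ζ : ℂ => -ζ * t) (-t) ζ := by
        simpa using (hasDerivAt_id ζ).neg.mul_const (t : ℂ)
      exact h1.cexp.const_mul _
  have hg : DifferentiableOn ℂ (fun ζ : ℂ => ζ ^ (-a : ℂ) * (Real.Gamma a : ℂ)) U := by
    intro w hw
    have hw : 0 < w.re := hw
    refine DifferentiableAt.differentiableWithinAt ?_
    have : w ∈ Complex.slitPlane := Or.inl hw
    fun_prop (disch := assumption)
  have hreal : ∀ r : ℝ, 0 < r → f r = (r : ℂ) ^ (-a : ℂ) * (Real.Gamma a : ℂ) := by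
    intro r hr
    have h1 := Real.integral_rpow_mul_exp_neg_mul_Ioi ha hr
    have h2 : f r = ((∫ t in Set.Ioi (0 : ℝ), t ^ (a - 1) * Real.exp (-(r * t)) : ℝ) : ℂ) := by
      rw [← integral_complex_ofReal]
      simp only [f]
      congr 1; ext t
      push_cast; ring_nf
    rw [h2, h1]
    rw [one_div, Real.inv_rpow hr.le, ← Real.rpow_neg hr.le, Complex.ofReal_mul,
      Complex.ofReal_cpow hr.le]
    push_cast; rfl
  have key : Set.EqOn f (fun ζ : ℂ => ζ ^ (-a : ℂ) * (Real.Gamma a : ℂ)) U := by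
    refine (hf.analyticOnNhd hUo).eqOn_of_preconnected_of_frequently_eq (hg.analyticOnNhd hUo) hUc
      (z₀ := 1) (by simp [U]) ?_
    -- The two sides agree at the points `1 + 1 / (k + 1)`, which accumulate at `1`.
    have ht : Tendsto (fun k : ℕ => ((1 + 1 / ((k : ℝ) + 1) : ℝ) : ℂ)) atTop (𝓝[≠] (1 : ℂ)) := by
      refine tendsto_nhdsWithin_iff.2 ⟨?_, Eventually.of_forall fun k => ?_⟩
      · have := (tendsto_one_div_add_atTop_nhds_zero_nat (𝕜 := ℝ)).const_add 1
        rw [add_zero] at this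
        exact_mod_cast (Complex.continuous_ofReal.tendsto 1).comp this
      · have : (0:ℝ) < 1 / ((k : ℝ) + 1) := by positivity
        simp only [Set.mem_compl_iff, Set.mem_singleton_iff]
        intro h
        have h := congrArg Complex.re h
        rw [Complex.ofReal_re, Complex.one_re] at h
        linarith
    refine ht.frequently (Frequently.of_forall fun k => ?_)
    exact hreal _ (by positivity)
  exact key hζ

/-! ### Poisson's integral for `₀F₁` -/

lemma integral_beta {u v : ℝ} (hu : 0 < u) (hv : 0 < v) :
    ∫ x in Set.Ioo (0 : ℝ) 1, x ^ (u - 1) * (1 - x) ^ (v - 1)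
      = Real.Gamma u * Real.Gamma v / Real.Gamma (u + v) := by
  have h := Complex.betaIntegral_eq_Gamma_mul_div u v (by simpa) (by simpa)
  rw [Complex.betaIntegral, intervalIntegral.integral_of_le zero_le_one,
    integral_Ioc_eq_integral_Ioo] at h
  rw [← Complex.ofReal_inj, ← integral_complex_ofReal]
  rw [Complex.ofReal_div, Complex.ofReal_mul, ← Complex.Gamma_ofReal, ← Complex.Gamma_ofReal,
    ← Complex.Gamma_ofReal, Complex.ofReal_add, ← h]
  refine setIntegral_congr_fun measurableSet_Ioo fun x hx => ?_
  rw [Complex.ofReal_mul, Complex.ofReal_cpow hx.1.le, Complex.ofReal_cpow (by linarith [hx.2])]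
  push_cast; rfl

/-- The weight `(1 - t²)^(b - 3/2)` of Poisson's integral, used for `0 < t < 1`. -/
def poissonWeight (b t : ℝ) : ℝ := (1 - t ^ 2) ^ (b - 3 / 2)

lemma poissonWeight_nonneg {b t : ℝ} (ht : t ∈ Set.Ioo (0 : ℝ) 1) : 0 ≤ poissonWeight b t :=
  Real.rpow_nonneg (by nlinarith [ht.1, ht.2]) _

lemma measurable_poissonWeight (b : ℝ) : Measurable (poissonWeight b) := by
  unfold poissonWeight; fun_prop

lemma integral_pow_mul_poissonWeight {b : ℝ} (hb : 1 / 2 < b) (k : ℕ) :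
    ∫ t in Set.Ioo (0 : ℝ) 1, t ^ (2 * k) * poissonWeight b t
      = Real.Gamma (k + 1 / 2) * Real.Gamma (b - 1 / 2) / Real.Gamma (k + b) / 2 := by
  have h := integral_beta (u := k + 1 / 2) (v := b - 1 / 2) (by positivity) (by linarith)
  rw [show (k : ℝ) + 1 / 2 + (b - 1 / 2) = k + b by ring] at h
  rw [← h, ← integral_indicator measurableSet_Ioo (f := fun x : ℝ => x ^ ((k:ℝ) + 1 / 2 - 1) * _)]
  have hsub : ∀ f : ℝ → ℝ, ∫ x, (Set.Ioo (0:ℝ) 1).indicator f x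
      = ∫ x in Set.Ioi (0:ℝ), (Set.Ioo (0:ℝ) 1).indicator f x := by
    intro f
    rw [← integral_indicator measurableSet_Ioi, Set.indicator_indicator,
      Set.inter_eq_right.2 Set.Ioo_subset_Ioi_self]
  rw [hsub, ← integral_comp_rpow_Ioi_of_pos two_pos, eq_div_iff two_ne_zero,
    ← integral_mul_const, ← integral_indicator measurableSet_Ioo, hsub]
  refine setIntegral_congr_fun measurableSet_Ioi fun x hx => ?_
  have hx : 0 < x := hx
  by_cases h1 : x < 1
  · have h2 : x ∈ Set.Ioo (0:ℝ) 1 := ⟨hx, h1⟩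
    have h3 : x ^ (2:ℝ) ∈ Set.Ioo (0:ℝ) 1 := ⟨by positivity, Real.rpow_lt_one hx.le h1 two_pos⟩
    simp only [Set.indicator_of_mem h2, Set.indicator_of_mem h3, smul_eq_mul]
    rw [← Real.rpow_mul hx.le, poissonWeight]
    have : x ^ (2 * k) = x ^ ((2:ℝ) - 1) * x ^ ((2:ℝ) * (k + 1 / 2 - 1)) := by
      rw [← Real.rpow_add hx, ← Real.rpow_natCast]
      congr 1; push_cast; ring
    rw [this, show b - 1 / 2 - 1 = b - 3 / 2 by ring, Real.rpow_two]
    ring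
  · have h2 : x ∉ Set.Ioo (0:ℝ) 1 := fun h => h1 h.2
    have h3 : x ^ (2:ℝ) ∉ Set.Ioo (0:ℝ) 1 := fun h => h1 (by
      have := h.2
      rw [Real.rpow_two] at this
      nlinarith)
    simp only [Set.indicator_of_notMem h2, Set.indicator_of_notMem h3, smul_zero]

lemma integrableOn_pow_mul_poissonWeight {b : ℝ} (hb : 1 / 2 < b) (k : ℕ) :
    IntegrableOn (fun t => t ^ (2 * k) * poissonWeight b t) (Set.Ioo (0 : ℝ) 1) := by
  -- A non-integrable function has Bochner integral zero, whereas this integral is positive.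
  by_contra h
  have h1 := integral_pow_mul_poissonWeight hb k
  rw [integral_undef h] at h1
  have := Real.Gamma_pos_of_pos (show 0 < (k:ℝ) + 1 / 2 by positivity)
  have := Real.Gamma_pos_of_pos (show 0 < b - 1 / 2 by linarith)
  have := Real.Gamma_pos_of_pos (show 0 < (k:ℝ) + b by positivity)
  have : 0 < Real.Gamma (k + 1 / 2) * Real.Gamma (b - 1 / 2) / Real.Gamma (k + b) / 2 := by
    positivity
  linarith

lemma integrableOn_poissonWeight {b : ℝ} (hb : 1 / 2 < b) :
    IntegrableOn (poissonWeight b) (Set.Ioo (0 : ℝ) 1) := by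
  have h := integrableOn_pow_mul_poissonWeight hb 0
  simp only [mul_zero, pow_zero, one_mul] at h
  exact h

lemma Gamma_nat_add_half_mul (k : ℕ) :
    Real.Gamma (k + 1 / 2) * (4 ^ k * k.factorial) = √Real.pi * (2 * k).factorial := by
  induction k with
  | zero => simp [-one_div, Real.Gamma_one_half_eq]
  | succ k ih =>
    have : Real.Gamma ((k + 1 : ℕ) + 1 / 2) = (k + 1 / 2) * Real.Gamma (k + 1 / 2) := by
      rw [← Real.Gamma_add_one (by positivity)]; congr 1; push_cast; ring
    rw [this, show 2 * (k + 1) = 2 * k + 1 + 1 by ring, Nat.factorial_succ, Nat.factorial_succ,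
      Nat.factorial_succ]
    push_cast
    linear_combination (4 * (k + 1) * (k + 1 / 2)) * ih

lemma Gamma_nat_add {b : ℝ} (hb : 0 < b) (k : ℕ) :
    Real.Gamma (k + b) = (ascPochhammer ℝ k).eval b * Real.Gamma b := by
  induction k with
  | zero => simp
  | succ k ih =>
    have : Real.Gamma ((k + 1 : ℕ) + b) = (k + b) * Real.Gamma (k + b) := by
      rw [← Real.Gamma_add_one (by positivity)]; congr 1; push_cast; ring
    rw [this, ih, ascPochhammer_succ_eval]; ring

/-- The normalising constant of Poisson's integral. -/
def poissonConst (b : ℝ) : ℝ := 2 * Real.Gamma b / (√Real.pi * Real.Gamma (b - 1 / 2))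

lemma poissonConst_pos {b : ℝ} (hb : 1 / 2 < b) : 0 < poissonConst b := by
  have := Real.Gamma_pos_of_pos (show 0 < b - 1 / 2 by linarith)
  have := Real.Gamma_pos_of_pos (show 0 < b by linarith)
  have := Real.pi_pos
  unfold poissonConst; positivity

lemma poissonConst_mul_integral {b : ℝ} (hb : 1 / 2 < b) (k : ℕ) :
    poissonConst b * (4 ^ k / (2 * k).factorial *
      ∫ t in Set.Ioo (0 : ℝ) 1, t ^ (2 * k) * poissonWeight b t)
      = 1 / ((ascPochhammer ℝ k).eval b * k.factorial) := by
  have hb0 : 0 < b := by linarith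
  have h1 := (Real.Gamma_pos_of_pos (show 0 < b - 1 / 2 by linarith)).ne'
  have h2 := (Real.Gamma_pos_of_pos hb0).ne'
  have h3 := (ascPochhammer_pos k b hb0).ne'
  have h4 : √Real.pi ≠ 0 := (Real.sqrt_pos.2 Real.pi_pos).ne'
  have h5 := Gamma_nat_add_half_mul k
  have h6 : ((2 * k).factorial : ℝ) ≠ 0 := by positivity
  rw [integral_pow_mul_poissonWeight hb, Gamma_nat_add hb0, poissonConst]
  rw [← eq_div_iff (by positivity)] at h5
  rw [h5]
  generalize Real.Gamma (b - 1 / 2) = G at h1 ⊢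
  field_simp

lemma norm_two_mul_pow (ζ : ℂ) (t : ℝ) (k : ℕ) :
    ‖(2 * ζ * t) ^ (2 * k)‖ = (2 * ‖ζ‖) ^ (2 * k) * t ^ (2 * k) := by
  rw [norm_pow, norm_mul, norm_mul, Complex.norm_real, mul_pow, Complex.norm_ofNat, pow_mul ‖t‖,
    Real.norm_eq_abs, sq_abs, ← pow_mul]

lemma hasSum_poisson {b : ℝ} (hb : 1 / 2 < b) (ζ : ℂ) :
    HasSum (fun k : ℕ => ζ ^ (2 * k) /
        ((((ascPochhammer ℝ k).eval b : ℝ) : ℂ) * (k.factorial : ℂ)))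
      (poissonConst b * ∫ t in Set.Ioo (0 : ℝ) 1, (poissonWeight b t : ℂ) * Complex.cosh (2 * ζ * t)) := by
  set μ := volume.restrict (Set.Ioo (0 : ℝ) 1)
  set F : ℕ → ℝ → ℂ := fun k t => (poissonWeight b t : ℂ) * ((2 * ζ * t) ^ (2 * k) / (2 * k).factorial)
  have hnorm : ∀ k, ∀ᵐ t ∂μ, ‖F k t‖
      = (2 * ‖ζ‖) ^ (2 * k) / (2 * k).factorial * (t ^ (2 * k) * poissonWeight b t) := by
    intro k
    filter_upwards [ae_restrict_mem measurableSet_Ioo] with t ht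
    simp only [F]
    rw [norm_mul, norm_div, norm_two_mul_pow, Complex.norm_real, Complex.norm_natCast,
      Real.norm_of_nonneg (poissonWeight_nonneg ht)]
    ring
  have hint : ∀ k, Integrable (F k) μ := by
    intro k
    refine ((integrableOn_pow_mul_poissonWeight hb k).const_mul
      ((2 * ‖ζ‖) ^ (2 * k) / (2 * k).factorial)).mono' ?_ ((hnorm k).mono fun t ht => ht.le)
    have := measurable_poissonWeight b
    apply Measurable.aestronglyMeasurable
    fun_prop
  have hsum : Summable fun k => ∫ t, ‖F k t‖ ∂μ := by
    have h1 : ∀ k, ∫ t, ‖F k t‖ ∂μ ≤ (2 * ‖ζ‖) ^ (2 * k) / (2 * k).factorial *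
        ∫ t, poissonWeight b t ∂μ := by
      intro k
      rw [integral_congr_ae (hnorm k), integral_const_mul]
      refine mul_le_mul_of_nonneg_left ?_ (by positivity)
      refine integral_mono_ae (integrableOn_pow_mul_poissonWeight hb k)
        (integrableOn_poissonWeight hb) ?_
      filter_upwards [ae_restrict_mem measurableSet_Ioo] with t ht
      exact mul_le_of_le_one_left (poissonWeight_nonneg ht) (pow_le_one₀ ht.1.le ht.2.le)
    refine Summable.of_nonneg_of_le (fun k => integral_nonneg fun t => norm_nonneg _) h1 ?_
    exact (Real.hasSum_cosh (2 * ‖ζ‖)).summable.mul_right _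
  have h := (hasSum_integral_of_summable_integral_norm hint hsum).mul_left (poissonConst b : ℂ)
  have e1 : ∀ k : ℕ, ζ ^ (2 * k) /
      ((((ascPochhammer ℝ k).eval b : ℝ) : ℂ) * (k.factorial : ℂ))
        = poissonConst b * ∫ t, F k t ∂μ := by
    intro k
    have h1 := congrArg (fun x : ℝ => (x : ℂ)) (poissonConst_mul_integral hb k)
    have h2 : ∫ t, F k t ∂μ = (4 ^ k / (2 * k).factorial * ζ ^ (2 * k)) *
        ((∫ t, t ^ (2 * k) * poissonWeight b t ∂μ : ℝ) : ℂ) := by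
      rw [← integral_complex_ofReal, ← integral_const_mul]
      congr 1; ext t
      simp only [F]
      push_cast
      rw [mul_pow, mul_pow, pow_mul 2]
      norm_num
      ring
    simp only [μ] at h2 ⊢
    rw [h2]
    push_cast at h1 ⊢
    rw [div_eq_mul_one_div, ← h1]
    ring
  have e2 : ∫ t in Set.Ioo (0 : ℝ) 1, (poissonWeight b t : ℂ) * Complex.cosh (2 * ζ * t)
      = ∫ t, ∑' k, F k t ∂μ :=
    integral_congr_ae (Eventually.of_forall fun t =>
      ((Complex.hasSum_cosh (2 * ζ * t)).mul_left _).tsum_eq.symm)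
  rw [funext e1, e2]
  exact h

/-- Poisson's integral: `₀F₁(b, ζ²) = c_b ∫_0^1 (1 - t²)^(b - 3/2) cosh(2ζt) dt` for `b > 1/2`. -/
lemma hyp0F1_sq {b : ℝ} (hb : 1 / 2 < b) (ζ : ℂ) :
    hyp0F1 b (ζ ^ 2) = poissonConst b *
      ∫ t in Set.Ioo (0 : ℝ) 1, (poissonWeight b t : ℂ) * Complex.cosh (2 * ζ * t) := by
  rw [← (hasSum_poisson hb ζ).tsum_eq, hyp0F1]
  simp_rw [pow_mul]

lemma norm_cosh_le (w : ℂ) : ‖Complex.cosh w‖ ≤ Real.exp |w.re| := by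
  rw [Complex.cosh]
  have h1 : ‖Complex.exp w‖ ≤ Real.exp |w.re| := by
    rw [Complex.norm_exp]; exact Real.exp_le_exp.2 (le_abs_self _)
  have h2 : ‖Complex.exp (-w)‖ ≤ Real.exp |w.re| := by
    rw [Complex.norm_exp]; exact Real.exp_le_exp.2 (by simpa using neg_le_abs w.re)
  rw [norm_div, Complex.norm_ofNat]
  have := norm_add_le (Complex.exp w) (Complex.exp (-w))
  linarith

lemma poissonConst_mul_integral_weight {b : ℝ} (hb : 1 / 2 < b) :
    poissonConst b * ∫ t in Set.Ioo (0 : ℝ) 1, poissonWeight b t = 1 := by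
  simpa using poissonConst_mul_integral hb 0

lemma norm_hyp0F1_sq_le {b : ℝ} (hb : 1 / 2 < b) (ζ : ℂ) :
    ‖hyp0F1 b (ζ ^ 2)‖ ≤ Real.exp (2 * |ζ.re|) := by
  rw [hyp0F1_sq hb, norm_mul, Complex.norm_real, Real.norm_of_nonneg (poissonConst_pos hb).le]
  have h : ‖∫ t in Set.Ioo (0 : ℝ) 1, (poissonWeight b t : ℂ) * Complex.cosh (2 * ζ * t)‖
      ≤ ∫ t in Set.Ioo (0 : ℝ) 1, poissonWeight b t * Real.exp (2 * |ζ.re|) := by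
    refine norm_integral_le_of_norm_le ?_ ?_
    · exact (integrableOn_poissonWeight hb).mul_const _
    · filter_upwards [ae_restrict_mem measurableSet_Ioo] with t ht
      rw [norm_mul, Complex.norm_real, Real.norm_of_nonneg (poissonWeight_nonneg ht)]
      refine mul_le_mul_of_nonneg_left ((norm_cosh_le _).trans (Real.exp_le_exp.2 ?_))
        (poissonWeight_nonneg ht)
      have : (2 * ζ * t).re = 2 * ζ.re * t := by simp
      rw [this, abs_mul, abs_mul, abs_of_pos ht.1, abs_two]
      nlinarith [abs_nonneg ζ.re, ht.2]
  rw [integral_mul_const] at h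
  calc _ ≤ poissonConst b * ((∫ t in Set.Ioo (0 : ℝ) 1, poissonWeight b t) * Real.exp (2 * |ζ.re|)) :=
        mul_le_mul_of_nonneg_left h (poissonConst_pos hb).le
    _ = Real.exp (2 * |ζ.re|) := by
        rw [← mul_assoc, poissonConst_mul_integral_weight hb, one_mul]

lemma measurable_hyp0F1 {b : ℝ} (hb : 1 / 2 < b) : Measurable (hyp0F1 b) := by
  have h : hyp0F1 b = fun x => poissonConst b *
      ∫ t in Set.Ioo (0 : ℝ) 1, (poissonWeight b t : ℂ) * Complex.cosh (2 * x ^ (1 / 2 : ℂ) * t) := by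
    ext x
    rw [← hyp0F1_sq hb, ← Complex.cpow_nat_mul]
    norm_num
  rw [h]
  have h1 := measurable_poissonWeight b
  refine Measurable.const_mul (StronglyMeasurable.measurable ?_) _
  refine StronglyMeasurable.integral_prod_right (f := fun (x : ℂ) (t : ℝ) => (poissonWeight b t : ℂ) * Complex.cosh (2 * x ^ (1 / 2 : ℂ) * t)) ?_
  apply Measurable.stronglyMeasurable
  unfold Function.uncurry
  have : Measurable fun p : ℂ × ℝ => Complex.cosh (2 * p.1 ^ (1 / 2 : ℂ) * p.2) := by
    apply Complex.measurable_cosh.comp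
    fun_prop
  exact (Complex.measurable_ofReal.comp (h1.comp measurable_snd)).mul this

/-! ### Large-argument behaviour of `₀F₁` -/

lemma ofReal_mul_cpow {r : ℝ} (hr : 0 < r) (z a : ℂ) : ((r : ℂ) * z) ^ a = (r : ℂ) ^ a * z ^ a := by
  rcases eq_or_ne z 0 with rfl | hz
  · rcases eq_or_ne a 0 with rfl | ha
    · simp
    · simp [Complex.zero_cpow ha]
  · have hr' : (r : ℂ) ≠ 0 := by exact_mod_cast hr.ne'
    rw [Complex.cpow_def_of_ne_zero (mul_ne_zero hr' hz), Complex.cpow_def_of_ne_zero hr',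
      Complex.cpow_def_of_ne_zero hz, ← Complex.exp_add, Complex.log_ofReal_mul hr hz,
      ← Complex.ofReal_log hr.le]
    ring_nf

lemma exists_rpow_mul_exp_neg_le (s : ℝ) : ∃ C, 0 < C ∧ ∀ x, 1 ≤ x → x ^ s * Real.exp (-x) ≤ C := by
  obtain ⟨k, hk⟩ := exists_nat_ge s
  refine ⟨k.factorial, by positivity, fun x hx => ?_⟩
  have h1 : x ^ s ≤ x ^ k := by
    rw [← Real.rpow_natCast]; exact Real.rpow_le_rpow_of_exponent_le hx hk
  have h2 := Real.pow_div_factorial_le_exp x (by linarith) k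
  rw [div_le_iff₀ (by positivity)] at h2
  rw [Real.exp_neg, mul_inv_le_iff₀ (Real.exp_pos x)]
  linarith

/-- First-order expansion of `(2 - τ)^κ` at `0`, with the function cut off at `τ = 1`. Thanks to the
cut-off the bound holds on the whole half-line, so that Watson's lemma needs no splitting. -/
lemma exists_two_sub_rpow_bound (κ : ℝ) : ∃ C, 0 ≤ C ∧ ∀ τ : ℝ, 0 < τ →
    |(Set.Ioo (0 : ℝ) 1).indicator (fun τ => (2 - τ) ^ κ) τ - 2 ^ κ * (1 - κ / 2 * τ)| ≤ C * τ ^ 2 := by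
  have hc : ContDiffOn ℝ (1 + 1) (fun τ : ℝ => (2 - τ) ^ κ) (Set.Icc 0 1) := by
    apply ContDiffOn.rpow_const_of_ne (by fun_prop)
    intro x hx
    linarith [hx.2]
  obtain ⟨C, hC⟩ := exists_taylor_mean_remainder_bound zero_le_one hc
  have hd : derivWithin (fun τ : ℝ => (2 - τ) ^ κ) (Set.Icc 0 1) 0 = -(2 ^ κ * (κ / 2)) := by
    have h1 : HasDerivAt (fun τ : ℝ => (2 - τ)) (-1) 0 := by
      simpa using (hasDerivAt_id (0:ℝ)).const_sub 2
    have h2 := (h1.rpow_const (p := κ) (Or.inl (by norm_num))).hasDerivWithinAt (s := Set.Icc 0 1)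
    rw [h2.derivWithin (uniqueDiffOn_Icc zero_lt_one 0 (by simp))]
    rw [sub_zero, Real.rpow_sub_one two_ne_zero]; ring
  refine ⟨max C 0 + 2 ^ κ * (1 + |κ|), by positivity, fun τ hτ => ?_⟩
  have hK : 0 ≤ (2:ℝ) ^ κ * (1 + |κ|) := by positivity
  by_cases h1 : τ < 1
  · have h2 : τ ∈ Set.Ioo (0:ℝ) 1 := ⟨hτ, h1⟩
    have h3 := hC τ ⟨hτ.le, h1.le⟩
    have h4 := taylorWithinEval_succ (fun τ : ℝ => (2 - τ) ^ κ) 0 (Set.Icc 0 1) 0 τ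
    rw [zero_add] at h4
    rw [h4, taylor_within_zero_eval, iteratedDerivWithin_one, hd] at h3
    simp only [sub_zero, zero_add, Nat.factorial_zero, Nat.cast_one, Nat.cast_zero, mul_one,
      inv_one, pow_one, one_mul, smul_eq_mul, one_add_one_eq_two, Real.norm_eq_abs] at h3
    rw [Set.indicator_of_mem h2]
    calc _ = |(2 - τ) ^ κ - (2 ^ κ + τ * -(2 ^ κ * (κ / 2)))| := by ring_nf
      _ ≤ C * τ ^ 2 := h3
      _ ≤ _ := by
        have := le_max_left C 0
        gcongr; linarith
  · have h2 : τ ∉ Set.Ioo (0:ℝ) 1 := fun h => h1 h.2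
    rw [Set.indicator_of_notMem h2, zero_sub, abs_neg, abs_mul, abs_of_pos (by positivity)]
    have h4 : |1 - κ / 2 * τ| ≤ (1 + |κ|) * τ ^ 2 := by
      have h5 : |1 - κ / 2 * τ| ≤ 1 + |κ| / 2 * τ := by
        refine (abs_sub _ _).trans ?_
        rw [abs_one, abs_mul, abs_div, abs_two, abs_of_pos hτ]
      push Not at h1
      nlinarith [abs_nonneg κ, mul_nonneg (abs_nonneg κ) (by nlinarith : 0 ≤ τ ^ 2 - τ)]
    calc _ ≤ (2:ℝ) ^ κ * ((1 + |κ|) * τ ^ 2) := by gcongr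
      _ ≤ _ := by
        have : 0 ≤ max C 0 * τ ^ 2 := by positivity
        linarith

/-- The two-term Watson expansion of the dominant exponential in Poisson's integral. -/
lemma exists_watson_bound {a : ℝ} (ha : 0 < a) : ∃ C, 0 ≤ C ∧ ∀ w : ℂ, 0 < w.re →
    ‖(∫ τ in Set.Ioo (0 : ℝ) 1, ((τ ^ (a - 1) * (2 - τ) ^ (a - 1) : ℝ) : ℂ) * Complex.exp (-w * τ))
      - ((2 ^ (a - 1) * Real.Gamma a : ℝ) : ℂ) * (w ^ (-a : ℂ) * (1 - ((a - 1) / 2 * a : ℝ) / w))‖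
      ≤ C * w.re ^ (-(a + 2)) := by
  obtain ⟨C, hC0, hC⟩ := exists_two_sub_rpow_bound (a - 1)
  refine ⟨C * Real.Gamma (a + 2), mul_nonneg hC0 (Real.Gamma_pos_of_pos (by linarith)).le,
    fun w hw => ?_⟩
  have hw0 : w ≠ 0 := by rintro rfl; simp at hw
  -- `G` is the integrand, extended by zero to the half-line, and `P` its two-term model.
  set G : ℝ → ℂ := fun τ => (((Set.Ioo (0 : ℝ) 1).indicator (fun τ => (2 - τ) ^ (a - 1)) τ : ℝ) : ℂ) *
    (((τ ^ (a - 1) : ℝ) : ℂ) * Complex.exp (-w * τ)) with hG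
  set P : ℝ → ℂ := fun τ => ((2 ^ (a - 1) : ℝ) : ℂ) * (((τ ^ (a - 1) : ℝ) : ℂ) * Complex.exp (-w * τ))
    - ((2 ^ (a - 1) * ((a - 1) / 2) : ℝ) : ℂ) * (((τ ^ (a + 1 - 1) : ℝ) : ℂ) * Complex.exp (-w * τ)) with hP
  have hPi : IntegrableOn P (Set.Ioi 0) :=
    ((integrableOn_rpow_mul_cexp_neg ha hw).const_mul _).sub
      ((integrableOn_rpow_mul_cexp_neg (by linarith) hw).const_mul _)
  have hPv : ∫ τ in Set.Ioi (0:ℝ), P τ =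
      ((2 ^ (a - 1) * Real.Gamma a : ℝ) : ℂ) * (w ^ (-a : ℂ) * (1 - ((a - 1) / 2 * a : ℝ) / w)) := by
    rw [hP, integral_sub ((integrableOn_rpow_mul_cexp_neg ha hw).const_mul _)
      ((integrableOn_rpow_mul_cexp_neg (by linarith) hw).const_mul _), integral_const_mul,
      integral_const_mul, integral_rpow_mul_cexp_neg ha hw,
      integral_rpow_mul_cexp_neg (by linarith) hw, Real.Gamma_add_one ha.ne']
    have : w ^ (-((a + 1 : ℝ) : ℂ)) = w ^ (-a : ℂ) / w := by
      rw [Complex.ofReal_add, neg_add, Complex.ofReal_one, ← sub_eq_add_neg,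
        Complex.cpow_sub _ _ hw0, Complex.cpow_one]
    rw [this]
    push_cast
    ring
  have hbound : ∀ τ ∈ Set.Ioi (0:ℝ), ‖G τ - P τ‖ ≤ C * (τ ^ (a + 2 - 1) * Real.exp (-w.re * τ)) := by
    intro τ hτ
    have hτ : 0 < τ := hτ
    have h1 : G τ - P τ = (((Set.Ioo (0 : ℝ) 1).indicator (fun τ => (2 - τ) ^ (a - 1)) τ
        - 2 ^ (a - 1) * (1 - (a - 1) / 2 * τ) : ℝ) : ℂ) *
        (((τ ^ (a - 1) : ℝ) : ℂ) * Complex.exp (-w * τ)) := by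
      simp only [hG, hP]
      rw [add_sub_right_comm, Real.rpow_add_one hτ.ne']
      push_cast; ring
    rw [h1, norm_mul, norm_mul, norm_cexp_neg_mul_ofReal, Complex.norm_real, Complex.norm_real,
      Real.norm_eq_abs, Real.norm_of_nonneg (Real.rpow_nonneg hτ.le _)]
    have h2 : τ ^ (a + 2 - 1) = τ ^ 2 * τ ^ (a - 1) := by
      rw [show a + 2 - 1 = 2 + (a - 1) by ring, Real.rpow_add hτ, Real.rpow_two]
    rw [h2]
    calc _ ≤ C * τ ^ 2 * (τ ^ (a - 1) * Real.exp (-w.re * τ)) := by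
          gcongr; exact hC τ hτ
      _ = _ := by ring
  have hgi := (integrableOn_rpow_mul_exp_neg (a := a + 2) (by linarith) hw).const_mul C
  have hDi : IntegrableOn (fun τ => G τ - P τ) (Set.Ioi 0) := by
    refine hgi.mono' ?_ ?_
    · apply Measurable.aestronglyMeasurable
      have : Measurable ((Set.Ioo (0 : ℝ) 1).indicator (fun τ => (2 - τ) ^ (a - 1))) :=
        (by fun_prop : Measurable fun τ : ℝ => (2 - τ) ^ (a - 1)).indicator measurableSet_Ioo
      fun_prop
    · filter_upwards [ae_restrict_mem measurableSet_Ioi] with τ hτ using hbound τ hτ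
  have hGv : (∫ τ in Set.Ioo (0 : ℝ) 1, ((τ ^ (a - 1) * (2 - τ) ^ (a - 1) : ℝ) : ℂ) *
      Complex.exp (-w * τ)) = ∫ τ in Set.Ioi (0:ℝ), G τ := by
    rw [← integral_indicator measurableSet_Ioo, ← integral_indicator measurableSet_Ioi]
    congr 1; ext τ
    by_cases h : τ ∈ Set.Ioo (0:ℝ) 1
    · rw [Set.indicator_of_mem h, Set.indicator_of_mem (Set.Ioo_subset_Ioi_self h)]
      simp only [hG, Set.indicator_of_mem h]
      push_cast; ring
    · rw [Set.indicator_of_notMem h]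
      simp only [hG]
      by_cases h' : τ ∈ Set.Ioi (0:ℝ)
      · rw [Set.indicator_of_mem h', Set.indicator_of_notMem h]; simp
      · rw [Set.indicator_of_notMem h']
  have hGi : IntegrableOn G (Set.Ioi 0) := by
    have h := hDi.add hPi
    rwa [show (fun τ => G τ - P τ) + P = G by ext; simp] at h
  rw [hGv, ← hPv, ← integral_sub hGi hPi]
  refine (norm_integral_le_of_norm_le hgi ?_).trans_eq ?_
  · filter_upwards [ae_restrict_mem measurableSet_Ioi] with τ hτ using hbound τ hτ
  · rw [integral_const_mul]
    simp only [neg_mul]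
    rw [Real.integral_rpow_mul_exp_neg_mul_Ioi (by linarith) hw, one_div, Real.inv_rpow hw.le,
      ← Real.rpow_neg hw.le]
    ring

/-- The substitution `t = 1 - τ`, which moves the maximum of the exponential to `τ = 0`. -/
lemma integral_poissonWeight_mul_cexp (b : ℝ) (w : ℂ) :
    ∫ t in Set.Ioo (0 : ℝ) 1, (poissonWeight b t : ℂ) * Complex.exp (w * t) = Complex.exp w *
      ∫ τ in Set.Ioo (0 : ℝ) 1, ((τ ^ (b - 3 / 2) * (2 - τ) ^ (b - 3 / 2) : ℝ) : ℂ)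
        * Complex.exp (-w * τ) := by
  rw [← integral_Ioc_eq_integral_Ioo, ← intervalIntegral.integral_of_le zero_le_one,
    ← integral_Ioc_eq_integral_Ioo, ← intervalIntegral.integral_of_le zero_le_one]
  have := intervalIntegral.integral_comp_sub_left (a := 0) (b := 1)
    (fun t : ℝ => (poissonWeight b t : ℂ) * Complex.exp (w * t)) 1
  rw [sub_self, sub_zero] at this
  rw [← this, ← intervalIntegral.integral_const_mul]
  refine intervalIntegral.integral_congr fun τ hτ => ?_
  rw [Set.uIcc_of_le zero_le_one] at hτ
  have h1 : poissonWeight b (1 - τ) = τ ^ (b - 3 / 2) * (2 - τ) ^ (b - 3 / 2) := by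
    rw [poissonWeight, ← Real.mul_rpow hτ.1 (by linarith [hτ.2])]
    congr 1; ring
  have h2 : Complex.exp (w * (1 - τ : ℝ)) = Complex.exp w * Complex.exp (-w * τ) := by
    rw [← Complex.exp_add]; push_cast; ring_nf
  simp only [h1, h2]
  ring

/-- The factor that normalises `₀F₁(b, ζ²)` to tend to `1`. -/
def hypNormalizer (b : ℝ) (ζ : ℂ) : ℂ :=
  ((2 * √Real.pi / Real.Gamma b : ℝ) : ℂ) * ζ ^ ((b - 1 / 2 : ℝ) : ℂ) * Complex.exp (-(2 * ζ))

/-- The second coefficient of the large-argument expansion of `₀F₁(b, ζ²)`. -/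
def hypCoeff (b : ℝ) : ℝ := -((b - 3 / 2) * (b - 1 / 2) / 4)

/-- In a sector about the positive axis, `₀F₁(b, ζ²)` is
`Γ(b) / (2√π) ζ^(1/2-b) e^(2ζ) (1 + c_b / ζ + O(ζ⁻²))`. -/
lemma exists_hyp0F1_bound {b : ℝ} (hb : 1 / 2 < b) : ∃ C, 0 ≤ C ∧ ∀ ζ : ℂ, 1 ≤ ζ.re → ‖ζ‖ ≤ 2 * ζ.re →
    ‖hyp0F1 b (ζ ^ 2) * hypNormalizer b ζ - (1 + hypCoeff b / ζ)‖ ≤ C / ‖ζ‖ ^ 2 := by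
  have ha : 0 < b - 1 / 2 := by linarith
  obtain ⟨C₁, hC₁0, hC₁⟩ := exists_watson_bound ha
  obtain ⟨C₂, hC₂0, hC₂⟩ := exists_rpow_mul_exp_neg_le (b - 1 / 2 + 2)
  set a := b - 1 / 2 with hab
  have hΓ : 0 < Real.Gamma a := Real.Gamma_pos_of_pos ha
  have hΓb : 0 < Real.Gamma b := Real.Gamma_pos_of_pos (by linarith)
  set m := ∫ t in Set.Ioo (0 : ℝ) 1, poissonWeight b t with hm
  have hm0 : 0 ≤ m := setIntegral_nonneg measurableSet_Ioo fun t ht => poissonWeight_nonneg ht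
  refine ⟨2 / Real.Gamma a * (C₁ + m * C₂), by positivity, fun ζ h1 h2 => ?_⟩
  have hre : 0 < ζ.re := by linarith
  have hζ0 : ζ ≠ 0 := by rintro rfl; simp at hre
  have hζn : 0 < ‖ζ‖ := norm_pos_iff.2 hζ0
  -- The hyperbolic cosine splits into two exponentials: `J` carries the dominant one, `K` the
  -- exponentially small one.
  set J : ℂ := ∫ τ in Set.Ioo (0 : ℝ) 1, ((τ ^ (a - 1) * (2 - τ) ^ (a - 1) : ℝ) : ℂ) *
    Complex.exp (-(2 * ζ) * τ) with hJ
  set K : ℂ := ∫ t in Set.Ioo (0 : ℝ) 1, (poissonWeight b t : ℂ) * Complex.exp (-(2 * ζ) * t) with hK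
  have hωi : ∀ w : ℂ, IntegrableOn (fun t : ℝ => (poissonWeight b t : ℂ) * Complex.exp (w * t))
      (Set.Ioo (0:ℝ) 1) := by
    intro w
    refine ((integrableOn_poissonWeight hb).mul_const (Real.exp |w.re|)).mono' ?_ ?_
    · have := measurable_poissonWeight b
      apply Measurable.aestronglyMeasurable; fun_prop
    · filter_upwards [ae_restrict_mem measurableSet_Ioo] with t ht
      rw [norm_mul, Complex.norm_real, Real.norm_of_nonneg (poissonWeight_nonneg ht),
        Complex.norm_exp]
      refine mul_le_mul_of_nonneg_left (Real.exp_le_exp.2 ?_) (poissonWeight_nonneg ht)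
      have : (w * t).re = w.re * t := by simp
      rw [this]
      nlinarith [le_abs_self w.re, abs_nonneg w.re, ht.1, ht.2]
  have hF : hyp0F1 b (ζ ^ 2) = poissonConst b / 2 * (Complex.exp (2 * ζ) * J + K) := by
    have e1 := integral_poissonWeight_mul_cexp b (2 * ζ)
    rw [show b - 3 / 2 = a - 1 by rw [hab]; ring] at e1
    rw [hyp0F1_sq hb, ← e1, hK, ← integral_add (hωi _) (hωi _), div_mul_eq_mul_div, mul_div_assoc,
      ← integral_div]
    congr 2; ext t
    rw [Complex.cosh, neg_mul]; ring
  have hKn : ‖K‖ ≤ m := by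
    refine norm_integral_le_of_norm_le (integrableOn_poissonWeight hb) ?_
    filter_upwards [ae_restrict_mem measurableSet_Ioo] with t ht
    rw [norm_mul, Complex.norm_real, Real.norm_of_nonneg (poissonWeight_nonneg ht),
      norm_cexp_neg_mul_ofReal]
    refine mul_le_of_le_one_right (poissonWeight_nonneg ht) (Real.exp_le_one_iff.2 ?_)
    have : (2 * ζ).re = 2 * ζ.re := by simp
    rw [this]
    nlinarith [ht.1]
  have hJn := hC₁ (2 * ζ) (by simp; linarith)
  rw [← hJ] at hJn
  have hexp : Complex.exp (-(2 * ζ)) * Complex.exp (2 * ζ) = 1 := by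
    rw [← Complex.exp_add]; simp
  have hconst : (2 * √Real.pi / Real.Gamma b) * (poissonConst b / 2) = 2 / Real.Gamma a := by
    have : √Real.pi ≠ 0 := (Real.sqrt_pos.2 Real.pi_pos).ne'
    rw [poissonConst, ← hab]
    field_simp
  have hmain : ζ ^ (a : ℂ) * ((2 / Real.Gamma a : ℝ) : ℂ) *
      (((2 ^ (a - 1) * Real.Gamma a : ℝ) : ℂ) * ((2 * ζ) ^ (-a : ℂ) *
        (1 - ((a - 1) / 2 * a : ℝ) / (2 * ζ)))) = 1 + hypCoeff b / ζ := by
    have e2 : (2 * ζ) ^ (-a : ℂ) = ((2 ^ (-a) : ℝ) : ℂ) * ζ ^ (-a : ℂ) := by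
      have := ofReal_mul_cpow two_pos ζ (-a : ℂ)
      rw [Complex.ofReal_cpow two_pos.le]
      push_cast at this ⊢
      exact this
    have e3 : ζ ^ (a : ℂ) * ζ ^ (-a : ℂ) = 1 := by
      rw [← Complex.cpow_add _ _ hζ0, add_neg_cancel, Complex.cpow_zero]
    have e4 : (2 / Real.Gamma a) * (2 ^ (a - 1) * Real.Gamma a) * 2 ^ (-a) = 1 := by
      rw [Real.rpow_sub_one two_ne_zero, Real.rpow_neg two_pos.le]
      field_simp
    have e5 : (1 : ℂ) - ((a - 1) / 2 * a : ℝ) / (2 * ζ) = 1 + hypCoeff b / ζ := by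
      rw [hypCoeff, ← hab, show b - 3 / 2 = a - 1 by rw [hab]; ring]
      push_cast
      field_simp
      ring
    rw [e2, e5]
    have e4' := congrArg (fun x : ℝ => (x : ℂ)) e4
    push_cast at e4' ⊢
    linear_combination ((1 + hypCoeff b / ζ) * ζ ^ (a : ℂ) * ζ ^ (-a : ℂ)) * e4'
      + (1 + hypCoeff b / ζ) * e3
  have hdecomp : hyp0F1 b (ζ ^ 2) * hypNormalizer b ζ - (1 + hypCoeff b / ζ)
      = ζ ^ (a : ℂ) * ((2 / Real.Gamma a : ℝ) : ℂ) * ((J - ((2 ^ (a - 1) * Real.Gamma a : ℝ) : ℂ) *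
        ((2 * ζ) ^ (-a : ℂ) * (1 - ((a - 1) / 2 * a : ℝ) / (2 * ζ))))
        + Complex.exp (-(2 * ζ)) * K) := by
    rw [mul_add, mul_sub, hmain, hF, hypNormalizer, ← hconst, ← hab]
    push_cast
    linear_combination (2 * (√Real.pi : ℂ) / (Real.Gamma b : ℂ) * (poissonConst b / 2)
      * ζ ^ (a : ℂ) * J) * hexp
  rw [hdecomp, norm_mul, norm_mul, Complex.norm_cpow_real, Complex.norm_real,
    Real.norm_of_nonneg (by positivity)]
  have hre2 : (2 * ζ).re = 2 * ζ.re := by simp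
  rw [hre2] at hJn
  have hle : (2 * ζ.re) ^ (-(a + 2)) ≤ ‖ζ‖ ^ (-(a + 2)) :=
    Real.rpow_le_rpow_of_nonpos hζn h2 (by linarith)
  have hKe : ‖Complex.exp (-(2 * ζ)) * K‖ ≤ m * C₂ * ‖ζ‖ ^ (-(a + 2)) := by
    rw [norm_mul, Complex.norm_exp, Complex.neg_re, hre2]
    have h3 := hC₂ (2 * ζ.re) (by linarith)
    have h4 : Real.exp (-(2 * ζ.re)) ≤ C₂ * ‖ζ‖ ^ (-(a + 2)) := by
      refine le_trans ?_ (mul_le_mul_of_nonneg_left hle hC₂0.le)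
      rw [Real.rpow_neg (by linarith), ← div_eq_mul_inv, le_div_iff₀ (by positivity)]
      linarith
    calc _ ≤ (C₂ * ‖ζ‖ ^ (-(a + 2))) * m := by gcongr
      _ = _ := by ring
  have hfin := (norm_add_le _ _).trans (add_le_add (hJn.trans (mul_le_mul_of_nonneg_left hle hC₁0)) hKe)
  have hpow : ‖ζ‖ ^ a * ‖ζ‖ ^ (-(a + 2)) = 1 / ‖ζ‖ ^ 2 := by
    rw [← Real.rpow_add hζn, show a + -(a + 2) = -2 by ring, Real.rpow_neg hζn.le, Real.rpow_two,
      one_div]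
  calc _ ≤ ‖ζ‖ ^ a * (2 / Real.Gamma a) * (C₁ * ‖ζ‖ ^ (-(a + 2)) + m * C₂ * ‖ζ‖ ^ (-(a + 2))) := by
        gcongr
    _ = 2 / Real.Gamma a * (C₁ + m * C₂) * (‖ζ‖ ^ a * ‖ζ‖ ^ (-(a + 2))) := by ring
    _ = _ := by rw [hpow]; ring

/-! ### The MacDonald function -/

lemma one_add_two_mul_sinh_sq (t : ℝ) : Real.cosh t = 1 + 2 * Real.sinh (t / 2) ^ 2 := by
  have h := Real.cosh_two_mul (t / 2)
  rw [mul_div_cancel₀ t two_ne_zero, Real.cosh_sq] at h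
  linarith

lemma one_add_sq_half_le_cosh {t : ℝ} (ht : 0 ≤ t) : 1 + t ^ 2 / 2 ≤ Real.cosh t := by
  rw [one_add_two_mul_sinh_sq]
  have h : t / 2 ≤ Real.sinh (t / 2) := Real.self_le_sinh_iff.2 (by linarith)
  nlinarith

lemma cosh_mul_le_exp (p : ℝ) {x t : ℝ} (hx : 0 < x) :
    Real.cosh (p * t) ≤ Real.exp (p ^ 2 / x) * Real.exp (x / 4 * t ^ 2) := by
  rw [← Real.exp_add]
  have key : ∀ q : ℝ, q ^ 2 = p ^ 2 → q * t ≤ p ^ 2 / x + x / 4 * t ^ 2 := by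
    intro q hq
    rw [← hq, ← sub_nonneg]
    have : q ^ 2 / x + x / 4 * t ^ 2 - q * t = (q - x * t / 2) ^ 2 / x := by field_simp; ring
    rw [this]; positivity
  have h1 := Real.exp_le_exp.2 (key p rfl)
  have h2 := Real.exp_le_exp.2 (key (-p) (by ring))
  rw [Real.cosh_eq]
  rw [neg_mul] at h2
  linarith

lemma exp_neg_mul_cosh_le {x t : ℝ} (hx : 0 < x) (ht : 0 ≤ t) :
    Real.exp (-x * Real.cosh t) ≤ Real.exp (-x) * Real.exp (-(x / 2) * t ^ 2) := by
  rw [← Real.exp_add]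
  apply Real.exp_le_exp.2
  nlinarith [one_add_sq_half_le_cosh ht]

lemma integrableOn_exp_neg_mul_cosh (p : ℝ) {x : ℝ} (hx : 0 < x) :
    IntegrableOn (fun t => Real.exp (-x * Real.cosh t) * Real.cosh (p * t)) (Set.Ioi 0) := by
  have hg : IntegrableOn (fun t : ℝ => Real.exp (-x) * Real.exp (p ^ 2 / x) *
      Real.exp (-(x / 4) * t ^ 2)) (Set.Ioi 0) :=
    ((integrable_exp_neg_mul_sq (by linarith : 0 < x / 4)).const_mul _).integrableOn
  refine hg.mono' ?_ ?_
  · apply Measurable.aestronglyMeasurable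
    have := Real.measurable_cosh
    fun_prop
  · filter_upwards [ae_restrict_mem measurableSet_Ioi] with t ht
    have ht : 0 < t := ht
    rw [Real.norm_of_nonneg (mul_nonneg (Real.exp_pos _).le (Real.cosh_pos _).le)]
    calc _ ≤ (Real.exp (-x) * Real.exp (-(x / 2) * t ^ 2)) *
          (Real.exp (p ^ 2 / x) * Real.exp (x / 4 * t ^ 2)) :=
        mul_le_mul (exp_neg_mul_cosh_le hx ht.le) (cosh_mul_le_exp p hx) (Real.cosh_pos _).le
          (by positivity)
      _ = Real.exp (-x) * Real.exp (p ^ 2 / x) *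
          (Real.exp (-(x / 2) * t ^ 2) * Real.exp (x / 4 * t ^ 2)) := by ring
      _ = _ := by rw [← Real.exp_add (-(x / 2) * t ^ 2)]; congr 2; ring

lemma besselK_nonneg (p x : ℝ) : 0 ≤ besselK p x :=
  integral_nonneg fun _ => mul_nonneg (Real.exp_pos _).le (Real.cosh_pos _).le

/-- Enlarging the argument of `K_p` by `y` costs at least the factor `e^(-y)`. -/
lemma besselK_add_le (p : ℝ) {x y : ℝ} (hx : 0 < x) (hy : 0 ≤ y) :
    besselK p (x + y) ≤ Real.exp (-y) * besselK p x := by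
  rw [besselK, besselK, ← integral_const_mul]
  refine setIntegral_mono_on (integrableOn_exp_neg_mul_cosh p (by linarith))
    ((integrableOn_exp_neg_mul_cosh p hx).const_mul _) measurableSet_Ioi fun t _ => ?_
  rw [← mul_assoc, ← Real.exp_add]
  refine mul_le_mul_of_nonneg_right (Real.exp_le_exp.2 ?_) (Real.cosh_pos _).le
  nlinarith [Real.one_le_cosh t]

lemma measurable_besselK (p : ℝ) : Measurable (besselK p) := by
  unfold besselK
  refine StronglyMeasurable.measurable ?_
  refine StronglyMeasurable.integral_prod_right
    (f := fun x t : ℝ => Real.exp (-x * Real.cosh t) * Real.cosh (p * t)) ?_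
  apply Measurable.stronglyMeasurable
  have := Real.measurable_cosh
  unfold Function.uncurry
  fun_prop

/-- The substitution `y = sinh (t / 2)`, under which `cosh t - 1 = 2 y²`. -/
lemma integral_exp_neg_mul_cosh_mul (x : ℝ) (g : ℝ → ℝ) :
    ∫ t in Set.Ioi (0 : ℝ), Real.exp (-x * (Real.cosh t - 1)) *
      (Real.cosh (t / 2) * g (Real.sinh (t / 2)))
      = 2 * ∫ y in Set.Ioi (0 : ℝ), Real.exp (-(2 * x) * y ^ 2) * g y := by
  have himg : (fun t : ℝ => Real.sinh (t / 2)) '' Set.Ioi 0 = Set.Ioi 0 := by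
    ext y
    simp only [Set.mem_image, Set.mem_Ioi]
    constructor
    · rintro ⟨t, ht, rfl⟩
      exact Real.sinh_pos_iff.2 (by linarith)
    · intro hy
      refine ⟨2 * Real.arsinh y, ?_, ?_⟩
      · have := Real.arsinh_pos_iff.2 hy; linarith
      · rw [mul_div_cancel_left₀ _ two_ne_zero, Real.sinh_arsinh]
  have h := integral_image_eq_integral_abs_deriv_smul (s := Set.Ioi (0:ℝ))
    (f := fun t : ℝ => Real.sinh (t / 2)) (f' := fun t => Real.cosh (t / 2) * (1 / 2))
    measurableSet_Ioi
    (fun t _ => ((Real.hasDerivAt_sinh _).comp t ((hasDerivAt_id t).div_const 2)).hasDerivWithinAt)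
    (fun a _ b _ hab => by
      have := Real.sinh_injective hab
      linarith) (fun y => Real.exp (-(2 * x) * y ^ 2) * g y)
  rw [himg] at h
  rw [h, ← integral_const_mul]
  refine setIntegral_congr_fun measurableSet_Ioi fun t _ => ?_
  simp only [smul_eq_mul]
  rw [abs_of_pos (by have := Real.cosh_pos (t / 2); positivity), one_add_two_mul_sinh_sq t]
  ring_nf

lemma integral_sq_mul_gaussian_Ioi {b : ℝ} (hb : 0 < b) :
    ∫ y in Set.Ioi (0 : ℝ), Real.exp (-b * y ^ 2) * y ^ 2 = √(Real.pi / b) / 2 / (2 * b) := by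
  have h := integral_rpow_mul_exp_neg_mul_rpow (p := 2) (q := 2) (b := b) two_pos (by norm_num) hb
  have h' : ∫ y in Set.Ioi (0 : ℝ), Real.exp (-b * y ^ 2) * y ^ 2
      = ∫ x in Set.Ioi (0 : ℝ), x ^ (2:ℝ) * Real.exp (-b * x ^ (2:ℝ)) := by
    refine setIntegral_congr_fun measurableSet_Ioi fun t _ => ?_
    simp only [Real.rpow_two]; ring
  rw [h', h]
  have hΓ : Real.Gamma ((2 + 1) / 2) = √Real.pi / 2 := by
    rw [show ((2:ℝ) + 1) / 2 = 1 / 2 + 1 by norm_num, Real.Gamma_add_one (by norm_num),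
      Real.Gamma_one_half_eq]; ring
  have hpow : b ^ (-(2 + 1 : ℝ) / 2) = (√b)⁻¹ * b⁻¹ := by
    rw [show (-(2 + 1 : ℝ) / 2) = -(1 / 2) + -1 by norm_num, Real.rpow_add hb, Real.rpow_neg hb.le,
      Real.rpow_neg_one, Real.sqrt_eq_rpow]
  rw [hΓ, hpow, Real.sqrt_div Real.pi_pos.le]
  have : √b ≠ 0 := (Real.sqrt_pos.2 hb).ne'
  field_simp

lemma abs_cosh_sub_le (x : ℝ) :
    |Real.cosh x - 1 - x ^ 2 / 2| ≤ x ^ 4 * Real.exp |x| := by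
  have key : ∀ y : ℝ, |Real.exp y - (1 + y + y ^ 2 / 2 + y ^ 3 / 6)| ≤ y ^ 4 * Real.exp |y| := by
    intro y
    have h := Complex.norm_exp_sub_sum_le_norm_mul_exp (y : ℂ) 4
    have e : Complex.exp y - ∑ m ∈ Finset.range 4, (y : ℂ) ^ m / m.factorial
        = ((Real.exp y - (1 + y + y ^ 2 / 2 + y ^ 3 / 6) : ℝ) : ℂ) := by
      simp [Finset.sum_range_succ, Nat.factorial]
    rw [e, Complex.norm_real, Complex.norm_real, Real.norm_eq_abs, Real.norm_eq_abs,
      show |y| ^ 4 = y ^ 4 from Even.pow_abs (by decide) y] at h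
    exact h
  have h1 := key x
  have h2 := key (-x)
  rw [abs_neg] at h2
  rw [abs_le] at h1 h2 ⊢
  rw [Real.cosh_eq]
  constructor <;> nlinarith [h1.1, h1.2, h2.1, h2.2]

/-- The normalising factor of `K_p` at infinity. -/
def besselNormalizer (x : ℝ) : ℝ := √(2 * x / Real.pi) * Real.exp x

/-- The second coefficient of the large-argument expansion of `K_p`. -/
def besselCoeff (p : ℝ) : ℝ := (4 * p ^ 2 - 1) / 8

/-- The deviation of `cosh(pt)` from `cosh(t/2) (1 + c sinh²(t/2))`, where `c` is chosen to match
the Taylor expansions at `0` through order three. -/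
lemma exists_cosh_comparison (p : ℝ) : ∃ A, 0 ≤ A ∧ ∀ x t : ℝ, 1 ≤ x → 0 < t →
    |Real.cosh (p * t) - Real.cosh (t / 2) * (1 + (2 * p ^ 2 - 1 / 2) * Real.sinh (t / 2) ^ 2)|
      ≤ A * (t ^ 4 * Real.exp (x / 4 * t ^ 2)) := by
  set c := 2 * p ^ 2 - 1 / 2 with hc
  have hterm : ∀ q x t : ℝ, 1 ≤ x → 0 < t → |Real.cosh (q * t) - 1 - (q * t) ^ 2 / 2|
      ≤ q ^ 4 * Real.exp (q ^ 2) * (t ^ 4 * Real.exp (x / 4 * t ^ 2)) := by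
    intro q x t hx ht
    refine (abs_cosh_sub_le _).trans ?_
    have : Real.exp |q * t| ≤ Real.exp (q ^ 2) * Real.exp (x / 4 * t ^ 2) := by
      rw [← Real.exp_add]
      apply Real.exp_le_exp.2
      rw [abs_mul, abs_of_pos ht, ← sq_abs q]
      nlinarith [sq_nonneg (|q| - t / 2), sq_nonneg t]
    calc _ ≤ (q * t) ^ 4 * (Real.exp (q ^ 2) * Real.exp (x / 4 * t ^ 2)) := by gcongr
      _ = _ := by ring
  refine ⟨p ^ 4 * Real.exp (p ^ 2) + |-1 + c / 4| * ((1 / 2) ^ 4 * Real.exp ((1 / 2) ^ 2))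
    + |c / 4| * ((3 / 2) ^ 4 * Real.exp ((3 / 2) ^ 2)), by positivity, fun x t hx ht => ?_⟩
  have h3 : Real.cosh (t / 2) * Real.sinh (t / 2) ^ 2
      = (Real.cosh (3 / 2 * t) - Real.cosh (1 / 2 * t)) / 4 := by
    have := Real.cosh_three_mul (t / 2)
    rw [show 3 * (t / 2) = 3 / 2 * t by ring] at this
    rw [this, Real.sinh_sq, show 1 / 2 * t = t / 2 by ring]; ring
  have e : Real.cosh (p * t) - Real.cosh (t / 2) * (1 + c * Real.sinh (t / 2) ^ 2)
      = (Real.cosh (p * t) - 1 - (p * t) ^ 2 / 2)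
        + (-1 + c / 4) * (Real.cosh (1 / 2 * t) - 1 - (1 / 2 * t) ^ 2 / 2)
        - c / 4 * (Real.cosh (3 / 2 * t) - 1 - (3 / 2 * t) ^ 2 / 2) := by
    have h4 : Real.cosh (t / 2) * (1 + c * Real.sinh (t / 2) ^ 2)
      = Real.cosh (t / 2) + c * (Real.cosh (t / 2) * Real.sinh (t / 2) ^ 2) := by ring
    rw [h4, h3, show t / 2 = 1 / 2 * t by ring, hc]
    ring
  rw [e]
  refine (abs_sub _ _).trans ((add_le_add (abs_add_le _ _) le_rfl).trans ?_)
  rw [abs_mul, abs_mul (c / 4)]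
  have h1 := hterm p x t hx ht
  have h2 := mul_le_mul_of_nonneg_left (hterm (1 / 2) x t hx ht) (abs_nonneg (-1 + c / 4))
  have h4 := mul_le_mul_of_nonneg_left (hterm (3 / 2) x t hx ht) (abs_nonneg (c / 4))
  linarith

/-- `K_p(x) = √(π/(2x)) e^(-x) (1 + (4p² - 1)/(8x) + O(x⁻²))`. -/
lemma exists_besselK_bound (p : ℝ) : ∃ C, 0 ≤ C ∧ ∀ x : ℝ, 1 ≤ x →
    |besselK p x * besselNormalizer x - (1 + besselCoeff p / x)| ≤ C / x ^ 2 := by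
  obtain ⟨A, hA0, hA⟩ := exists_cosh_comparison p
  set c := 2 * p ^ 2 - 1 / 2 with hc
  have hΓ : 0 < Real.Gamma ((4 + 1) / 2) := Real.Gamma_pos_of_pos (by norm_num)
  refine ⟨A * ((1 / 4) ^ (-(4 + 1 : ℝ) / 2) * (1 / 2) * Real.Gamma ((4 + 1) / 2))
    * √(2 / Real.pi), by positivity, fun x hx => ?_⟩
  have hx0 : 0 < x := by linarith
  set E : ℝ → ℝ := fun t => Real.exp (-x * (Real.cosh t - 1)) with hE
  set M : ℝ → ℝ := fun t => Real.cosh (t / 2) * (1 + c * Real.sinh (t / 2) ^ 2) with hM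
  have hKe : besselK p x * Real.exp x = ∫ t in Set.Ioi (0:ℝ), E t * Real.cosh (p * t) := by
    rw [besselK, ← integral_mul_const]
    congr 1; ext t
    simp only [hE]
    rw [mul_right_comm, ← Real.exp_add]; ring_nf
  have hMv : ∫ t in Set.Ioi (0:ℝ), E t * M t = √(Real.pi / (2 * x)) * (1 + besselCoeff p / x) := by
    simp only [hE, hM]
    rw [integral_exp_neg_mul_cosh_mul x (fun y => 1 + c * y ^ 2)]
    simp_rw [mul_add, mul_one, mul_left_comm _ c]
    rw [integral_add, integral_const_mul, integral_gaussian_Ioi, integral_sq_mul_gaussian_Ioi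
      (by positivity), besselCoeff, hc]
    · field_simp; ring
    · exact (integrable_exp_neg_mul_sq (by positivity)).integrableOn
    · have := (integrable_rpow_mul_exp_neg_mul_sq (b := 2 * x) (s := 2) (by positivity)
        (by norm_num)).const_mul c
      simp_rw [Real.rpow_two, mul_comm (_ ^ 2)] at this
      exact this.integrableOn
  set D : ℝ → ℝ := fun t => A * (t ^ (4:ℝ) * Real.exp (-(x / 4) * t ^ (2:ℝ))) with hD
  have hDi : IntegrableOn D (Set.Ioi 0) :=
    (integrableOn_rpow_mul_exp_neg_mul_rpow (p := 2) (by norm_num) (by norm_num)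
      (by positivity)).const_mul A
  have hbound : ∀ t ∈ Set.Ioi (0:ℝ), ‖E t * Real.cosh (p * t) - E t * M t‖ ≤ D t := by
    intro t ht
    have ht : 0 < t := ht
    have h1 : E t ≤ Real.exp (-(x / 2) * t ^ 2) :=
      Real.exp_le_exp.2 (by nlinarith [one_add_sq_half_le_cosh ht.le])
    rw [← mul_sub, norm_mul, Real.norm_eq_abs, Real.norm_eq_abs, abs_of_pos (Real.exp_pos _)]
    calc _ ≤ Real.exp (-(x / 2) * t ^ 2) * (A * (t ^ 4 * Real.exp (x / 4 * t ^ 2))) :=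
          mul_le_mul h1 (hA x t hx ht) (abs_nonneg _) (Real.exp_pos _).le
      _ = A * (t ^ 4 * (Real.exp (-(x / 2) * t ^ 2) * Real.exp (x / 4 * t ^ 2))) := by ring
      _ = D t := by
          simp only [hD]
          rw [← Real.exp_add, Real.rpow_two, show (4:ℝ) = (4:ℕ) by norm_num, Real.rpow_natCast]
          ring_nf
  have hEK : IntegrableOn (fun t => E t * Real.cosh (p * t)) (Set.Ioi 0) := by
    have := (integrableOn_exp_neg_mul_cosh p hx0).mul_const (Real.exp x)
    refine this.congr (Eventually.of_forall fun t => ?_)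
    simp only [hE]
    rw [mul_right_comm, ← Real.exp_add]; ring_nf
  have hDf : IntegrableOn (fun t => E t * Real.cosh (p * t) - E t * M t) (Set.Ioi 0) := by
    refine hDi.mono' ?_ ?_
    · apply Measurable.aestronglyMeasurable
      have h1 := Real.measurable_cosh
      have h2 := Real.measurable_sinh
      simp only [hE, hM]
      fun_prop
    · filter_upwards [ae_restrict_mem measurableSet_Ioi] with t ht using hbound t ht
  have hEM : IntegrableOn (fun t => E t * M t) (Set.Ioi 0) := by
    have h := hEK.sub hDf
    simp only [Pi.sub_def, sub_sub_cancel] at h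
    exact h
  have hdiff : |besselK p x * Real.exp x - √(Real.pi / (2 * x)) * (1 + besselCoeff p / x)|
      ≤ A * ((x / 4) ^ (-(4 + 1 : ℝ) / 2) * (1 / 2) * Real.Gamma ((4 + 1) / 2)) := by
    rw [hKe, ← hMv, ← integral_sub hEK hEM, ← integral_rpow_mul_exp_neg_mul_rpow two_pos
      (by norm_num) (by positivity), ← integral_const_mul, ← Real.norm_eq_abs]
    refine norm_integral_le_of_norm_le hDi ?_
    filter_upwards [ae_restrict_mem measurableSet_Ioi] with t ht using hbound t ht
  have hsq : √(2 * x / Real.pi) * √(Real.pi / (2 * x)) = 1 := by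
    rw [← Real.sqrt_mul (by positivity)]
    have := Real.pi_pos.ne'
    rw [show 2 * x / Real.pi * (Real.pi / (2 * x)) = 1 by field_simp, Real.sqrt_one]
  have e : besselK p x * besselNormalizer x - (1 + besselCoeff p / x) = √(2 * x / Real.pi) *
      (besselK p x * Real.exp x - √(Real.pi / (2 * x)) * (1 + besselCoeff p / x)) := by
    rw [besselNormalizer]
    linear_combination (1 + besselCoeff p / x) * hsq
  rw [e, abs_mul, abs_of_nonneg (Real.sqrt_nonneg _)]
  refine (mul_le_mul_of_nonneg_left hdiff (Real.sqrt_nonneg _)).trans_eq ?_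
  have hp : (x / 4) ^ (-(4 + 1 : ℝ) / 2) = (1 / 4) ^ (-(4 + 1 : ℝ) / 2) * ((√x)⁻¹ * (x ^ 2)⁻¹) := by
    rw [show x / 4 = 1 / 4 * x by ring, Real.mul_rpow (by norm_num) hx0.le,
      show x ^ (-(4 + 1 : ℝ) / 2) = (√x)⁻¹ * (x ^ 2)⁻¹ by
        rw [show (-(4 + 1 : ℝ) / 2) = -(1 / 2) + -2 by norm_num, Real.rpow_add hx0,
          Real.rpow_neg hx0.le, Real.rpow_neg hx0.le, Real.rpow_two, Real.sqrt_eq_rpow]]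
  have hs : √(2 * x / Real.pi) = √(2 / Real.pi) * √x := by
    rw [← Real.sqrt_mul (by positivity)]; congr 1; ring
  rw [hp, hs]
  have : √x ≠ 0 := (Real.sqrt_pos.2 hx0).ne'
  field_simp

/-! ### Even part of the Taylor expansion -/

section Taylor

variable {V F : Type*} [NormedAddCommGroup V] [NormedSpace ℝ V] [NormedAddCommGroup F]
  [NormedSpace ℝ F]

/-- A function vanishing at the origin gains one order of vanishing over its derivative. -/
lemma norm_le_pow_succ_of_fderiv {f : V → F} {r C : ℝ} {k : ℕ} (hC : 0 ≤ C)
    (hf : ∀ y, ‖y‖ < r → DifferentiableAt ℝ f y) (h0 : f 0 = 0)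
    (hb : ∀ y, ‖y‖ < r → ‖fderiv ℝ f y‖ ≤ C * ‖y‖ ^ k) (y : V) (hy : ‖y‖ < r) :
    ‖f y‖ ≤ C * ‖y‖ ^ (k + 1) := by
  have h := (convex_closedBall (0 : V) ‖y‖).norm_image_sub_le_of_norm_fderiv_le (𝕜 := ℝ) (f := f)
    (C := C * ‖y‖ ^ k) (x := 0) (y := y)
    (fun x hx => hf x (lt_of_le_of_lt (by simpa using hx) hy))
    (fun x hx => by
      have hx : ‖x‖ ≤ ‖y‖ := by simpa using hx
      exact (hb x (lt_of_le_of_lt hx hy)).trans (by gcongr))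
    (by simp) (by simp)
  rw [h0, sub_zero, sub_zero] at h
  rw [pow_succ, ← mul_assoc]
  exact h

lemma eventually_differentiableAt {f : V → F} {x : V} (hf : ContDiffAt ℝ ∞ f x) :
    ∀ᶠ y in 𝓝 x, DifferentiableAt ℝ f y :=
  ((hf.of_le (by exact_mod_cast le_top : (1 : WithTop ℕ∞) ≤ ∞)).eventually (by simp)).mono
    fun _ hy => hy.differentiableAt (by simp)

lemma hasFDerivAt_comp_neg {f : V → F} {y : V} (hf : DifferentiableAt ℝ f (-y)) :
    HasFDerivAt (fun y => f (-y)) (-fderiv ℝ f (-y)) y := by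
  exact (hf.hasFDerivAt.comp y (hasFDerivAt_id y).neg).congr_fderiv (by ext; simp)

set_option maxSynthPendingDepth 3 in
/-- The second symmetric difference of a smooth function agrees with its second derivative up to
fourth order, because the odd Taylor terms cancel. -/
lemma eventually_norm_symm_sub_le {H : V → F} (hH : ContDiffAt ℝ ∞ H 0) :
    ∃ C, 0 ≤ C ∧ ∃ r, 0 < r ∧ ∀ y, ‖y‖ < r →
      ‖H y + H (-y) - (2 : ℝ) • H 0 - fderiv ℝ (fderiv ℝ H) 0 y y‖ ≤ C * ‖y‖ ^ 4 := by
  have h1 : ContDiffAt ℝ ∞ (fderiv ℝ H) 0 := hH.fderiv_right (by simp)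
  have h2 : ContDiffAt ℝ ∞ (fderiv ℝ (fderiv ℝ H)) 0 := h1.fderiv_right (by simp)
  have h3 : ContDiffAt ℝ ∞ (fderiv ℝ (fderiv ℝ (fderiv ℝ H))) 0 := h2.fderiv_right (by simp)
  obtain ⟨K, t, ht, hLip⟩ := (h3.of_le (by exact_mod_cast le_top : (1 : WithTop ℕ∞) ≤ ∞)).exists_lipschitzOnWith
  obtain ⟨r, hr, hball⟩ := Metric.eventually_nhds_iff.1
    (((eventually_differentiableAt hH).and (eventually_differentiableAt h1)).and ((eventually_differentiableAt h2).and ht))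
  have hball : ∀ y : V, ‖y‖ < r → (DifferentiableAt ℝ H y ∧ DifferentiableAt ℝ (fderiv ℝ H) y) ∧
      DifferentiableAt ℝ (fderiv ℝ (fderiv ℝ H)) y ∧ y ∈ t := fun y hy => hball (by simpa using hy)
  have hneg : ∀ y : V, ‖y‖ < r → ‖-y‖ < r := fun y hy => by simpa using hy
  set D₁ := fderiv ℝ H
  set D₂ := fderiv ℝ D₁
  set D₃ := fderiv ℝ D₂
  -- `D²H(y) + D²H(-y) - 2 D²H(0)` is quadratically small, its derivative being odd
  have s2 : ∀ y, ‖y‖ < r → ‖D₂ y + D₂ (-y) - (2 : ℝ) • D₂ 0‖ ≤ (2 * K) * ‖y‖ ^ 2 := by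
    have hd : ∀ y, ‖y‖ < r → HasFDerivAt (fun y => D₂ y + D₂ (-y) - (2 : ℝ) • D₂ 0)
        (D₃ y + -D₃ (-y)) y := fun y hy =>
      (((hball y hy).2.1.hasFDerivAt).add (hasFDerivAt_comp_neg (hball _ (hneg y hy)).2.1)).sub_const _
    refine norm_le_pow_succ_of_fderiv (k := 1) (by positivity)
      (fun y hy => (hd y hy).differentiableAt) ?_ ?_
    · simp [two_smul]
    · intro y hy
      rw [(hd y hy).fderiv, ← sub_eq_add_neg]
      have := hLip.norm_sub_le (hball y hy).2.2 (hball _ (hneg y hy)).2.2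
      rw [sub_neg_eq_add, ← two_smul ℝ y, norm_smul, Real.norm_ofNat] at this
      rw [pow_one]; linarith
  have s1 : ∀ y, ‖y‖ < r → ‖D₁ y - D₁ (-y) - (2 : ℝ) • D₂ 0 y‖ ≤ (2 * K) * ‖y‖ ^ 3 := by
    have hd : ∀ y, ‖y‖ < r → HasFDerivAt (fun y => D₁ y - D₁ (-y) - (2 : ℝ) • D₂ 0 y)
        (D₂ y + D₂ (-y) - (2 : ℝ) • D₂ 0) y := fun y hy => by
      have := (((hball y hy).1.2.hasFDerivAt).sub (hasFDerivAt_comp_neg (hball _ (hneg y hy)).1.2)).sub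
        ((D₂ 0).hasFDerivAt.const_smul (2 : ℝ))
      rwa [sub_neg_eq_add] at this
    refine norm_le_pow_succ_of_fderiv (k := 2) (by positivity)
      (fun y hy => (hd y hy).differentiableAt) (by simp) ?_
    intro y hy
    rw [(hd y hy).fderiv]; exact s2 y hy
  have hsymm : ∀ u v, D₂ 0 u v = D₂ 0 v u := by
    have : IsSymmSndFDerivAt ℝ H 0 := hH.isSymmSndFDerivAt
      (by rw [minSmoothness_of_isRCLikeNormedField]; exact WithTop.coe_le_coe.2 (le_top : (2 : ℕ∞) ≤ ⊤))
    exact this.eq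
  refine ⟨2 * K, by positivity, r, hr, ?_⟩
  have hd : ∀ y, ‖y‖ < r → HasFDerivAt (fun y => H y + H (-y) - (2 : ℝ) • H 0 - D₂ 0 y y)
      (D₁ y - D₁ (-y) - (2 : ℝ) • D₂ 0 y) y := fun y hy => by
    have hq : HasFDerivAt (fun y => D₂ 0 y y) ((2 : ℝ) • D₂ 0 y) y := by
      refine ((D₂ 0).hasFDerivAt.clm_apply (hasFDerivAt_id y)).congr_fderiv ?_
      ext v
      simp [two_smul, hsymm v y]
    have := ((((hball y hy).1.1.hasFDerivAt).add (hasFDerivAt_comp_neg (hball _ (hneg y hy)).1.1)).sub_const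
      ((2 : ℝ) • H 0)).sub hq
    rwa [← sub_eq_add_neg] at this
  refine norm_le_pow_succ_of_fderiv (k := 3) (by positivity)
    (fun y hy => (hd y hy).differentiableAt) (by simp [two_smul]) ?_
  intro y hy
  rw [(hd y hy).fderiv]; exact s1 y hy

end Taylor

/-! ### Gaussian moments on `ℂⁿ` -/

variable {n : ℕ}

/-- The real basis of `ℂⁿ` made of the vectors `e_k` and `√-1 e_k`. -/
def realVec (i : Fin n × Bool) : Cn n := EuclideanSpace.single i.1 (bif i.2 then Complex.I else 1)

/-- The real coordinates of a vector in the basis `realVec`. -/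
def realCoord (i : Fin n × Bool) (y : Cn n) : ℝ := bif i.2 then (y i.1).im else (y i.1).re

lemma sum_realCoord_smul (y : Cn n) : ∑ i, realCoord i y • realVec i = y := by
  rw [Fintype.sum_prod_type]
  simp only [Fintype.sum_bool, realCoord, realVec, cond_true, cond_false]
  ext l
  simp only [WithLp.ofLp_sum, WithLp.ofLp_add, WithLp.ofLp_smul, Finset.sum_apply, Pi.add_apply,
    Pi.smul_apply, PiLp.single_apply]
  rw [Finset.sum_eq_single l]
  · simp [add_comm]
  · intro k _ hk; simp [hk.symm]
  · simp

lemma norm_sq_eq_sum_realCoord (y : Cn n) : ‖y‖ ^ 2 = ∑ i, realCoord i y ^ 2 := by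
  rw [EuclideanSpace.norm_sq_eq, Fintype.sum_prod_type]
  refine Finset.sum_congr rfl fun k _ => ?_
  simp only [Fintype.sum_bool, realCoord, cond_true, cond_false]
  rw [← Complex.normSq_eq_norm_sq, Complex.normSq_apply]; ring

/-- `realCoord` as a continuous real-linear functional. -/
def realCoordL (i : Fin n × Bool) : Cn n →L[ℝ] ℝ :=
  (bif i.2 then Complex.imCLM else Complex.reCLM).comp
    ((EuclideanSpace.proj i.1 : Cn n →L[ℂ] ℂ).restrictScalars ℝ)

lemma realCoordL_apply (i : Fin n × Bool) (y : Cn n) : realCoordL i y = realCoord i y := by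
  rcases i with ⟨k, _ | _⟩ <;> simp [realCoordL, realCoord]

lemma realCoord_realVec (i j : Fin n × Bool) : realCoord i (realVec j) = if i = j then 1 else 0 := by
  rcases i with ⟨k, _ | _⟩ <;> rcases j with ⟨l, _ | _⟩ <;>
    by_cases h : k = l <;> simp [realCoord, realVec, h, Prod.ext_iff]

lemma abs_realCoord_le (i : Fin n × Bool) (y : Cn n) : |realCoord i y| ≤ ‖y‖ := by
  refine abs_le_of_sq_le_sq ?_ (norm_nonneg y)
  rw [norm_sq_eq_sum_realCoord]
  exact Finset.single_le_sum (f := fun i => realCoord i y ^ 2) (fun _ _ => sq_nonneg _)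
    (Finset.mem_univ i)

/-- The total mass `(π/b)^n` of the Gaussian `e^(-b|y|²)` on `ℂⁿ`. -/
lemma integral_gaussian_Cn {b : ℝ} (hb : 0 < b) :
    ∫ y : Cn n, Real.exp (-b * ‖y‖ ^ 2) = (Real.pi / b) ^ n := by
  have h := GaussianFourier.integral_rexp_neg_mul_sq_norm (V := Cn n) hb
  rw [h]
  have : Module.finrank ℝ (Cn n) = 2 * n := by
    rw [finrank_real_of_complex]; simp
  rw [this, ← Real.rpow_natCast]
  congr 1
  push_cast; ring

lemma integrable_gaussian_Cn {b : ℝ} (hb : 0 < b) :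
    Integrable fun y : Cn n => Real.exp (-b * ‖y‖ ^ 2) := by
  -- A non-integrable function has Bochner integral zero, whereas this integral is positive.
  by_contra h
  have h1 := integral_gaussian_Cn (n := n) hb
  rw [integral_undef h] at h1
  have := Real.pi_pos
  have : 0 < (Real.pi / b) ^ n := by positivity
  linarith

lemma mul_exp_neg_le (b t : ℝ) :
    t * Real.exp (-b * t) * b ≤ 2 * Real.exp (-(b / 2) * t) := by
  have h := Real.add_one_le_exp (b / 2 * t)
  have e : Real.exp (-(b / 2) * t) = Real.exp (b / 2 * t) * Real.exp (-b * t) := by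
    rw [← Real.exp_add]; ring_nf
  rw [e]
  nlinarith [Real.exp_pos (-b * t)]

lemma sq_mul_exp_neg_le {b t : ℝ} (hb : 0 ≤ b) (ht : 0 ≤ t) :
    t ^ 2 * Real.exp (-b * t) * b ^ 2 ≤ 8 * Real.exp (-(b / 2) * t) := by
  have h := Real.pow_div_factorial_le_exp (b / 2 * t) (by positivity) 2
  have e : Real.exp (-(b / 2) * t) = Real.exp (b / 2 * t) * Real.exp (-b * t) := by
    rw [← Real.exp_add]; ring_nf
  rw [e]
  have h2 : ((2 : ℕ).factorial : ℝ) = 2 := by norm_num [Nat.factorial]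
  rw [h2] at h
  have := Real.exp_pos (-b * t)
  nlinarith

lemma integrable_norm_pow_four_mul_gaussian {b : ℝ} (hb : 0 < b) :
    Integrable fun y : Cn n => ‖y‖ ^ 4 * Real.exp (-b * ‖y‖ ^ 2) := by
  refine ((integrable_gaussian_Cn (n := n) (half_pos hb)).const_mul (8 / b ^ 2)).mono'
    (by fun_prop) (Eventually.of_forall fun y => ?_)
  rw [Real.norm_of_nonneg (by positivity), div_mul_eq_mul_div, le_div_iff₀ (by positivity)]
  have := sq_mul_exp_neg_le hb.le (sq_nonneg ‖y‖)
  rwa [← pow_mul] at this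

lemma integral_norm_pow_four_mul_gaussian_le {b : ℝ} (hb : 0 < b) :
    ∫ y : Cn n, ‖y‖ ^ 4 * Real.exp (-b * ‖y‖ ^ 2) ≤ 8 * 2 ^ n * ((Real.pi / b) ^ n / b ^ 2) := by
  have h : ∫ y : Cn n, ‖y‖ ^ 4 * Real.exp (-b * ‖y‖ ^ 2)
      ≤ ∫ y : Cn n, (8 / b ^ 2) * Real.exp (-(b / 2) * ‖y‖ ^ 2) := by
    refine integral_mono (integrable_norm_pow_four_mul_gaussian hb)
      ((integrable_gaussian_Cn (half_pos hb)).const_mul _) fun y => ?_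
    simp only
    rw [div_mul_eq_mul_div, le_div_iff₀ (by positivity)]
    have := sq_mul_exp_neg_le hb.le (sq_nonneg ‖y‖)
    rwa [← pow_mul] at this
  rw [integral_const_mul, integral_gaussian_Cn (half_pos hb),
    show Real.pi / (b / 2) = 2 * (Real.pi / b) by field_simp, mul_pow] at h
  refine h.trans_eq ?_
  ring

lemma integrable_norm_sq_mul_gaussian {b : ℝ} (hb : 0 < b) :
    Integrable fun y : Cn n => ‖y‖ ^ 2 * Real.exp (-b * ‖y‖ ^ 2) := by
  refine ((integrable_gaussian_Cn (n := n) (half_pos hb)).const_mul (2 / b)).mono'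
    (by fun_prop) (Eventually.of_forall fun y => ?_)
  rw [Real.norm_of_nonneg (by positivity), div_mul_eq_mul_div, le_div_iff₀ hb]
  exact mul_exp_neg_le b (‖y‖ ^ 2)

lemma hasFDerivAt_gaussian (b : ℝ) (y : Cn n) :
    HasFDerivAt (fun y : Cn n => Real.exp (-b * ‖y‖ ^ 2))
      (Real.exp (-b * ‖y‖ ^ 2) • (-b) • ∑ i, (2 * realCoord i y) • realCoordL i) y := by
  have h : HasFDerivAt (fun y : Cn n => ‖y‖ ^ 2) (∑ i, (2 * realCoord i y) • realCoordL i) y := by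
    have e : (fun y : Cn n => ‖y‖ ^ 2) = fun y => ∑ i, realCoordL i y ^ 2 := by
      ext y; simp_rw [realCoordL_apply]; exact norm_sq_eq_sum_realCoord y
    rw [e]
    refine HasFDerivAt.fun_sum fun i _ => ?_
    have := (realCoordL i).hasFDerivAt (x := y) |>.pow 2
    refine this.congr_fderiv ?_
    simp [realCoordL_apply]
  exact (h.const_mul (-b)).exp

lemma integrable_realCoord_mul {b : ℝ} (hb : 0 < b) (i j : Fin n × Bool) :
    Integrable fun y : Cn n => realCoord i y * realCoord j y * Real.exp (-b * ‖y‖ ^ 2) := by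
  refine (integrable_norm_sq_mul_gaussian hb).mono' ?_ (Eventually.of_forall fun y => ?_)
  · simp_rw [← realCoordL_apply]
    exact Continuous.aestronglyMeasurable (by fun_prop)
  · rw [norm_mul, norm_mul, Real.norm_of_nonneg (Real.exp_pos _).le, sq]
    gcongr
    · exact abs_realCoord_le i y
    · exact abs_realCoord_le j y

/-- Second moments of the Gaussian, by integration by parts. -/
lemma integral_realCoord_mul {b : ℝ} (hb : 0 < b) (i j : Fin n × Bool) :
    ∫ y : Cn n, realCoord i y * realCoord j y * Real.exp (-b * ‖y‖ ^ 2)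
      = if i = j then (Real.pi / b) ^ n / (2 * b) else 0 := by
  have hg : ∀ y : Cn n, fderiv ℝ (fun y : Cn n => Real.exp (-b * ‖y‖ ^ 2)) y (realVec j)
      = -(2 * b) * (realCoord j y * Real.exp (-b * ‖y‖ ^ 2)) := by
    intro y
    rw [(hasFDerivAt_gaussian b y).fderiv]
    simp only [smul_apply, sum_apply, realCoordL_apply,
      realCoord_realVec, smul_eq_mul, mul_ite, mul_one, mul_zero, Finset.sum_ite_eq',
      Finset.mem_univ, if_true]
    ring
  have hc : ∀ y : Cn n, fderiv ℝ (fun y : Cn n => realCoord i y) y (realVec j)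
      = if i = j then 1 else 0 := by
    intro y
    have : (fun y : Cn n => realCoord i y) = realCoordL i := by
      ext y; exact (realCoordL_apply i y).symm
    rw [this, ContinuousLinearMap.fderiv, realCoordL_apply, realCoord_realVec]
  have hdc : Differentiable ℝ (fun y : Cn n => realCoord i y) := by
    have : (fun y : Cn n => realCoord i y) = realCoordL i := by
      ext y; exact (realCoordL_apply i y).symm
    rw [this]; exact (realCoordL i).differentiable
  have hint : Integrable fun y : Cn n => realCoord i y * Real.exp (-b * ‖y‖ ^ 2) := by
    refine ((integrable_gaussian_Cn hb).add (integrable_norm_sq_mul_gaussian hb)).mono' ?_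
      (Eventually.of_forall fun y => ?_)
    · exact (hdc.continuous.mul (by fun_prop)).aestronglyMeasurable
    · rw [norm_mul, Real.norm_of_nonneg (Real.exp_pos _).le, Real.norm_eq_abs, Pi.add_apply]
      have h1 := abs_realCoord_le i y
      have h2 : |realCoord i y| ≤ 1 + ‖y‖ ^ 2 := by nlinarith [sq_nonneg (‖y‖ - 1)]
      have := mul_le_mul_of_nonneg_right h2 (Real.exp_pos (-b * ‖y‖ ^ 2)).le
      linarith
  have h := integral_mul_fderiv_eq_neg_fderiv_mul_of_integrable (μ := (volume : Measure (Cn n)))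
    (f := fun y : Cn n => realCoord i y) (g := fun y : Cn n => Real.exp (-b * ‖y‖ ^ 2))
    (v := realVec j) ?_ ?_ hint (fun y _ => hdc y)
    (fun y _ => (hasFDerivAt_gaussian b y).differentiableAt)
  · simp_rw [hg, hc] at h
    have e : ∀ y : Cn n, realCoord i y * (-(2 * b) * (realCoord j y * Real.exp (-b * ‖y‖ ^ 2)))
        = -(2 * b) * (realCoord i y * realCoord j y * Real.exp (-b * ‖y‖ ^ 2)) := fun y => by ring
    simp_rw [e] at h
    rw [integral_const_mul, integral_const_mul, integral_gaussian_Cn hb] at h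
    split_ifs with hij
    · rw [if_pos hij] at h
      field_simp at h ⊢
      linarith
    · rw [if_neg hij] at h
      have hb2 : -(2 * b) ≠ 0 := by linarith
      simpa [hb2, hb.ne'] using h
  · simp_rw [hc]
    exact (integrable_gaussian_Cn hb).const_mul _
  · simp_rw [hg]
    refine ((integrable_realCoord_mul hb i j).const_mul (-(2 * b))).congr
      (Eventually.of_forall fun y => ?_)
    simp only; ring

lemma bilin_eq_sum_realCoord (B : Cn n →L[ℝ] Cn n →L[ℝ] ℂ) (y : Cn n) :
    B y y = ∑ i, ∑ j, ((realCoord i y * realCoord j y : ℝ) : ℂ) * B (realVec i) (realVec j) := by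
  conv_lhs => rw [← sum_realCoord_smul y]
  rw [map_sum, Finset.sum_comm]
  refine Finset.sum_congr rfl fun j _ => ?_
  rw [map_sum, sum_apply]
  refine Finset.sum_congr rfl fun i _ => ?_
  simp
  ring

/-- The Gaussian average of a quadratic form is its trace. -/
lemma integral_bilin_mul_gaussian {b : ℝ} (hb : 0 < b) (B : Cn n →L[ℝ] Cn n →L[ℝ] ℂ) :
    Integrable (fun y : Cn n => B y y * (Real.exp (-b * ‖y‖ ^ 2) : ℂ)) ∧
    ∫ y : Cn n, B y y * (Real.exp (-b * ‖y‖ ^ 2) : ℂ)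
      = ((Real.pi / b) ^ n / (2 * b) : ℝ) * ∑ i, B (realVec i) (realVec i) := by
  have e : (fun y : Cn n => B y y * (Real.exp (-b * ‖y‖ ^ 2) : ℂ)) = fun y => ∑ i, ∑ j,
      ((realCoord i y * realCoord j y * Real.exp (-b * ‖y‖ ^ 2) : ℝ) : ℂ) *
        B (realVec i) (realVec j) := by
    ext y
    rw [bilin_eq_sum_realCoord, Finset.sum_mul]
    refine Finset.sum_congr rfl fun i _ => ?_
    rw [Finset.sum_mul]
    refine Finset.sum_congr rfl fun j _ => ?_
    push_cast; ring
  have hi : ∀ i j, Integrable fun y : Cn n =>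
      ((realCoord i y * realCoord j y * Real.exp (-b * ‖y‖ ^ 2) : ℝ) : ℂ) *
        B (realVec i) (realVec j) := fun i j =>
    (integrable_realCoord_mul hb i j).ofReal.mul_const _
  rw [e]
  refine ⟨integrable_finsetSum _ fun i _ => integrable_finsetSum _ fun j _ => hi i j, ?_⟩
  rw [integral_finsetSum _ fun i _ => integrable_finsetSum _ fun j _ => hi i j, Finset.mul_sum]
  refine Finset.sum_congr rfl fun i _ => ?_
  rw [integral_finsetSum _ fun j _ => hi i j]
  simp_rw [integral_mul_const, integral_complex_ofReal, integral_realCoord_mul hb]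
  rw [Finset.sum_eq_single i]
  · simp
  · intro j _ hj; simp [hj.symm]
  · simp

/-! ### Laplace's method for a Gaussian phase -/

/-- Only the even part of the amplitude contributes to a Gaussian integral over a centred ball. -/
lemma setIntegral_ball_mul_gaussian_symm {H : Cn n → ℂ} {δ b : ℝ}
    (hi : IntegrableOn (fun y => H y * (Real.exp (-b * ‖y‖ ^ 2) : ℂ)) (Metric.ball 0 δ)) :
    Integrable ((Metric.ball 0 δ).indicator
      fun y => (H y + H (-y)) / 2 * (Real.exp (-b * ‖y‖ ^ 2) : ℂ)) ∧
    ∫ y in Metric.ball 0 δ, H y * (Real.exp (-b * ‖y‖ ^ 2) : ℂ)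
      = ∫ y, (Metric.ball 0 δ).indicator
        (fun y => (H y + H (-y)) / 2 * (Real.exp (-b * ‖y‖ ^ 2) : ℂ)) y := by
  set f := (Metric.ball (0 : Cn n) δ).indicator fun y => H y * (Real.exp (-b * ‖y‖ ^ 2) : ℂ) with hf
  have hfi : Integrable f := hi.integrable_indicator Metric.isOpen_ball.measurableSet
  have hfi' : Integrable fun y => f (-y) := hfi.comp_neg
  have e : ((Metric.ball 0 δ).indicator
      fun y => (H y + H (-y)) / 2 * (Real.exp (-b * ‖y‖ ^ 2) : ℂ)) = fun y => (f y + f (-y)) / 2 := by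
    ext y
    have hmem : -y ∈ Metric.ball (0 : Cn n) δ ↔ y ∈ Metric.ball (0 : Cn n) δ := by simp
    by_cases h : y ∈ Metric.ball (0 : Cn n) δ
    · simp only [hf, Set.indicator_of_mem h, Set.indicator_of_mem (hmem.2 h), norm_neg]
      ring
    · simp only [hf, Set.indicator_of_notMem h, Set.indicator_of_notMem (fun h' => h (hmem.1 h'))]
      simp
  rw [e]
  refine ⟨(hfi.add hfi').div_const 2, ?_⟩
  rw [integral_div, integral_add hfi hfi', integral_neg_eq_self f volume,
    ← integral_indicator Metric.isOpen_ball.measurableSet]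
  ring

/-- Laplace's method on a ball: a function whose even part is quadratic up to fourth order
integrates against `e^(-b|y|²)` to its value at `0` plus the trace of the quadratic form over `4b`,
with relative error `O(b⁻²)`. -/
lemma exists_laplace_bound {H : Cn n → ℂ} {B : Cn n →L[ℝ] Cn n →L[ℝ] ℂ} {δ C M : ℝ} (hδ : 0 < δ)
    (hC : 0 ≤ C) (hHc : ContinuousOn H (Metric.ball 0 δ)) (hHM : ∀ y, ‖y‖ < δ → ‖H y‖ ≤ M)
    (hT : ∀ y, ‖y‖ < δ → ‖H y + H (-y) - (2 : ℝ) • H 0 - B y y‖ ≤ C * ‖y‖ ^ 4) :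
    ∃ K, 0 ≤ K ∧ ∀ b : ℝ, 0 < b →
      ‖(∫ y in Metric.ball 0 δ, H y * (Real.exp (-b * ‖y‖ ^ 2) : ℂ))
        - ((Real.pi / b) ^ n : ℝ) * (H 0 + (∑ i, B (realVec i) (realVec i)) / (4 * b))‖
      ≤ K * ((Real.pi / b) ^ n / b ^ 2) := by
  set C' := C + ‖H 0‖ / δ ^ 4 + ‖B‖ / δ ^ 2 with hC'
  have hC'0 : 0 ≤ C' := by positivity
  refine ⟨C' * (8 * 2 ^ n), by positivity, fun b hb => ?_⟩
  set g : Cn n → ℂ := fun y => (Real.exp (-b * ‖y‖ ^ 2) : ℂ) with hg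
  have hgn : ∀ y, ‖g y‖ = Real.exp (-b * ‖y‖ ^ 2) := fun y => by
    simp only [hg]
    rw [Complex.norm_real, Real.norm_of_nonneg (Real.exp_pos _).le]
  have hgi : Integrable g := by
    have := (integrable_gaussian_Cn (n := n) hb).ofReal (𝕜 := ℂ)
    exact this
  have hi : IntegrableOn (fun y => H y * g y) (Metric.ball 0 δ) := by
    refine Integrable.bdd_mul (c := M) hgi.integrableOn
      (hHc.aestronglyMeasurable Metric.isOpen_ball.measurableSet) ?_
    filter_upwards [ae_restrict_mem Metric.isOpen_ball.measurableSet] with y hy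
    exact hHM y (by simpa using hy)
  obtain ⟨hSi, hS⟩ := setIntegral_ball_mul_gaussian_symm hi
  obtain ⟨hBi, hB⟩ := integral_bilin_mul_gaussian hb B
  set S := (Metric.ball 0 δ).indicator fun y => (H y + H (-y)) / 2 * g y with hSdef
  set P : Cn n → ℂ := fun y => H 0 * g y + (1 / 2) * (B y y * g y) with hP
  have hPi : Integrable P := (hgi.const_mul _).add (hBi.const_mul _)
  have hPv : ∫ y, P y
      = ((Real.pi / b) ^ n : ℝ) * (H 0 + (∑ i, B (realVec i) (realVec i)) / (4 * b)) := by
    rw [hP, integral_add (hgi.const_mul _) (hBi.const_mul _), integral_const_mul,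
      integral_const_mul, hB]
    have : ∫ y, g y = (((Real.pi / b) ^ n : ℝ) : ℂ) := by
      rw [← integral_gaussian_Cn hb, ← integral_complex_ofReal]
    rw [this]
    push_cast
    have : (b : ℂ) ≠ 0 := by exact_mod_cast hb.ne'
    field_simp
    ring
  have hpt : ∀ y, ‖S y - P y‖ ≤ C' * (‖y‖ ^ 4 * Real.exp (-b * ‖y‖ ^ 2)) := by
    intro y
    have hBy : ‖B y y‖ ≤ ‖B‖ * ‖y‖ ^ 2 := by
      have := B.le_opNorm₂ y y
      rwa [mul_assoc, ← sq] at this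
    by_cases h : ‖y‖ < δ
    · have hmem : y ∈ Metric.ball (0 : Cn n) δ := by simpa using h
      have e : S y - P y = (1 / 2) * (H y + H (-y) - (2 : ℝ) • H 0 - B y y) * g y := by
        simp only [hSdef, hP, Set.indicator_of_mem hmem, Complex.real_smul]
        push_cast
        ring
      rw [e, norm_mul, norm_mul, hgn]
      have h1 := hT y h
      have h2 : ‖(1 / 2 : ℂ)‖ = 1 / 2 := by norm_num
      rw [h2]
      have h3 : C ≤ C' := by
        have : 0 ≤ ‖H 0‖ / δ ^ 4 := by positivity
        have : 0 ≤ ‖B‖ / δ ^ 2 := by positivity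
        rw [hC']; linarith
      have h4 : (0:ℝ) ≤ ‖y‖ ^ 4 := by positivity
      have h5 : 1 / 2 * ‖H y + H (-y) - (2 : ℝ) • H 0 - B y y‖ ≤ C' * ‖y‖ ^ 4 := by
        have := mul_le_mul_of_nonneg_right h3 h4
        have := norm_nonneg (H y + H (-y) - (2 : ℝ) • H 0 - B y y)
        linarith
      calc _ ≤ (C' * ‖y‖ ^ 4) * Real.exp (-b * ‖y‖ ^ 2) := by gcongr
        _ = _ := by ring
    · have hmem : y ∉ Metric.ball (0 : Cn n) δ := by simpa using h
      push Not at h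
      have e : S y - P y = -((H 0 + 1 / 2 * B y y) * g y) := by
        simp only [hSdef, hP, Set.indicator_of_notMem hmem]
        ring
      rw [e, norm_neg, norm_mul, hgn, ← mul_assoc]
      gcongr
      have h2 : ‖(1 / 2 : ℂ)‖ = 1 / 2 := by norm_num
      have h1 : ‖H 0 + 1 / 2 * B y y‖ ≤ ‖H 0‖ + ‖B‖ * ‖y‖ ^ 2 := by
        refine (norm_add_le _ _).trans ?_
        rw [norm_mul, h2]
        have := norm_nonneg (B y y)
        linarith
      have h3 : ‖H 0‖ ≤ ‖H 0‖ / δ ^ 4 * ‖y‖ ^ 4 := by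
        rw [div_mul_eq_mul_div, le_div_iff₀ (by positivity)]
        gcongr
      have h4 : ‖B‖ * ‖y‖ ^ 2 ≤ ‖B‖ / δ ^ 2 * ‖y‖ ^ 4 := by
        rw [div_mul_eq_mul_div, le_div_iff₀ (by positivity), mul_assoc,
          show ‖y‖ ^ 4 = ‖y‖ ^ 2 * ‖y‖ ^ 2 by ring]
        gcongr
      have h5 : 0 ≤ C * ‖y‖ ^ 4 := by positivity
      rw [hC', add_mul, add_mul]
      linarith
  rw [hS, ← hPv, ← integral_sub hSi hPi]
  calc _ ≤ ∫ y : Cn n, C' * (‖y‖ ^ 4 * Real.exp (-b * ‖y‖ ^ 2)) :=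
        norm_integral_le_of_norm_le ((integrable_norm_pow_four_mul_gaussian hb).const_mul _)
          (Eventually.of_forall hpt)
    _ ≤ C' * (8 * 2 ^ n * ((Real.pi / b) ^ n / b ^ 2)) := by
        rw [integral_const_mul]
        exact mul_le_mul_of_nonneg_left (integral_norm_pow_four_mul_gaussian_le hb) hC'0
    _ = _ := by ring

/-! ### Coordinates in which the phase is quadratic -/

lemma inner_eq_hdot (y z : Cn n) : inner ℂ y z = hdot z y := by
  simp [PiLp.inner_apply, hdot]

lemma hdot_conj (y z : Cn n) : conj (hdot y z) = hdot z y := by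
  rw [← inner_eq_hdot, ← inner_eq_hdot, inner_conj_symm]

lemma hdot_add_left (x y z : Cn n) : hdot (x + y) z = hdot x z + hdot y z := by
  simp only [← inner_eq_hdot, inner_add_right]

lemma hdot_sub_left (x y z : Cn n) : hdot (x - y) z = hdot x z - hdot y z := by
  simp only [← inner_eq_hdot, inner_sub_right]

lemma hdot_smul_left (c : ℂ) (y z : Cn n) : hdot (c • y) z = c * hdot y z := by
  simp only [← inner_eq_hdot, inner_smul_right]

lemma hdot_smul_right (c : ℂ) (y z : Cn n) : hdot y (c • z) = conj c * hdot y z := by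
  simp only [← inner_eq_hdot, inner_smul_left]

lemma hdot_self (y : Cn n) : hdot y y = (‖y‖ : ℂ) ^ 2 := by
  rw [← inner_eq_hdot, inner_self_eq_norm_sq_to_K]; simp

lemma norm_hdot_le (y z : Cn n) : ‖hdot y z‖ ≤ ‖y‖ * ‖z‖ := by
  rw [← inner_eq_hdot, mul_comm]; exact norm_inner_le_norm _ _

/-- Pythagoras for the splitting `a e + v` with `v ⊥ e`. -/
lemma norm_smul_add_sq {e v : Cn n} (he : ‖e‖ = 1) (hv : hdot v e = 0) (a : ℂ) :
    ‖a • e + v‖ ^ 2 = ‖a‖ ^ 2 + ‖v‖ ^ 2 := by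
  have h : inner ℂ (a • e) v = 0 := by rw [inner_smul_left, inner_eq_hdot, hv, mul_zero]
  have := norm_add_sq_eq_norm_sq_add_norm_sq_of_inner_eq_zero (𝕜 := ℂ) (a • e) v h
  rw [norm_smul, he, mul_one] at this
  nlinarith [this]

/-- The shifted point `Y = y + s₀ e`. -/
def shiftPt (e : Cn n) (s₀ : ℝ) (y : Cn n) : Cn n := y + (s₀ : ℂ) • e

/-- The coordinate `s = Y · e`, so that `s²` is the coordinate of the image along `e`. -/
def sCoord (e : Cn n) (s₀ : ℝ) (y : Cn n) : ℂ := hdot (shiftPt e s₀ y) e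

/-- The part `v = Y - s e` of `Y` orthogonal to `e`. -/
def perpPart (e : Cn n) (s₀ : ℝ) (y : Cn n) : Cn n := shiftPt e s₀ y - sCoord e s₀ y • e

/-- The number `|s|² + |Y|² = 2|s|² + |v|²`. -/
def stretchSq (e : Cn n) (s₀ : ℝ) (y : Cn n) : ℝ := ‖sCoord e s₀ y‖ ^ 2 + ‖shiftPt e s₀ y‖ ^ 2

/-- The chart `y ↦ s² e + √(2|s|² + |v|²) v`, where `y + s₀ e = s e + v` and `v ⊥ e`. It satisfies
`|Ψ(y)| = |s|² + |v|²`, which turns `|w| + |z| - 2 Re √(w·z)` into `|y|²` when `z = s₀² e`. -/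
def chart (e : Cn n) (s₀ : ℝ) (y : Cn n) : Cn n :=
  sCoord e s₀ y ^ 2 • e + (√(stretchSq e s₀ y) : ℂ) • perpPart e s₀ y

section Algebra

variable {e : Cn n} {s₀ : ℝ} {y : Cn n}

lemma hdot_unit (he : ‖e‖ = 1) : hdot e e = 1 := by rw [hdot_self, he]; simp

lemma hdot_perpPart (he : ‖e‖ = 1) : hdot (perpPart e s₀ y) e = 0 := by
  rw [perpPart, hdot_sub_left, hdot_smul_left, hdot_unit he, mul_one, sCoord, sub_self]

lemma smul_add_perpPart : sCoord e s₀ y • e + perpPart e s₀ y = shiftPt e s₀ y := by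
  rw [perpPart]; abel

lemma sCoord_eq (he : ‖e‖ = 1) : sCoord e s₀ y = hdot y e + s₀ := by
  rw [sCoord, shiftPt, hdot_add_left, hdot_smul_left, hdot_unit he, mul_one]

lemma norm_shiftPt_sq (he : ‖e‖ = 1) :
    ‖shiftPt e s₀ y‖ ^ 2 = ‖sCoord e s₀ y‖ ^ 2 + ‖perpPart e s₀ y‖ ^ 2 := by
  rw [← smul_add_perpPart, norm_smul_add_sq he (hdot_perpPart he)]

lemma stretchSq_nonneg : 0 ≤ stretchSq e s₀ y := by unfold stretchSq; positivity

lemma hdot_chart (he : ‖e‖ = 1) : hdot (chart e s₀ y) e = sCoord e s₀ y ^ 2 := by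
  rw [chart, hdot_add_left, hdot_smul_left, hdot_smul_left, hdot_unit he, hdot_perpPart he]; simp

lemma norm_chart (he : ‖e‖ = 1) : ‖chart e s₀ y‖ = ‖shiftPt e s₀ y‖ ^ 2 := by
  have h1 : hdot ((√(stretchSq e s₀ y) : ℂ) • perpPart e s₀ y) e = 0 := by
    rw [hdot_smul_left, hdot_perpPart he, mul_zero]
  have h2 := norm_smul_add_sq he h1 (sCoord e s₀ y ^ 2)
  rw [norm_smul, Complex.norm_real, Real.norm_of_nonneg (Real.sqrt_nonneg _), mul_pow,
    Real.sq_sqrt stretchSq_nonneg, norm_pow] at h2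
  have h3 := norm_shiftPt_sq (e := e) (s₀ := s₀) (y := y) he
  rw [← sq_eq_sq₀ (norm_nonneg _) (by positivity), chart, h2, stretchSq, h3]
  ring

lemma norm_sq_eq (he : ‖e‖ = 1) :
    ‖y‖ ^ 2 = ‖shiftPt e s₀ y‖ ^ 2 - 2 * s₀ * (sCoord e s₀ y).re + s₀ ^ 2 := by
  have h : y = (sCoord e s₀ y - s₀) • e + perpPart e s₀ y := by
    rw [sub_smul, sub_add_eq_add_sub, smul_add_perpPart, shiftPt]; abel
  have h2 := norm_smul_add_sq he (hdot_perpPart (e := e) (s₀ := s₀) (y := y) he)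
    (sCoord e s₀ y - s₀)
  rw [← h] at h2
  rw [h2, norm_shiftPt_sq he, ← Complex.normSq_eq_norm_sq, ← Complex.normSq_eq_norm_sq,
    Complex.normSq_apply, Complex.normSq_apply]
  simp; ring

lemma norm_sCoord_sub_le (he : ‖e‖ = 1) : ‖sCoord e s₀ y - s₀‖ ≤ ‖y‖ := by
  rw [sCoord_eq he, add_sub_cancel_right]
  simpa [he] using norm_hdot_le y e

lemma sCoord_re_ge (he : ‖e‖ = 1) : s₀ - ‖y‖ ≤ (sCoord e s₀ y).re := by
  have h1 := (Complex.abs_re_le_norm (sCoord e s₀ y - s₀)).trans (norm_sCoord_sub_le he)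
  have h2 := (abs_le.1 h1).1
  simp at h2
  linarith

/-- The chart determines `s²`, hence `s` when `Re s > 0`, and then `|Y|` and `v`. -/
lemma chart_injOn (he : ‖e‖ = 1) : Set.InjOn (chart e s₀) {y | 0 < (sCoord e s₀ y).re} := by
  intro x hx y hy hxy
  have hx : 0 < (sCoord e s₀ x).re := hx
  have hy : 0 < (sCoord e s₀ y).re := hy
  have h1 : sCoord e s₀ x = sCoord e s₀ y := by
    have h := congrArg (fun w => hdot w e) hxy
    simp only [hdot_chart he] at h
    rcases sq_eq_sq_iff_eq_or_eq_neg.1 h with h | h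
    · exact h
    · rw [h, Complex.neg_re] at hx; linarith
  have h2 : ‖shiftPt e s₀ x‖ ^ 2 = ‖shiftPt e s₀ y‖ ^ 2 := by
    rw [← norm_chart he, ← norm_chart he, hxy]
  have h3 : stretchSq e s₀ x = stretchSq e s₀ y := by rw [stretchSq, stretchSq, h1, h2]
  have hpos : 0 < stretchSq e s₀ y := by
    have : 0 < ‖sCoord e s₀ y‖ := norm_pos_iff.2 (by rintro h; rw [h] at hy; simp at hy)
    unfold stretchSq; positivity
  have h4 : perpPart e s₀ x = perpPart e s₀ y := by
    rw [chart, chart, h1, h3] at hxy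
    have hne : (√(stretchSq e s₀ y) : ℂ) ≠ 0 := by
      exact_mod_cast (Real.sqrt_pos.2 hpos).ne'
    exact smul_right_injective _ hne (add_left_cancel hxy)
  have h5 : shiftPt e s₀ x = shiftPt e s₀ y := by
    rw [← smul_add_perpPart, ← smul_add_perpPart, h1, h4]
  exact add_right_cancel h5

/-- The phase `|z| + |w| - 2 Re √(w·z)` for `z = s₀² e`. -/
def phase (e : Cn n) (s₀ : ℝ) (w : Cn n) : ℝ :=
  s₀ ^ 2 + ‖w‖ - 2 * s₀ * (hdot w e ^ (1 / 2 : ℂ)).re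

lemma cpow_half_re_nonneg (x : ℂ) : 0 ≤ (x ^ (1 / 2 : ℂ)).re := by
  have h := Complex.abs_arg_le_pi x
  rcases eq_or_ne x 0 with rfl | hx
  · simp
  · rw [Complex.cpow_def_of_ne_zero hx, Complex.exp_re]
    refine mul_nonneg (Real.exp_pos _).le (Real.cos_nonneg_of_mem_Icc ?_)
    have : (Complex.log x * (1 / 2)).im = x.arg / 2 := by
      rw [show (1 / 2 : ℂ) = ((1 / 2 : ℝ) : ℂ) by push_cast; rfl, mul_comm, Complex.im_ofReal_mul,
        Complex.log_im]; ring
    rw [this]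
    constructor <;> linarith [abs_le.1 h]

lemma cpow_half_sq (x : ℂ) : (x ^ (1 / 2 : ℂ)) ^ 2 = x := by
  rw [← Complex.cpow_nat_mul]; norm_num

lemma sq_cpow_half {s : ℂ} (hs : 0 < s.re) : (s ^ 2) ^ (1 / 2 : ℂ) = s := by
  rcases sq_eq_sq_iff_eq_or_eq_neg.1 (cpow_half_sq (s ^ 2)) with h | h
  · exact h
  · have := cpow_half_re_nonneg (s ^ 2)
    rw [h, Complex.neg_re] at this
    linarith

lemma phase_chart (he : ‖e‖ = 1) (hs : 0 < (sCoord e s₀ y).re) :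
    phase e s₀ (chart e s₀ y) = ‖y‖ ^ 2 := by
  rw [phase, hdot_chart he, sq_cpow_half hs, norm_chart he, norm_sq_eq (s₀ := s₀) (y := y) he]; ring

/-- The inverse of the chart is explicit: `s = √(w·e)` and `v = (w - (w·e) e) / √(|w| + |w·e|)`. -/
lemma exists_chart_eq (he : ‖e‖ = 1) {w : Cn n} (hw : 0 < (hdot w e ^ (1 / 2 : ℂ)).re) :
    ∃ y, chart e s₀ y = w ∧ sCoord e s₀ y = hdot w e ^ (1 / 2 : ℂ) := by
  set x := hdot w e with hx
  set s := x ^ (1 / 2 : ℂ) with hs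
  have hs2 : s ^ 2 = x := cpow_half_sq x
  have hsn : ‖s‖ ^ 2 = ‖x‖ := by rw [← norm_pow, hs2]
  have hs0 : 0 < ‖s‖ := norm_pos_iff.2 (by rintro h; rw [h] at hw; simp at hw)
  set r := √(‖w‖ + ‖x‖) with hr
  have hrp : 0 < ‖w‖ + ‖x‖ := by rw [← hsn]; positivity
  have hr0 : 0 < r := Real.sqrt_pos.2 hrp
  have hrc : (r : ℂ) ≠ 0 := by exact_mod_cast hr0.ne'
  set v := (r : ℂ)⁻¹ • (w - x • e) with hv
  have hpe : hdot (w - x • e) e = 0 := by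
    rw [hdot_sub_left, hdot_smul_left, hdot_unit he, mul_one, sub_self]
  have hve : hdot v e = 0 := by rw [hv, hdot_smul_left, hpe, mul_zero]
  have hY : shiftPt e s₀ (s • e + v - (s₀ : ℂ) • e) = s • e + v := by rw [shiftPt]; abel
  have hS : sCoord e s₀ (s • e + v - (s₀ : ℂ) • e) = s := by
    rw [sCoord, hY, hdot_add_left, hdot_smul_left, hdot_unit he, hve]; simp
  have hwn : ‖w‖ ^ 2 = ‖x‖ ^ 2 + ‖w - x • e‖ ^ 2 := by
    rw [← norm_smul_add_sq he hpe, add_sub_cancel]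
  have hYn : ‖s • e + v‖ ^ 2 = ‖w‖ := by
    rw [norm_smul_add_sq he hve, hsn, hv, norm_smul, norm_inv, Complex.norm_real,
      Real.norm_of_nonneg hr0.le, mul_pow, inv_pow, hr, Real.sq_sqrt hrp.le]
    field_simp
    linarith
  refine ⟨s • e + v - (s₀ : ℂ) • e, ?_, hS⟩
  rw [chart, perpPart, stretchSq, hS, hY, hYn, hsn, add_comm ‖x‖, ← hr, add_sub_cancel_left, hv,
    smul_smul, mul_inv_cancel₀ hrc, one_smul, hs2]
  abel

/-- The chart maps the ball of radius `δ ≤ s₀` onto a sublevel set of the phase. -/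
lemma chart_image_ball (he : ‖e‖ = 1) {δ : ℝ} (hδ : 0 < δ) (hδs : δ ≤ s₀) :
    chart e s₀ '' Metric.ball 0 δ = {w | phase e s₀ w < δ ^ 2} := by
  ext w
  constructor
  · rintro ⟨y, hy, rfl⟩
    have hy : ‖y‖ < δ := by simpa using hy
    have := sCoord_re_ge (e := e) (s₀ := s₀) (y := y) he
    rw [Set.mem_ofPred_eq, phase_chart he (by linarith)]
    gcongr
  · intro hw
    have hw : phase e s₀ w < δ ^ 2 := hw
    have hre : 0 < (hdot w e ^ (1 / 2 : ℂ)).re := by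
      refine lt_of_le_of_ne (cpow_half_re_nonneg _) fun h => ?_
      rw [phase, ← h] at hw
      nlinarith [norm_nonneg w]
    obtain ⟨y, hy, hs⟩ := exists_chart_eq (s₀ := s₀) he hre
    refine ⟨y, ?_, hy⟩
    rw [← hy, phase_chart he (by rw [hs]; exact hre)] at hw
    simpa using lt_of_pow_lt_pow_left₀ 2 hδ.le hw

end Algebra

/-! ### The Jacobian of the chart -/

variable {e : Cn n} {s₀ : ℝ} {y : Cn n}

/-- `η ↦ η · e` as a continuous complex-linear functional. -/
def hdotL (e : Cn n) : Cn n →L[ℂ] ℂ := innerSL ℂ e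

lemma hdotL_apply (e η : Cn n) : hdotL e η = hdot η e := by
  rw [← inner_eq_hdot]; rfl

lemma hasFDerivAt_shiftPt : HasFDerivAt (shiftPt e s₀) (ContinuousLinearMap.id ℝ (Cn n)) y :=
  (hasFDerivAt_id y).add_const _

lemma sCoord_eq_hdotL : sCoord e s₀ = fun y => (hdotL e).restrictScalars ℝ (shiftPt e s₀ y) := by
  ext y; exact (hdotL_apply e _).symm

lemma hasFDerivAt_sCoord : HasFDerivAt (sCoord e s₀) ((hdotL e).restrictScalars ℝ) y := by
  rw [sCoord_eq_hdotL]
  exact ((hdotL e).restrictScalars ℝ).hasFDerivAt.comp y hasFDerivAt_shiftPt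

/-- The derivative of `stretchSq` is twice this functional. -/
def stretchDeriv (e : Cn n) (s₀ : ℝ) (y : Cn n) : Cn n →L[ℝ] ℝ :=
  (innerSL ℝ (sCoord e s₀ y)).comp ((hdotL e).restrictScalars ℝ) + innerSL ℝ (shiftPt e s₀ y)

lemma hasFDerivAt_stretchSq :
    HasFDerivAt (stretchSq e s₀) ((2 : ℝ) • stretchDeriv e s₀ y) y := by
  have h1 := (hasFDerivAt_sCoord (e := e) (s₀ := s₀) (y := y)).norm_sq
  have h2 := (hasFDerivAt_shiftPt (e := e) (s₀ := s₀) (y := y)).norm_sq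
  refine (h1.add h2).congr_fderiv ?_
  ext η
  simp [stretchDeriv]
  ring

/-- The derivative of `chart`. -/
def chartDeriv (e : Cn n) (s₀ : ℝ) (y : Cn n) : Cn n →L[ℝ] Cn n :=
  ((2 * sCoord e s₀ y) • (hdotL e).restrictScalars ℝ).smulRight e
    + ((√(stretchSq e s₀ y) : ℂ) • (ContinuousLinearMap.id ℝ (Cn n)
        - ((hdotL e).restrictScalars ℝ).smulRight e)
      + ((√(stretchSq e s₀ y))⁻¹ • stretchDeriv e s₀ y).smulRight (perpPart e s₀ y))

lemma hasFDerivAt_chart (hpos : 0 < stretchSq e s₀ y) :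
    HasFDerivAt (chart e s₀) (chartDeriv e s₀ y) y := by
  have hs := hasFDerivAt_sCoord (e := e) (s₀ := s₀) (y := y)
  have h1 : HasFDerivAt (fun y => sCoord e s₀ y ^ 2 • e)
      (((2 * sCoord e s₀ y) • (hdotL e).restrictScalars ℝ).smulRight e) y := by
    refine ((hs.pow 2).smul_const e).congr_fderiv ?_
    ext; simp
  have h2 : HasFDerivAt (perpPart e s₀) (ContinuousLinearMap.id ℝ (Cn n)
        - ((hdotL e).restrictScalars ℝ).smulRight e) y :=
    hasFDerivAt_shiftPt.sub (hs.smul_const e)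
  have h3 := (hasFDerivAt_stretchSq (e := e) (s₀ := s₀) (y := y)).sqrt hpos.ne'
  have h4 := Complex.ofRealCLM.hasFDerivAt.comp y h3
  refine (h1.add (h4.smul h2)).congr_fderiv ?_
  have hne : √(stretchSq e s₀ y) ≠ 0 := (Real.sqrt_pos.2 hpos).ne'
  ext1 η
  simp only [chartDeriv, add_apply, smul_apply, ContinuousLinearMap.smulRight_apply, sub_apply,
    ContinuousLinearMap.comp_apply, Complex.ofRealCLM_apply, Function.comp_apply, smul_eq_mul,
    ContinuousLinearMap.id_apply]
  congr 2
  rw [← Complex.coe_smul]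
  congr 2
  field_simp

lemma inner_shiftPt_perpPart (he : ‖e‖ = 1) :
    inner ℝ (shiftPt e s₀ y) (perpPart e s₀ y) = ‖perpPart e s₀ y‖ ^ 2 := by
  have h : inner ℝ (shiftPt e s₀ y) (perpPart e s₀ y)
      = (inner ℂ (shiftPt e s₀ y) (perpPart e s₀ y)).re := by
    simp [PiLp.inner_apply]
  rw [h]
  conv_lhs => rw [← smul_add_perpPart]
  rw [inner_add_left, inner_smul_left, inner_eq_hdot, hdot_perpPart he, mul_zero, zero_add,
    inner_self_eq_norm_sq_to_K]
  norm_cast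

lemma stretchDeriv_perpPart (he : ‖e‖ = 1) :
    stretchDeriv e s₀ y (perpPart e s₀ y) = ‖perpPart e s₀ y‖ ^ 2 := by
  have : (innerSL ℝ (shiftPt e s₀ y)) (perpPart e s₀ y) = ‖perpPart e s₀ y‖ ^ 2 :=
    inner_shiftPt_perpPart he
  rw [stretchDeriv, add_apply, this, ContinuousLinearMap.comp_apply,
    ContinuousLinearMap.coe_restrictScalars', hdotL_apply, hdot_perpPart he, map_zero, zero_add]

/-- The derivative of the chart is a complex-linear map followed by a rank-one perturbation of the
identity, so its determinant is explicit. -/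
lemma det_chartDeriv (he : ‖e‖ = 1) (hn : 2 ≤ n) (hpos : 0 < stretchSq e s₀ y) :
    |(chartDeriv e s₀ y).det| = 8 * ‖sCoord e s₀ y‖ ^ 2 * ‖shiftPt e s₀ y‖ ^ 2
      * stretchSq e s₀ y ^ (n - 2) := by
  set s := sCoord e s₀ y with hs
  set h := √(stretchSq e s₀ y) with hh
  have hh0 : 0 < h := Real.sqrt_pos.2 hpos
  have hhc : (h : ℂ) ≠ 0 := by exact_mod_cast hh0.ne'
  have hsq : h ^ 2 = stretchSq e s₀ y := Real.sq_sqrt hpos.le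
  set v := perpPart e s₀ y with hv
  set A : Cn n →ₗ[ℂ] Cn n := (h : ℂ) • LinearMap.transvection ((2 * s / h - 1) • (hdotL e).toLinearMap) e
    with hA
  have hAv : ∀ u, A u = (2 * s * hdot u e) • e + (h : ℂ) • (u - hdot u e • e) := by
    intro u
    rw [hA, LinearMap.smul_apply, LinearMap.transvection.apply, LinearMap.smul_apply]
    have : (hdotL e).toLinearMap u = hdot u e := hdotL_apply e u
    rw [this, smul_eq_mul, smul_add, smul_smul, smul_sub, smul_smul]
    have : (h : ℂ) * ((2 * s / h - 1) * hdot u e) = 2 * s * hdot u e - h * hdot u e := by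
      field_simp
    rw [this, sub_smul]
    abel
  have hfac : (chartDeriv e s₀ y).toLinearMap = (A.restrictScalars ℝ) ∘ₗ
      LinearMap.transvection ((h⁻¹ • stretchDeriv e s₀ y).toLinearMap) ((h : ℂ)⁻¹ • v) := by
    ext1 u
    have e1 : A v = (h : ℂ) • v := by
      rw [hAv, hdot_perpPart he]; simp
    rw [LinearMap.comp_apply, LinearMap.transvection.apply, LinearMap.restrictScalars_apply, map_add,
      ← Complex.coe_smul, map_smul, map_smul, e1, inv_smul_smul₀ hhc, hAv]
    simp only [chartDeriv, ContinuousLinearMap.coe_coe, add_apply, smul_apply, sub_apply,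
      ContinuousLinearMap.smulRight_apply, ContinuousLinearMap.coe_restrictScalars', hdotL_apply,
      ContinuousLinearMap.id_apply, smul_eq_mul, ← Complex.coe_smul]
    rw [add_assoc]
  have hdetA : LinearMap.det (A.restrictScalars ℝ) = h ^ (2 * n) * (4 * ‖s‖ ^ 2 / h ^ 2) := by
    rw [LinearMap.det_restrictScalars, Algebra.norm_complex_apply, hA, LinearMap.det_smul,
      LinearMap.transvection.det, LinearMap.smul_apply]
    have : (hdotL e).toLinearMap e = 1 := (hdotL_apply e e).trans (hdot_unit he)
    rw [this, smul_eq_mul, mul_one, add_sub_cancel, finrank_euclideanSpace_fin,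
      Complex.normSq_eq_norm_sq, norm_mul, norm_pow, norm_div, norm_mul, Complex.norm_real,
      Real.norm_of_nonneg hh0.le, Complex.norm_ofNat, mul_pow, ← pow_mul, div_pow, mul_comm 2 n]
    ring
  have hdet : (chartDeriv e s₀ y).det = h ^ (2 * n) * (4 * ‖s‖ ^ 2 / h ^ 2)
      * (1 + ‖v‖ ^ 2 / h ^ 2) := by
    have e2 : ((h⁻¹ • stretchDeriv e s₀ y).toLinearMap) ((h : ℂ)⁻¹ • v) = ‖v‖ ^ 2 / h ^ 2 := by
      rw [← Complex.ofReal_inv, Complex.coe_smul, map_smul, ContinuousLinearMap.coe_coe,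
        smul_apply, stretchDeriv_perpPart he, smul_eq_mul, smul_eq_mul, ← hv]
      field_simp
    rw [ContinuousLinearMap.det, hfac, LinearMap.det_comp, hdetA, LinearMap.transvection.det, e2]
  have hY := norm_shiftPt_sq (e := e) (s₀ := s₀) (y := y) he
  have hpow : h ^ (2 * n) = h ^ 4 * stretchSq e s₀ y ^ (n - 2) := by
    rw [← hsq, ← pow_mul, ← pow_add]; congr 1; omega
  have hst : h ^ 2 + ‖v‖ ^ 2 = 2 * ‖shiftPt e s₀ y‖ ^ 2 := by
    rw [hsq, stretchSq, hY]; ring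
  have e3 : h ^ (2 * n) * (4 * ‖s‖ ^ 2 / h ^ 2) * (1 + ‖v‖ ^ 2 / h ^ 2)
      = 8 * ‖s‖ ^ 2 * ‖shiftPt e s₀ y‖ ^ 2 * stretchSq e s₀ y ^ (n - 2) := by
    rw [hpow, show (1 : ℝ) + ‖v‖ ^ 2 / h ^ 2 = (h ^ 2 + ‖v‖ ^ 2) / h ^ 2 by field_simp, hst]
    field_simp
    ring
  rw [hdet, e3, abs_of_nonneg (by positivity)]

lemma stretchSq_pos (hs : 0 < (sCoord e s₀ y).re) : 0 < stretchSq e s₀ y := by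
  have : 0 < ‖sCoord e s₀ y‖ := norm_pos_iff.2 (by rintro h; rw [h] at hs; simp at hs)
  unfold stretchSq; positivity

/-- Change of variables to the ball in the chart. -/
lemma setIntegral_phase_lt (he : ‖e‖ = 1) (hn : 2 ≤ n) {δ : ℝ} (hδ : 0 < δ) (hδs : δ ≤ s₀)
    (f : Cn n → ℂ) :
    ∫ w in {w | phase e s₀ w < δ ^ 2}, f w = ∫ y in Metric.ball 0 δ,
      ((8 * ‖sCoord e s₀ y‖ ^ 2 * ‖shiftPt e s₀ y‖ ^ 2 * stretchSq e s₀ y ^ (n - 2) : ℝ) : ℂ)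
        * f (chart e s₀ y) := by
  have hre : ∀ y ∈ Metric.ball (0 : Cn n) δ, 0 < (sCoord e s₀ y).re := by
    intro y hy
    have hy : ‖y‖ < δ := by simpa using hy
    have := sCoord_re_ge (e := e) (s₀ := s₀) (y := y) he
    linarith
  rw [← chart_image_ball he hδ hδs, integral_image_eq_integral_abs_det_fderiv_smul volume
    Metric.isOpen_ball.measurableSet
    (fun y hy => (hasFDerivAt_chart (stretchSq_pos (hre y hy))).hasFDerivWithinAt)
    ((chart_injOn he).mono fun y hy => hre y hy)]
  refine setIntegral_congr_fun Metric.isOpen_ball.measurableSet fun y hy => ?_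
  rw [det_chartDeriv he hn (stretchSq_pos (hre y hy)), Complex.real_smul]

lemma contDiffAt_sCoord : ContDiffAt ℝ ∞ (sCoord e s₀) y := by
  rw [sCoord_eq_hdotL]
  exact ((hdotL e).restrictScalars ℝ).contDiff.contDiffAt.comp y
    (contDiffAt_id.add contDiffAt_const)

lemma contDiffAt_shiftPt : ContDiffAt ℝ ∞ (shiftPt e s₀) y := contDiffAt_id.add contDiffAt_const

lemma contDiffAt_stretchSq : ContDiffAt ℝ ∞ (stretchSq e s₀) y :=
  (contDiffAt_sCoord.norm_sq ℝ).add (contDiffAt_shiftPt.norm_sq ℝ)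

lemma contDiffAt_chart (hpos : 0 < stretchSq e s₀ y) : ContDiffAt ℝ ∞ (chart e s₀) y := by
  have h1 : ContDiffAt ℝ ∞ (fun y => (√(stretchSq e s₀ y) : ℂ)) y :=
    Complex.ofRealCLM.contDiff.contDiffAt.comp y (contDiffAt_stretchSq.sqrt hpos.ne')
  exact ((contDiffAt_sCoord.pow 2).smul contDiffAt_const).add
    (h1.smul (contDiffAt_shiftPt.sub (contDiffAt_sCoord.smul contDiffAt_const)))

/-! ### Wirtinger calculus -/

/-- The `i`-th complex coordinate as a real-linear functional. -/
def coordL (i : Fin n) : Cn n →L[ℝ] ℂ := (EuclideanSpace.proj i : Cn n →L[ℂ] ℂ).restrictScalars ℝ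

@[simp] lemma coordL_apply (i : Fin n) (η : Cn n) : coordL i η = η i := rfl

/-- The real-linear functional `η ↦ ∑ a_i η_i + ∑ b_i conj(η_i)`. -/
def wirtL (a b : Fin n → ℂ) : Cn n →L[ℝ] ℂ :=
  ∑ i, (a i • coordL i + b i • (Complex.conjCLE : ℂ →L[ℝ] ℂ).comp (coordL i))

lemma wirtL_apply (a b : Fin n → ℂ) (η : Cn n) :
    wirtL a b η = ∑ i, (a i * η i + b i * conj (η i)) := by
  simp [wirtL, sum_apply]

/-- `f` is real differentiable at `w` with Wirtinger derivatives `∂_i f = a_i`, `∂_{i bar} f = b_i`. -/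
def HasWirtAt (f : Cn n → ℂ) (a b : Fin n → ℂ) (w : Cn n) : Prop := HasFDerivAt f (wirtL a b) w

lemma wirtL_single (a b : Fin n → ℂ) (i : Fin n) (c : ℂ) :
    wirtL a b (EuclideanSpace.single i c) = a i * c + b i * conj c := by
  rw [wirtL_apply, Finset.sum_eq_single i]
  · simp
  · intro j _ hj; simp [hj]
  · simp

namespace HasWirtAt

variable {f g : Cn n → ℂ} {a b a' b' : Fin n → ℂ} {w : Cn n}

lemma dW_eq (h : HasWirtAt f a b w) (i : Fin n) : dW i f w = a i := by
  have h : HasFDerivAt f (wirtL a b) w := h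
  rw [dW, h.fderiv, wirtL_single, wirtL_single]
  simp only [map_one, Complex.conj_I]
  linear_combination (b i - a i) / 2 * Complex.I_sq

lemma dWbar_eq (h : HasWirtAt f a b w) (i : Fin n) : dWbar i f w = b i := by
  have h : HasFDerivAt f (wirtL a b) w := h
  rw [dWbar, h.fderiv, wirtL_single, wirtL_single]
  simp only [map_one, Complex.conj_I]
  linear_combination (a i - b i) / 2 * Complex.I_sq

lemma congr_fun (h : HasWirtAt f a b w) (hfg : g =ᶠ[𝓝 w] f) : HasWirtAt g a b w :=
  HasFDerivAt.congr_of_eventuallyEq h hfg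

lemma mul (hf : HasWirtAt f a b w) (hg : HasWirtAt g a' b' w) :
    HasWirtAt (fun u => f u * g u) (fun i => a i * g w + f w * a' i)
      (fun i => b i * g w + f w * b' i) w := by
  refine (HasFDerivAt.mul hf hg).congr_fderiv ?_
  ext η
  simp only [add_apply, smul_apply, wirtL_apply, smul_eq_mul, Finset.mul_sum,
    ← Finset.sum_add_distrib]
  exact Finset.sum_congr rfl fun i _ => by ring

lemma const_mul (hf : HasWirtAt f a b w) (c : ℂ) :
    HasWirtAt (fun u => c * f u) (fun i => c * a i) (fun i => c * b i) w := by
  refine (HasFDerivAt.const_mul hf c).congr_fderiv ?_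
  ext η
  simp only [smul_apply, wirtL_apply, smul_eq_mul, Finset.mul_sum]
  exact Finset.sum_congr rfl fun i _ => by ring

lemma add_const (hf : HasWirtAt f a b w) (c : ℂ) : HasWirtAt (fun u => f u + c) a b w :=
  HasFDerivAt.add_const c hf

lemma add (hf : HasWirtAt f a b w) (hg : HasWirtAt g a' b' w) :
    HasWirtAt (fun u => f u + g u) (fun i => a i + a' i) (fun i => b i + b' i) w := by
  refine (HasFDerivAt.add hf hg).congr_fderiv ?_
  ext η
  simp only [add_apply, wirtL_apply, ← Finset.sum_add_distrib]
  exact Finset.sum_congr rfl fun i _ => by ring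

lemma comp {φ : ℂ → ℂ} {φ' : ℂ} (hφ : HasDerivAt φ φ' (f w)) (hf : HasWirtAt f a b w) :
    HasWirtAt (fun u => φ (f u)) (fun i => φ' * a i) (fun i => φ' * b i) w := by
  refine ((hφ.hasFDerivAt.restrictScalars ℝ).comp w hf).congr_fderiv ?_
  ext η
  simp only [ContinuousLinearMap.comp_apply, wirtL_apply, ContinuousLinearMap.coe_restrictScalars',
    ContinuousLinearMap.toSpanSingleton_apply, smul_eq_mul, Finset.sum_mul]
  exact Finset.sum_congr rfl fun i _ => by ring

lemma cpow_const (hf : HasWirtAt f a b w) (hw : f w ∈ Complex.slitPlane) (c : ℂ) :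
    HasWirtAt (fun u => f u ^ c) (fun i => c * f w ^ (c - 1) * a i)
      (fun i => c * f w ^ (c - 1) * b i) w :=
  comp (φ := fun x => x ^ c) ((hasDerivAt_id (f w)).cpow_const hw |> fun h => by simpa using h) hf

end HasWirtAt

lemma hasWirtAt_conj_coord (j : Fin n) (w : Cn n) :
    HasWirtAt (fun u => conj (u j)) (fun _ => 0) (fun i => if i = j then 1 else 0) w := by
  have h : HasFDerivAt (fun u : Cn n => conj (u j))
      ((Complex.conjCLE : ℂ →L[ℝ] ℂ).comp (coordL j)) w :=
    ((Complex.conjCLE : ℂ →L[ℝ] ℂ).comp (coordL j)).hasFDerivAt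
  refine h.congr_fderiv ?_
  ext η
  simp [wirtL_apply]

lemma hasWirtAt_coord (j : Fin n) (w : Cn n) :
    HasWirtAt (fun u => u j) (fun i => if i = j then 1 else 0) (fun _ => 0) w := by
  have h : HasFDerivAt (fun u : Cn n => u j) (coordL j) w := (coordL j).hasFDerivAt
  refine h.congr_fderiv ?_
  ext η
  simp [wirtL_apply]

lemma hasWirtAt_hdot_left (z w : Cn n) :
    HasWirtAt (fun u => hdot u z) (fun i => conj (z i)) (fun _ => 0) w := by
  have h : HasFDerivAt (fun u : Cn n => hdot u z) (wirtL (fun i => conj (z i)) fun _ => 0) w := by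
    have e : (fun u : Cn n => hdot u z) = wirtL (fun i => conj (z i)) fun _ => 0 := by
      ext u; rw [wirtL_apply, hdot]; exact Finset.sum_congr rfl fun i _ => by ring
    rw [e]; exact ContinuousLinearMap.hasFDerivAt _
  exact h

lemma hasWirtAt_hdot_right (z w : Cn n) :
    HasWirtAt (fun u => hdot z u) (fun _ => 0) (fun i => z i) w := by
  have h : HasFDerivAt (fun u : Cn n => hdot z u) (wirtL (fun _ => 0) fun i => z i) w := by
    have e : (fun u : Cn n => hdot z u) = wirtL (fun _ => 0) fun i => z i := by
      ext u; rw [wirtL_apply, hdot]; exact Finset.sum_congr rfl fun i _ => by ring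
    rw [e]; exact ContinuousLinearMap.hasFDerivAt _
  exact h

lemma hasWirtAt_hdot_self (w : Cn n) :
    HasWirtAt (fun u => hdot u u) (fun i => conj (w i)) (fun i => w i) w := by
  have h : HasFDerivAt (fun u : Cn n => ∑ l, u l * conj (u l))
      (wirtL (fun i => conj (w i)) fun i => w i) w := by
    have h1 : ∀ l ∈ Finset.univ, HasFDerivAt (fun u : Cn n => u l * conj (u l))
        (w l • ((Complex.conjCLE : ℂ →L[ℝ] ℂ).comp (coordL l)) + conj (w l) • coordL l) w :=
      fun l _ => (coordL l).hasFDerivAt.mul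
        ((Complex.conjCLE : ℂ →L[ℝ] ℂ).comp (coordL l)).hasFDerivAt
    refine (HasFDerivAt.fun_sum h1).congr_fderiv ?_
    ext η
    simp [wirtL_apply, sum_apply, add_comm]
  exact h

/-- The function `w ↦ |w|^α`, complex valued. -/
def normPow (α : ℝ) (w : Cn n) : ℂ := ((‖w‖ ^ α : ℝ) : ℂ)

lemma normPow_eq_cpow (α : ℝ) (w : Cn n) : normPow α w = hdot w w ^ ((α / 2 : ℝ) : ℂ) := by
  rw [hdot_self, normPow, ← Complex.ofReal_pow, ← Complex.ofReal_cpow (by positivity),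
    ← Real.rpow_natCast, ← Real.rpow_mul (norm_nonneg w)]
  congr 2; push_cast; ring

lemma normPow_add {w : Cn n} (hw : w ≠ 0) (α β : ℝ) :
    normPow (α + β) w = normPow α w * normPow β w := by
  rw [normPow, Real.rpow_add (norm_pos_iff.2 hw), Complex.ofReal_mul]; rfl

lemma normPow_neg_natCast (k : ℕ) (w : Cn n) : normPow (-(k : ℝ)) w = ((‖w‖ : ℂ) ^ k)⁻¹ := by
  rw [normPow, Real.rpow_neg (norm_nonneg w), Real.rpow_natCast, Complex.ofReal_inv,
    Complex.ofReal_pow]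

lemma hdot_self_mem_slitPlane {w : Cn n} (hw : w ≠ 0) : hdot w w ∈ Complex.slitPlane := by
  rw [hdot_self, ← Complex.ofReal_pow, Complex.ofReal_mem_slitPlane]
  have := norm_pos_iff.2 hw
  positivity

lemma hasWirtAt_normPow {w : Cn n} (hw : w ≠ 0) (α : ℝ) :
    HasWirtAt (normPow α) (fun i => (α / 2 : ℝ) * normPow (α - 2) w * conj (w i))
      (fun i => (α / 2 : ℝ) * normPow (α - 2) w * w i) w := by
  have h := (hasWirtAt_hdot_self w).cpow_const (hdot_self_mem_slitPlane hw) ((α / 2 : ℝ) : ℂ)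
  have e : normPow (α - 2) w = hdot w w ^ (((α / 2 : ℝ) : ℂ) - 1) := by
    rw [normPow_eq_cpow]; congr 1; push_cast; ring
  rw [e]
  exact h.congr_fun (Eventually.of_forall fun u => normPow_eq_cpow α u)

/-! ### The Kähler metric with potential `2|w|` -/

lemma metric_apply {w : Cn n} (hw : w ≠ 0) (i j : Fin n) :
    metric w i j = (if i = j then normPow (-1) w else 0)
      - normPow (-3) w / 2 * (conj (w i) * w j) := by
  rw [metric, Matrix.of_apply]
  have h1 : dW i potential =ᶠ[𝓝 w] fun u : Cn n => normPow (-1) u * conj (u i) := by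
    filter_upwards [isOpen_ne.mem_nhds hw] with u hu
    have h := ((hasWirtAt_normPow hu 1).const_mul 2).congr_fun (g := potential)
      (Eventually.of_forall fun v => by simp [potential, normPow])
    rw [h.dW_eq i, show (1 : ℝ) - 2 = -1 by norm_num]
    push_cast; ring
  have h2 := (((hasWirtAt_normPow hw (-1)).mul (hasWirtAt_conj_coord i w)).congr_fun h1).dWbar_eq j
  rw [h2, show (-1 : ℝ) - 2 = -3 by norm_num]
  simp only [eq_comm (a := j)]
  split_ifs <;> (push_cast; ring)

lemma ofReal_norm_ne_zero {w : Cn n} (hw : w ≠ 0) : (‖w‖ : ℂ) ≠ 0 := by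
  exact_mod_cast (norm_pos_iff.2 hw).ne'

lemma sum_conj_mul (w : Cn n) : ∑ i, conj (w i) * w i = (‖w‖ : ℂ) ^ 2 := by
  rw [← hdot_self, hdot]; exact Finset.sum_congr rfl fun i _ => mul_comm _ _

lemma metric_eq {w : Cn n} (hw : w ≠ 0) : metric w = normPow (-1) w •
    ((1 : Matrix (Fin n) (Fin n) ℂ) + Matrix.vecMulVec
      (fun i => -(1 / (2 * (‖w‖ : ℂ) ^ 2)) * conj (w i)) (fun j => w j)) := by
  ext i j
  have h3 : normPow (-3) w = normPow (-1) w * ((‖w‖ : ℂ) ^ 2)⁻¹ := by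
    rw [← normPow_neg_natCast, ← normPow_add hw]; norm_num
  rw [metric_apply hw, h3, Matrix.smul_apply, Matrix.add_apply, Matrix.vecMulVec_apply,
    Matrix.one_apply, smul_eq_mul]
  have := ofReal_norm_ne_zero hw
  split_ifs <;> (field_simp; try ring)

lemma metricDet_eq {w : Cn n} (hw : w ≠ 0) : metricDet w = normPow (-(n : ℝ)) w / 2 := by
  rw [metricDet, metric_eq hw, Matrix.det_smul, Fintype.card_fin, Matrix.vecMulVec_eq Unit,
    Matrix.det_one_add_replicateCol_mul_replicateRow, normPow_neg_natCast]
  have h1 : normPow (-1) w = (‖w‖ : ℂ)⁻¹ := by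
    have := normPow_neg_natCast 1 w
    simpa using this
  have h2 : (fun j => w j) ⬝ᵥ (fun i => -(1 / (2 * (‖w‖ : ℂ) ^ 2)) * conj (w i)) = -(1 / 2) := by
    rw [dotProduct]
    have e : ∀ i, w i * (-(1 / (2 * (‖w‖ : ℂ) ^ 2)) * conj (w i))
        = -(1 / (2 * (‖w‖ : ℂ) ^ 2)) * (conj (w i) * w i) := fun i => by ring
    simp_rw [e]
    rw [← Finset.mul_sum, sum_conj_mul]
    have := ofReal_norm_ne_zero hw
    field_simp
  rw [h1, h2, inv_pow]
  ring

lemma metricInv_eq {w : Cn n} (hw : w ≠ 0) (j i : Fin n) :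
    metricInv w j i = (if j = i then (‖w‖ : ℂ) else 0) + w i * conj (w j) / ‖w‖ := by
  have h0 := ofReal_norm_ne_zero hw
  have h1 : normPow (-1) w = (‖w‖ : ℂ)⁻¹ := by
    have := normPow_neg_natCast 1 w
    simpa using this
  have hinv : metric w * Matrix.of (fun j i : Fin n => (if j = i then (‖w‖ : ℂ) else 0)
      + w i * conj (w j) / ‖w‖) = 1 := by
    ext k i
    rw [metric_eq hw, h1, Matrix.smul_mul, Matrix.smul_apply, Matrix.mul_apply, Matrix.one_apply]
    simp only [Matrix.add_apply, Matrix.one_apply, Matrix.vecMulVec_apply, Matrix.of_apply, add_mul,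
      mul_add, Finset.sum_add_distrib, ite_mul, mul_ite, one_mul, mul_zero, zero_mul,
      Finset.sum_ite_eq, Finset.sum_ite_eq', Finset.mem_univ, if_true, smul_eq_mul]
    have e : ∀ x, -(1 / (2 * (‖w‖ : ℂ) ^ 2)) * conj (w k) * w x * (w i * conj (w x) / ‖w‖)
        = -(1 / (2 * (‖w‖ : ℂ) ^ 2)) * conj (w k) * w i / ‖w‖ * (conj (w x) * w x) :=
      fun x => by ring
    simp_rw [e]
    rw [← Finset.mul_sum, sum_conj_mul]
    split_ifs <;> (field_simp; ring)
  rw [metricInv, Matrix.inv_eq_right_inv hinv, Matrix.of_apply]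

/-- Contraction of the inverse metric with an invariant tensor. -/
lemma sum_metricInv_mul {w : Cn n} (hw : w ≠ 0) (c d : ℂ) :
    ∑ i, ∑ j, metricInv w j i * ((if i = j then c else 0) + d * (conj (w i) * w j))
      = c * (n + 1) * ‖w‖ + 2 * d * (‖w‖ : ℂ) ^ 3 := by
  have h0 := ofReal_norm_ne_zero hw
  simp_rw [metricInv_eq hw]
  simp only [add_mul, mul_add, Finset.sum_add_distrib, ite_mul, mul_ite, mul_zero, zero_mul,
      Finset.sum_ite_eq, Finset.sum_ite_eq', Finset.mem_univ, if_true, Finset.sum_const,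
      Finset.card_univ, Fintype.card_fin, nsmul_eq_mul]
  have e1 : ∑ x, (‖w‖ : ℂ) * (d * (conj (w x) * w x)) = ‖w‖ * (d * (‖w‖ : ℂ) ^ 2) := by
    rw [← Finset.mul_sum, ← Finset.mul_sum, sum_conj_mul]
  have e2 : ∑ x, w x * conj (w x) / ‖w‖ * c = (‖w‖ : ℂ) ^ 2 / ‖w‖ * c := by
    rw [← Finset.sum_mul, ← Finset.sum_div, ← hdot_self, hdot]
  have e3 : ∑ x, ∑ y, w x * conj (w y) / ‖w‖ * (d * (conj (w x) * w y))
      = d / ‖w‖ * ((‖w‖ : ℂ) ^ 2 * (‖w‖ : ℂ) ^ 2) := by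
    rw [← sum_conj_mul, Finset.sum_mul_sum, Finset.mul_sum]
    refine Finset.sum_congr rfl fun x _ => ?_
    rw [Finset.mul_sum]
    exact Finset.sum_congr rfl fun y _ => by ring
  rw [e1, e2, e3]
  field_simp
  ring

lemma scalarCurvature_eq {z : Cn n} (hz : z ≠ 0) :
    scalarCurvature z = -(n * (n - 1)) / (2 * (‖z‖ : ℂ)) := by
  have h0 := ofReal_norm_ne_zero hz
  have hlog : ∀ u : Cn n, u ≠ 0 → Complex.log (metricDet u)
      = -(n / 2) * Complex.log (hdot u u) + -(Real.log 2 : ℂ) := by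
    intro u hu
    have hu' := norm_pos_iff.2 hu
    rw [metricDet_eq hu, hdot_self, normPow, ← Complex.ofReal_pow, ← Complex.ofReal_log (by positivity)]
    have : ((‖u‖ ^ (-(n : ℝ)) : ℝ) : ℂ) / 2 = ((‖u‖ ^ (-(n : ℝ)) / 2 : ℝ) : ℂ) := by push_cast; rfl
    rw [this, ← Complex.ofReal_log (by positivity), Real.log_div (by positivity) two_ne_zero,
      Real.log_rpow hu', Real.log_pow]
    push_cast; ring
  have hne : ∀ᶠ u : Cn n in 𝓝 z, u ≠ 0 := isOpen_ne.mem_nhds hz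
  have hbar : ∀ j, dWbar j (fun u : Cn n => Complex.log (metricDet u)) =ᶠ[𝓝 z]
      fun u => -(n / 2) * (normPow (-2) u * u j) := by
    intro j
    filter_upwards [hne] with u hu
    have h1 := ((HasWirtAt.comp (f := fun v => hdot v v) (Complex.hasDerivAt_log (hdot_self_mem_slitPlane hu))
      (hasWirtAt_hdot_self u)).const_mul (-(n / 2))).add_const (-(Real.log 2 : ℂ))
    have h2 := h1.congr_fun (g := fun u : Cn n => Complex.log (metricDet u))
      (Filter.Eventually.mono (show ∀ᶠ v : Cn n in 𝓝 u, v ≠ 0 from isOpen_ne.mem_nhds hu)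
        fun v hv => hlog v hv)
    rw [h2.dWbar_eq j]
    have := normPow_neg_natCast 2 u
    push_cast at this
    rw [this, hdot_self]
  have key : ∀ i j, dW i (dWbar j fun u : Cn n => Complex.log (metricDet u)) z
      = (if i = j then -(n / 2) * normPow (-2) z else 0)
        + (n / 2) * normPow (-4) z * (conj (z i) * z j) := by
    intro i j
    have h := ((((hasWirtAt_normPow hz (-2)).mul (hasWirtAt_coord j z)).const_mul
      (-(n / 2))).congr_fun (hbar j)).dW_eq i
    rw [h, show (-2 : ℝ) - 2 = -4 by norm_num]
    split_ifs <;> (push_cast; ring)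
  rw [scalarCurvature, laplaceBeltrami]
  simp_rw [key]
  rw [sum_metricInv_mul hz]
  have h2 := normPow_neg_natCast 2 z
  have h4 := normPow_neg_natCast 4 z
  push_cast at h2 h4
  rw [h2, h4]
  field_simp
  ring

/-! ### The coefficient of `ħ` in real terms -/

lemma hdot_self_cpow {z : Cn n} (c : ℝ) : hdot z z ^ (c : ℂ) = normPow (2 * c) z := by
  rw [normPow_eq_cpow]; congr 2; ring

/-- The mixed second Wirtinger derivatives of `|w|^α (z·w)^a (w·z)^b` at `w = z`. -/
lemma dWbar_dW_weight {z : Cn n} (hz : z ≠ 0) (α a b : ℝ) (i j : Fin n) :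
    dWbar j (dW i fun w => normPow α w * hdot z w ^ (a : ℂ) * hdot w z ^ (b : ℂ)) z
      = normPow (α + 2 * a + 2 * b) z * ((if i = j then (α / 2) * normPow (-2) z else 0)
        + normPow (-4) z * ((α / 2 + a) * (α / 2 + b) - α / 2) * (conj (z i) * z j)) := by
  have hsl := hdot_self_mem_slitPlane hz
  have hl : ∀ᶠ w : Cn n in 𝓝 z, hdot z w ∈ Complex.slitPlane := by
    have hc : ContinuousAt (fun w => hdot z w) z :=
      HasFDerivAt.continuousAt (hasWirtAt_hdot_right z z)
    exact hc.eventually_mem (Complex.isOpen_slitPlane.mem_nhds hsl)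
  have hr : ∀ᶠ w : Cn n in 𝓝 z, hdot w z ∈ Complex.slitPlane := by
    have hc : ContinuousAt (fun w => hdot w z) z :=
      HasFDerivAt.continuousAt (hasWirtAt_hdot_left z z)
    exact hc.eventually_mem (Complex.isOpen_slitPlane.mem_nhds hsl)
  have hfirst : dW i (fun w => normPow α w * hdot z w ^ (a : ℂ) * hdot w z ^ (b : ℂ)) =ᶠ[𝓝 z]
      fun w => (α / 2 : ℝ) * (normPow (α - 2) w * conj (w i) * hdot z w ^ (a : ℂ)
          * hdot w z ^ (b : ℂ))
        + (b * conj (z i)) * (normPow α w * hdot z w ^ (a : ℂ) * hdot w z ^ ((b - 1 : ℝ) : ℂ)) := by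
    filter_upwards [hl, hr, (isOpen_ne.mem_nhds hz : ∀ᶠ u : Cn n in 𝓝 z, u ≠ 0)] with w h1 h2 h3
    have h := ((hasWirtAt_normPow h3 α).mul ((hasWirtAt_hdot_right z w).cpow_const h1 a)).mul
      ((hasWirtAt_hdot_left z w).cpow_const h2 b)
    rw [h.dW_eq i]
    push_cast
    ring
  have hsecond := (((((hasWirtAt_normPow hz (α - 2)).mul (hasWirtAt_conj_coord i z)).mul
      ((hasWirtAt_hdot_right z z).cpow_const hsl a)).mul
      ((hasWirtAt_hdot_left z z).cpow_const hsl b)).const_mul ((α / 2 : ℝ) : ℂ)).add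
    ((((hasWirtAt_normPow hz α).mul ((hasWirtAt_hdot_right z z).cpow_const hsl a)).mul
      ((hasWirtAt_hdot_left z z).cpow_const hsl ((b - 1 : ℝ) : ℂ))).const_mul (b * conj (z i)))
  rw [(hsecond.congr_fun hfirst).dWbar_eq j]
  have ha : hdot z z ^ ((a : ℂ) - 1) = normPow (2 * a) z * normPow (-2) z := by
    rw [← normPow_add hz, show ((a : ℂ) - 1) = ((a - 1 : ℝ) : ℂ) by push_cast; rfl, hdot_self_cpow]
    congr 1; ring
  have hb : hdot z z ^ ((b - 1 : ℝ) : ℂ) = normPow (2 * b) z * normPow (-2) z := by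
    rw [← normPow_add hz, hdot_self_cpow]; congr 1; ring
  have e1 : normPow (α - 2) z = normPow α z * normPow (-2) z := by
    rw [← normPow_add hz, sub_eq_add_neg]
  have e2 : normPow (α - 2 - 2) z = normPow α z * normPow (-2) z * normPow (-2) z := by
    rw [← normPow_add hz, ← normPow_add hz]; ring_nf
  have e3 : normPow (-4) z = normPow (-2) z * normPow (-2) z := by
    rw [← normPow_add hz]; norm_num
  have e4 : normPow (α + 2 * a + 2 * b) z = normPow α z * normPow (2 * a) z * normPow (2 * b) z := by
    rw [← normPow_add hz, ← normPow_add hz]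
  rw [hdot_self_cpow, hdot_self_cpow, ha, hb, e1, e2, e3, e4]
  simp only [eq_comm (a := j)]
  split_ifs <;> (push_cast; ring)

/-- The term of the expansion coming from the weight `ξ / g`. -/
lemma sum_metricInv_mul_xi {z : Cn n} (hz : z ≠ 0) (p ν μ : ℝ) :
    ∑ i, ∑ j, metricInv z j i * dWbar j (dW i fun w => xi p ν μ z w / metricDet w) z
      = 2 * normPow (n + p - ν) z / ‖z‖ * ((n + p - ν) * (n + p - μ) / 2
        + (n - 1) * (n + p - 1 / 2) / 2) := by
  have h0 := ofReal_norm_ne_zero hz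
  set α : ℝ := n + p - 1 / 2 with hα
  set a : ℝ := -μ / 2 + 1 / 4 with ha
  set b : ℝ := -ν / 2 + 1 / 4 with hb
  set c : ℂ := 2 * normPow (μ - 1 / 2) z with hc
  have hxi : ∀ᶠ w : Cn n in 𝓝 z, xi p ν μ z w / metricDet w
      = c * (normPow α w * hdot z w ^ (a : ℂ) * hdot w z ^ (b : ℂ)) := by
    filter_upwards [(isOpen_ne.mem_nhds hz : ∀ᶠ u : Cn n in 𝓝 z, u ≠ 0)] with w hw
    have h1 : normPow α w * normPow (-(n : ℝ)) w = normPow (p - 1 / 2) w := by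
      rw [← normPow_add hw]; congr 1; rw [hα]; ring
    have h2 : normPow (-(n : ℝ)) w ≠ 0 := by
      rw [normPow_neg_natCast]
      exact inv_ne_zero (pow_ne_zero _ (ofReal_norm_ne_zero hw))
    rw [xi, metricDet_eq hw, Complex.ofReal_mul]
    change normPow (μ - 1 / 2) z * normPow (p - 1 / 2) w * hdot z w ^ (a : ℂ) * hdot w z ^ (b : ℂ)
      / _ = _
    rw [← h1, hc]
    generalize hdot z w ^ (a : ℂ) = X
    generalize hdot w z ^ (b : ℂ) = Y
    generalize normPow (μ - 1 / 2) z = Z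
    field_simp
  have key : ∀ i j, dWbar j (dW i fun w => xi p ν μ z w / metricDet w) z
      = (if i = j then c * normPow (α + 2 * a + 2 * b) z * (α / 2) * normPow (-2) z else 0)
        + c * normPow (α + 2 * a + 2 * b) z * normPow (-4) z *
          ((α / 2 + a) * (α / 2 + b) - α / 2) * (conj (z i) * z j) := by
    intro i j
    have h1 : dW i (fun w => xi p ν μ z w / metricDet w) =ᶠ[𝓝 z]
        dW i fun w => c * (normPow α w * hdot z w ^ (a : ℂ) * hdot w z ^ (b : ℂ)) := by
      have : (fun w => xi p ν μ z w / metricDet w) =ᶠ[𝓝 z]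
        fun w => c * (normPow α w * hdot z w ^ (a : ℂ) * hdot w z ^ (b : ℂ)) := hxi
      filter_upwards [this.fderiv (𝕜 := ℝ)] with w hw
      rw [dW, dW, hw]
    have hdiff : ∀ᶠ w : Cn n in 𝓝 z, DifferentiableAt ℝ
        (fun w => normPow α w * hdot z w ^ (a : ℂ) * hdot w z ^ (b : ℂ)) w := by
      have hsl := hdot_self_mem_slitPlane hz
      have hcl : ContinuousAt (fun w => hdot z w) z :=
        HasFDerivAt.continuousAt (hasWirtAt_hdot_right z z)
      have hcr : ContinuousAt (fun w => hdot w z) z :=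
        HasFDerivAt.continuousAt (hasWirtAt_hdot_left z z)
      filter_upwards [hcl.eventually_mem (Complex.isOpen_slitPlane.mem_nhds hsl),
        hcr.eventually_mem (Complex.isOpen_slitPlane.mem_nhds hsl),
        (isOpen_ne.mem_nhds hz : ∀ᶠ u : Cn n in 𝓝 z, u ≠ 0)] with w h1 h2 h3
      have h : HasFDerivAt _ _ _ :=
        ((hasWirtAt_normPow h3 α).mul ((hasWirtAt_hdot_right z w).cpow_const h1 a)).mul
        ((hasWirtAt_hdot_left z w).cpow_const h2 b)
      exact h.differentiableAt
    have h2 : dW i (fun w => c * (normPow α w * hdot z w ^ (a : ℂ) * hdot w z ^ (b : ℂ))) =ᶠ[𝓝 z]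
        fun w => c * dW i (fun w => normPow α w * hdot z w ^ (a : ℂ) * hdot w z ^ (b : ℂ)) w := by
      filter_upwards [hdiff] with w hw
      rw [dW, dW, fderiv_const_mul hw, smul_apply, smul_apply, smul_eq_mul, smul_eq_mul]
      ring
    have h3 : ∀ g : Cn n → ℂ, dWbar j (fun w => c * g w) z = c * dWbar j g z := by
      intro g
      have : fderiv ℝ (fun w => c * g w) z = c • fderiv ℝ g z :=
        congrFun (fderiv_const_smul_field (𝕜 := ℝ) (f := g) c) z
      rw [dWbar, dWbar, this, smul_apply, smul_apply, smul_eq_mul, smul_eq_mul]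
      ring
    have h4 := (h1.trans h2).fderiv_eq (𝕜 := ℝ)
    have h5 : dWbar j (dW i fun w => xi p ν μ z w / metricDet w) z = dWbar j (fun w => c *
        dW i (fun w => normPow α w * hdot z w ^ (a : ℂ) * hdot w z ^ (b : ℂ)) w) z := by
      rw [dWbar, dWbar, h4]
    rw [h5, h3, dWbar_dW_weight hz]
    split_ifs <;> ring
  simp_rw [key]
  rw [sum_metricInv_mul hz]
  have h2 := normPow_neg_natCast 2 z
  have h4 := normPow_neg_natCast 4 z
  push_cast at h2 h4
  have e : c * normPow (α + 2 * a + 2 * b) z = 2 * normPow (n + p - ν) z := by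
    rw [hc, mul_assoc, ← normPow_add hz]
    congr 2; rw [hα, ha, hb]; ring
  rw [e, h2, h4, hα, ha, hb]
  push_cast
  field_simp
  ring

/-! ### Derivatives of the symbol in real directions -/

lemma sum_smul_single (z : Cn n) : ∑ i, z i • EuclideanSpace.single i (1 : ℂ) = z := by
  ext l
  simp only [WithLp.ofLp_sum, WithLp.ofLp_smul, Finset.sum_apply, Pi.smul_apply,
    PiLp.single_apply]
  rw [Finset.sum_eq_single l]
  · simp
  · intro k _ hk; simp [hk.symm]
  · simp

lemma realLin_smul (ℓ : Cn n →L[ℝ] ℂ) (c : ℂ) (v : Cn n) :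
    ℓ (c • v) = c.re * ℓ v + c.im * ℓ (Complex.I • v) := by
  conv_lhs => rw [← Complex.re_add_im c, add_smul, mul_smul, Complex.coe_smul, Complex.coe_smul,
    map_add, map_smul, map_smul]
  simp

lemma single_I (i : Fin n) : (EuclideanSpace.single i Complex.I : Cn n)
    = Complex.I • EuclideanSpace.single i (1 : ℂ) := by
  ext l; by_cases h : l = i <;> simp [h]

lemma sum_mul_sub_I (ℓ : Cn n →L[ℝ] ℂ) (z : Cn n) :
    ∑ i, z i * (ℓ (EuclideanSpace.single i 1) - Complex.I * ℓ (EuclideanSpace.single i Complex.I))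
      = ℓ z - Complex.I * ℓ (Complex.I • z) := by
  conv_rhs => rw [← sum_smul_single z, Finset.smul_sum, map_sum, map_sum, Finset.mul_sum,
    ← Finset.sum_sub_distrib]
  refine Finset.sum_congr rfl fun i _ => ?_
  rw [single_I, realLin_smul ℓ (z i), smul_smul, realLin_smul ℓ (Complex.I * z i)]
  conv_lhs => rw [← Complex.re_add_im (z i)]
  simp only [Complex.mul_re, Complex.mul_im,
    Complex.I_re, Complex.I_im, zero_mul, one_mul, zero_sub, zero_add, Complex.ofReal_neg]
  linear_combination (-(z i).im * ℓ (Complex.I • EuclideanSpace.single i (1:ℂ))) * Complex.I_sq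

lemma sum_conj_mul_add_I (ℓ : Cn n →L[ℝ] ℂ) (z : Cn n) :
    ∑ i, conj (z i) *
        (ℓ (EuclideanSpace.single i 1) + Complex.I * ℓ (EuclideanSpace.single i Complex.I))
      = ℓ z + Complex.I * ℓ (Complex.I • z) := by
  conv_rhs => rw [← sum_smul_single z, Finset.smul_sum, map_sum, map_sum, Finset.mul_sum,
    ← Finset.sum_add_distrib]
  refine Finset.sum_congr rfl fun i _ => ?_
  rw [single_I, realLin_smul ℓ (z i), smul_smul, realLin_smul ℓ (Complex.I * z i)]
  conv_lhs => rw [← Complex.re_add_im (z i)]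
  simp only [map_add, map_mul, Complex.conj_ofReal, Complex.conj_I, Complex.mul_re, Complex.mul_im,
    Complex.I_re, Complex.I_im, zero_mul, one_mul, zero_sub, zero_add, Complex.ofReal_neg]
  linear_combination (-(z i).im * ℓ (Complex.I • EuclideanSpace.single i (1:ℂ))) * Complex.I_sq

/-- Mixed Wirtinger derivatives in terms of the real second derivative. -/
lemma dW_dWbar_eq {β : Cn n → ℂ} (hβ : ContDiff ℝ ∞ β) (z : Cn n) (i j : Fin n) :
    dW i (dWbar j β) z =
      ((fderiv ℝ (fderiv ℝ β) z (EuclideanSpace.single i 1) (EuclideanSpace.single j 1)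
        + Complex.I * fderiv ℝ (fderiv ℝ β) z (EuclideanSpace.single i 1)
          (EuclideanSpace.single j Complex.I))
      - Complex.I * (fderiv ℝ (fderiv ℝ β) z (EuclideanSpace.single i Complex.I)
          (EuclideanSpace.single j 1)
        + Complex.I * fderiv ℝ (fderiv ℝ β) z (EuclideanSpace.single i Complex.I)
          (EuclideanSpace.single j Complex.I))) / 4 := by
  have hd : DifferentiableAt ℝ (fderiv ℝ β) z :=
    ((hβ.fderiv_right (m := ∞) (by simp)).differentiable (by simp)) z
  set B := fderiv ℝ (fderiv ℝ β) z with hB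
  have h1 : ∀ v : Cn n, HasFDerivAt (fun w => fderiv ℝ β w v) (B.flip v) z := fun v =>
    ((ContinuousLinearMap.apply ℝ ℂ v).hasFDerivAt.comp z hd.hasFDerivAt).congr_fderiv
      (by ext; simp [hB])
  have h2 : HasFDerivAt (dWbar j β) ((1 / 2 : ℂ) • (B.flip (EuclideanSpace.single j 1)
      + Complex.I • B.flip (EuclideanSpace.single j Complex.I))) z := by
    have := ((h1 (EuclideanSpace.single j 1)).add
      ((h1 (EuclideanSpace.single j Complex.I)).const_mul Complex.I)).const_mul (1 / 2 : ℂ)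
    refine this.congr_of_eventuallyEq (Eventually.of_forall fun w => ?_)
    simp only [dWbar, Pi.add_apply]
    ring
  rw [dW, h2.fderiv]
  simp only [smul_apply, add_apply, ContinuousLinearMap.flip_apply, smul_eq_mul]
  ring

lemma symm_fderiv_fderiv {β : Cn n → ℂ} (hβ : ContDiff ℝ ∞ β) (z u v : Cn n) :
    fderiv ℝ (fderiv ℝ β) z u v = fderiv ℝ (fderiv ℝ β) z v u := by
  have : IsSymmSndFDerivAt ℝ β z := hβ.contDiffAt.isSymmSndFDerivAt
    (by rw [minSmoothness_of_isRCLikeNormedField]; exact WithTop.coe_le_coe.2 (le_top : (2 : ℕ∞) ≤ ⊤))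
  exact this.eq u v

lemma laplaceBeltrami_symbol {β : Cn n → ℂ} (hβ : ContDiff ℝ ∞ β) {z : Cn n} (hz : z ≠ 0) :
    ∑ i, ∑ j, metricInv z j i * dW i (dWbar j β) z
      = ‖z‖ / 4 * (∑ k, fderiv ℝ (fderiv ℝ β) z (realVec k) (realVec k))
        + (fderiv ℝ (fderiv ℝ β) z z z
          + fderiv ℝ (fderiv ℝ β) z (Complex.I • z) (Complex.I • z)) / (4 * ‖z‖) := by
  have h0 := ofReal_norm_ne_zero hz
  set B := fderiv ℝ (fderiv ℝ β) z with hB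
  have hsymm : ∀ u v, B u v = B v u := symm_fderiv_fderiv hβ z
  have hdiag : ∀ i, dW i (dWbar i β) z = (B (EuclideanSpace.single i 1) (EuclideanSpace.single i 1)
      + B (EuclideanSpace.single i Complex.I) (EuclideanSpace.single i Complex.I)) / 4 := by
    intro i
    rw [dW_dWbar_eq hβ, ← hB, hsymm (EuclideanSpace.single i Complex.I) (EuclideanSpace.single i 1)]
    linear_combination (-(B (EuclideanSpace.single i Complex.I)
      (EuclideanSpace.single i Complex.I)) / 4) * Complex.I_sq
  have htr : ∑ k, B (realVec k) (realVec k) = 4 * ∑ i, dW i (dWbar i β) z := by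
    rw [Fintype.sum_prod_type, Finset.mul_sum]
    refine Finset.sum_congr rfl fun i _ => ?_
    rw [hdiag, Fintype.sum_bool]
    simp only [realVec, cond_true, cond_false]
    ring
  have hrank : ∑ i, ∑ j, z i * conj (z j) * dW i (dWbar j β) z
      = (B z z + B (Complex.I • z) (Complex.I • z)) / 4 := by
    have inner : ∀ i, ∑ j, z i * conj (z j) * dW i (dWbar j β) z
        = z i * ((B (EuclideanSpace.single i 1) z + Complex.I * B (EuclideanSpace.single i 1) (Complex.I • z))
          - Complex.I * (B (EuclideanSpace.single i Complex.I) z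
            + Complex.I * B (EuclideanSpace.single i Complex.I) (Complex.I • z))) / 4 := by
      intro i
      rw [← sum_conj_mul_add_I (B (EuclideanSpace.single i 1)) z,
        ← sum_conj_mul_add_I (B (EuclideanSpace.single i Complex.I)) z, Finset.mul_sum,
        ← Finset.sum_sub_distrib, Finset.mul_sum, Finset.sum_div]
      refine Finset.sum_congr rfl fun j _ => ?_
      rw [dW_dWbar_eq hβ]
      ring
    simp_rw [inner]
    have h1 := sum_mul_sub_I (B.flip z + Complex.I • B.flip (Complex.I • z)) z
    simp only [add_apply, smul_apply, ContinuousLinearMap.flip_apply, smul_eq_mul] at h1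
    rw [← Finset.sum_div, h1, hsymm (Complex.I • z) z]
    linear_combination (-(B (Complex.I • z) (Complex.I • z)) / 4) * Complex.I_sq
  have hexp : ∑ i, ∑ j, metricInv z j i * dW i (dWbar j β) z
      = ‖z‖ * ∑ i, dW i (dWbar i β) z
        + (∑ i, ∑ j, z i * conj (z j) * dW i (dWbar j β) z) / ‖z‖ := by
    simp_rw [metricInv_eq hz, add_mul, Finset.sum_add_distrib, ite_mul, zero_mul,
      Finset.sum_ite_eq', Finset.mem_univ, if_true, Finset.mul_sum, Finset.sum_div]
    congr 1
    refine Finset.sum_congr rfl fun i _ => Finset.sum_congr rfl fun j _ => ?_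
    ring
  rw [hexp, hrank, htr]
  field_simp

/-- The gradient terms of the expansion. -/
lemma sum_metricInv_gradient {z : Cn n} (hz : z ≠ 0) (β : Cn n → ℂ) (A A' : ℂ) :
    ∑ i, ∑ j, metricInv z j i * (conj (z i) * A * dWbar j β z + z j * A' * dW i β z)
      = ‖z‖ * (A * (fderiv ℝ β z z + Complex.I * fderiv ℝ β z (Complex.I • z))
        + A' * (fderiv ℝ β z z - Complex.I * fderiv ℝ β z (Complex.I • z))) := by
  have h0 := ofReal_norm_ne_zero hz
  have h1 : ∀ j, ∑ i, metricInv z j i * conj (z i) = 2 * ‖z‖ * conj (z j) := by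
    intro j
    simp_rw [metricInv_eq hz, add_mul, Finset.sum_add_distrib, ite_mul, zero_mul,
      Finset.sum_ite_eq, Finset.mem_univ, if_true]
    have e : ∀ i, z i * conj (z j) / ‖z‖ * conj (z i) = conj (z j) / ‖z‖ * (conj (z i) * z i) :=
      fun i => by ring
    simp_rw [e]
    rw [← Finset.mul_sum, sum_conj_mul]
    field_simp; ring
  have h2 : ∀ i, ∑ j, metricInv z j i * z j = 2 * ‖z‖ * z i := by
    intro i
    simp_rw [metricInv_eq hz, add_mul, Finset.sum_add_distrib, ite_mul, zero_mul,
      Finset.sum_ite_eq', Finset.mem_univ, if_true]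
    have e : ∀ j, z i * conj (z j) / ‖z‖ * z j = z i / ‖z‖ * (conj (z j) * z j) :=
      fun j => by ring
    simp_rw [e]
    rw [← Finset.mul_sum, sum_conj_mul]
    field_simp; ring
  simp_rw [mul_add, Finset.sum_add_distrib]
  rw [Finset.sum_comm]
  have e1 : ∑ j, ∑ i, metricInv z j i * (conj (z i) * A * dWbar j β z)
      = ‖z‖ * A * (fderiv ℝ β z z + Complex.I * fderiv ℝ β z (Complex.I • z)) := by
    rw [← sum_conj_mul_add_I, Finset.mul_sum]
    refine Finset.sum_congr rfl fun j _ => ?_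
    have : ∑ i, metricInv z j i * (conj (z i) * A * dWbar j β z)
        = (∑ i, metricInv z j i * conj (z i)) * (A * dWbar j β z) := by
      rw [Finset.sum_mul]; exact Finset.sum_congr rfl fun i _ => by ring
    rw [this, h1, dWbar]
    ring
  have e2 : ∑ i, ∑ j, metricInv z j i * (z j * A' * dW i β z)
      = ‖z‖ * A' * (fderiv ℝ β z z - Complex.I * fderiv ℝ β z (Complex.I • z)) := by
    rw [← sum_mul_sub_I, Finset.mul_sum]
    refine Finset.sum_congr rfl fun i _ => ?_
    have : ∑ j, metricInv z j i * (z j * A' * dW i β z)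
        = (∑ j, metricInv z j i * z j) * (A' * dW i β z) := by
      rw [Finset.sum_mul]; exact Finset.sum_congr rfl fun i _ => by ring
    rw [this, h2, dW]
    ring
  rw [e1, e2]
  ring

/-- The coefficient of `ħ` written with real derivatives of the symbol. -/
lemma firstCoeff_eq {β : Cn n → ℂ} (hβ : ContDiff ℝ ∞ β) {z : Cn n} (hz : z ≠ 0) (p ν μ : ℝ) :
    firstCoeff p ν μ β z =
      ‖z‖ / 4 * (∑ k, fderiv ℝ (fderiv ℝ β) z (realVec k) (realVec k))
      + (fderiv ℝ (fderiv ℝ β) z z z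
          + fderiv ℝ (fderiv ℝ β) z (Complex.I • z) (Complex.I • z)) / (4 * ‖z‖)
      + ((n + p - ν) * (fderiv ℝ β z z + Complex.I * fderiv ℝ β z (Complex.I • z))
        + (n + p - μ) * (fderiv ℝ β z z - Complex.I * fderiv ℝ β z (Complex.I • z))) / (2 * ‖z‖)
      + ((p - ν + 1) * (p + ν - 1) / 4 + (n + p - ν) * (n + p - μ) / 2
        + (n - 1) * (p + (n - 1) / 2) / 2) / ‖z‖ * β z := by
  have h0 := ofReal_norm_ne_zero hz
  have hsplit : ∑ i, ∑ j, metricInv z j i *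
        (1 / (2 * (‖z‖ : ℂ) ^ 2) *
            (conj (z i) * (n + p - ν) * dWbar j β z + z j * (n + p - μ) * dW i β z)
          + dW i (dWbar j β) z
          + β z / (2 * ((‖z‖ ^ (n + p - ν) : ℝ) : ℂ)) *
              dWbar j (dW i fun w => xi p ν μ z w / metricDet w) z)
      = 1 / (2 * (‖z‖ : ℂ) ^ 2) * (∑ i, ∑ j, metricInv z j i *
          (conj (z i) * (n + p - ν) * dWbar j β z + z j * (n + p - μ) * dW i β z))
        + ∑ i, ∑ j, metricInv z j i * dW i (dWbar j β) z
        + β z / (2 * normPow (n + p - ν) z) * ∑ i, ∑ j, metricInv z j i *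
            dWbar j (dW i fun w => xi p ν μ z w / metricDet w) z := by
    simp_rw [Finset.mul_sum, ← Finset.sum_add_distrib]
    refine Finset.sum_congr rfl fun i _ => Finset.sum_congr rfl fun j _ => ?_
    rw [normPow]; ring
  have hne : normPow (n + p - ν) z ≠ 0 := by
    rw [normPow]
    exact_mod_cast (Real.rpow_pos_of_pos (norm_pos_iff.2 hz) _).ne'
  rw [firstCoeff, hsplit, sum_metricInv_gradient hz, laplaceBeltrami_symbol hβ hz,
    sum_metricInv_mul_xi hz, scalarCurvature_eq hz]
  field_simp
  ring

/-! ### Second-order jets of curves -/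

section Jets

variable {E F : Type*} [NormedAddCommGroup E] [NormedSpace ℝ E] [NormedAddCommGroup F]
  [NormedSpace ℝ F]

/-- `f` is twice differentiable at `0`, with value `a`, derivative `b` and second derivative `c`. -/
def HasJet (f : ℝ → E) (a b c : E) : Prop :=
  f 0 = a ∧ ∃ f' : ℝ → E, (∀ᶠ t in 𝓝 0, HasDerivAt f (f' t) t) ∧ f' 0 = b ∧ HasDerivAt f' c 0

namespace HasJet

variable {f g : ℝ → E} {a b c a' b' c' : E}

lemma congr (h : HasJet f a b c) (hb : b = b') (hc : c = c') : HasJet f a b' c' := hb ▸ hc ▸ h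

lemma second_unique (h : HasJet f a b c) (h' : HasJet f a' b' c') : c = c' := by
  obtain ⟨-, f₁, h1, -, h2⟩ := h
  obtain ⟨-, f₂, h3, -, h4⟩ := h'
  refine h2.unique (h4.congr_of_eventuallyEq ?_)
  filter_upwards [h1, h3] with t h h' using h.unique h'

lemma congr_fun (h : HasJet f a b c) (hfg : ∀ t, g t = f t) : HasJet g a b c := by
  rwa [show g = f from funext hfg]

lemma hasDerivAt (h : HasJet f a b c) : HasDerivAt f b 0 := by
  obtain ⟨-, f', h1, rfl, -⟩ := h
  exact h1.self_of_nhds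

lemma add (hf : HasJet f a b c) (hg : HasJet g a' b' c') :
    HasJet (fun t => f t + g t) (a + a') (b + b') (c + c') := by
  obtain ⟨rfl, f', h1, rfl, h2⟩ := hf
  obtain ⟨rfl, g', h3, rfl, h4⟩ := hg
  refine ⟨rfl, fun t => f' t + g' t, ?_, rfl, h2.add h4⟩
  filter_upwards [h1, h3] with t h h' using h.add h'

lemma clm_comp (L : E →L[ℝ] F) (hf : HasJet f a b c) :
    HasJet (fun t => L (f t)) (L a) (L b) (L c) := by
  obtain ⟨rfl, f', h1, rfl, h2⟩ := hf
  refine ⟨rfl, fun t => L (f' t), ?_, rfl, L.hasFDerivAt.comp_hasDerivAt 0 h2⟩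
  filter_upwards [h1] with t h using L.hasFDerivAt.comp_hasDerivAt t h

/-- The second-order chain rule along a curve. -/
lemma comp {β : E → F} (hf : HasJet f a b c) (hβ : ContDiffAt ℝ ∞ β a) :
    HasJet (fun t => β (f t)) (β a) (fderiv ℝ β a b)
      (fderiv ℝ (fderiv ℝ β) a b b + fderiv ℝ β a c) := by
  have h0 := hf.hasDerivAt
  obtain ⟨rfl, f', h1, rfl, h2⟩ := hf
  have hd : ∀ᶠ t in 𝓝 (0 : ℝ), DifferentiableAt ℝ β (f t) :=
    h0.continuousAt.eventually (eventually_differentiableAt hβ)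
  have hd2 : DifferentiableAt ℝ (fderiv ℝ β) (f 0) :=
    (hβ.fderiv_right (m := ∞) (by simp)).differentiableAt (by simp)
  refine ⟨rfl, fun t => fderiv ℝ β (f t) (f' t), ?_, rfl, ?_⟩
  · filter_upwards [h1, hd] with t ht ht' using ht'.hasFDerivAt.comp_hasDerivAt t ht
  · exact (hd2.hasFDerivAt.comp_hasDerivAt 0 h0).clm_apply h2

lemma line {H : E → F} (hH : ContDiffAt ℝ ∞ H 0) (u : E) :
    HasJet (fun t : ℝ => H (t • u)) (H 0) (fderiv ℝ H 0 u) (fderiv ℝ (fderiv ℝ H) 0 u u) := by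
  have h : HasJet (fun t : ℝ => t • u) 0 u 0 := by
    refine ⟨zero_smul _ _, fun _ => u, Eventually.of_forall fun t => ?_, rfl,
      hasDerivAt_const _ _⟩
    simpa using (hasDerivAt_id t).smul_const u
  exact (h.comp hH).congr rfl (by simp)

section Complex

variable {f g : ℝ → ℂ} {a b c a' b' c' : ℂ}

lemma mul (hf : HasJet f a b c) (hg : HasJet g a' b' c') :
    HasJet (fun t => f t * g t) (a * a') (b * a' + a * b') (c * a' + 2 * b * b' + a * c') := by
  have hf0 := hf.hasDerivAt
  have hg0 := hg.hasDerivAt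
  obtain ⟨rfl, f', h1, rfl, h2⟩ := hf
  obtain ⟨rfl, g', h3, rfl, h4⟩ := hg
  refine ⟨rfl, fun t => f' t * g t + f t * g' t, ?_, rfl, ?_⟩
  · filter_upwards [h1, h3] with t h h' using h.mul h'
  · exact ((h2.mul hg0).add (hf0.mul h4)).congr_deriv (by ring)

lemma quadratic (a b c : ℂ) : HasJet (fun t : ℝ => a + t * b + (t : ℂ) ^ 2 * c) a b (2 * c) := by
  have hid : ∀ t : ℝ, HasDerivAt (fun t : ℝ => (t : ℂ)) 1 t := fun t =>
    Complex.ofRealCLM.hasDerivAt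
  refine ⟨by simp, fun t => b + 2 * t * c, Eventually.of_forall fun t => ?_, by simp, ?_⟩
  · exact ((((hid t).mul_const b).const_add a).add (((hid t).pow 2).mul_const c)).congr_deriv
      (by simp)
  · exact ((((hid 0).const_mul 2).mul_const c).const_add b).congr_deriv (by simp)

/-- Powers of a curve through `1`. -/
lemma cpow_const (hf : HasJet f 1 b c) (r : ℂ) :
    HasJet (fun t => f t ^ r) 1 (r * b) (r * (r - 1) * b ^ 2 + r * c) := by
  have hf0 := hf.hasDerivAt
  obtain ⟨h0, f', h1, rfl, h2⟩ := hf
  have hmem : f 0 ∈ Complex.slitPlane := by rw [h0]; exact Complex.one_mem_slitPlane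
  have hd : ∀ {t : ℝ} {d : ℂ} (r : ℂ), f t ∈ Complex.slitPlane → HasDerivAt f d t →
      HasDerivAt (fun t => f t ^ r) (r * f t ^ (r - 1) * d) t := fun r hm h =>
    (((hasDerivAt_id _).cpow_const hm).scomp_of_eq _ h rfl).congr_deriv (by simp; ring)
  have hev : ∀ᶠ t in 𝓝 (0 : ℝ), f t ∈ Complex.slitPlane :=
    hf0.continuousAt.eventually_mem (Complex.isOpen_slitPlane.mem_nhds hmem)
  refine ⟨by simp [h0], fun t => r * f t ^ (r - 1) * f' t, ?_, by simp [h0], ?_⟩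
  · filter_upwards [h1, hev] with t h h' using hd r h' h
  · refine (((hd (r - 1) hmem hf0).const_mul r).mul h2).congr_deriv ?_
    simp [h0]; ring

end Complex

end HasJet

end Jets

/-! ### The Laplacian of the pulled-back symbol at the critical point -/

/-- The leading amplitude of the integrand in the chart times the Jacobian of the chart, normalized
to take the value `1` at the origin. -/
def amp (p ν μ : ℝ) (e : Cn n) (s₀ : ℝ) (y : Cn n) : ℂ :=
  (sCoord e s₀ y / s₀) ^ ((3 / 2 - ν : ℝ) : ℂ) * (conj (sCoord e s₀ y) / s₀) ^ ((3 / 2 - μ : ℝ) : ℂ)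
    * ((‖shiftPt e s₀ y‖ ^ 2 / s₀ ^ 2 : ℝ) : ℂ) ^ ((p + 1 / 2 : ℝ) : ℂ)
    * ((stretchSq e s₀ y / (2 * s₀ ^ 2) : ℝ) : ℂ) ^ ((n - 2 : ℝ) : ℂ)

lemma sCoord_zero (he : ‖e‖ = 1) : sCoord e s₀ 0 = s₀ := by
  rw [sCoord_eq he]; simp [hdot]

lemma shiftPt_zero : shiftPt e s₀ 0 = (s₀ : ℂ) • e := zero_add _

lemma norm_shiftPt_zero_sq (he : ‖e‖ = 1) : ‖shiftPt e s₀ 0‖ ^ 2 = s₀ ^ 2 := by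
  rw [shiftPt_zero, norm_smul, he, Complex.norm_real, mul_one, Real.norm_eq_abs, sq_abs]

lemma stretchSq_zero (he : ‖e‖ = 1) : stretchSq e s₀ 0 = 2 * s₀ ^ 2 := by
  rw [stretchSq, norm_shiftPt_zero_sq he, sCoord_zero he, Complex.norm_real, Real.norm_eq_abs,
    sq_abs]; ring

lemma chart_zero (he : ‖e‖ = 1) : chart e s₀ 0 = ((s₀ : ℂ) ^ 2) • e := by
  have : perpPart e s₀ 0 = 0 := by rw [perpPart, shiftPt_zero, sCoord_zero he, sub_self]
  rw [chart, this, smul_zero, add_zero, sCoord_zero he]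

lemma amp_zero (he : ‖e‖ = 1) (hs₀ : 0 < s₀) (p ν μ : ℝ) : amp p ν μ e s₀ 0 = 1 := by
  have : (s₀ : ℂ) ≠ 0 := by exact_mod_cast hs₀.ne'
  have h1 : s₀ ^ 2 / s₀ ^ 2 = 1 := div_self (by positivity)
  have h2 : 2 * s₀ ^ 2 / (2 * s₀ ^ 2) = 1 := div_self (by positivity)
  rw [amp, sCoord_zero he, norm_shiftPt_zero_sq he, stretchSq_zero he, h1, h2,
    Complex.conj_ofReal, div_self this]
  simp

lemma div_ofReal_mem_slitPlane {x : ℂ} {r : ℝ} (hx : 0 < x.re) (hr : 0 < r) :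
    x / r ∈ Complex.slitPlane := by
  left; rw [Complex.div_ofReal_re]; positivity

lemma contDiffAt_cpow_const {f : Cn n → ℂ} (hf : ContDiffAt ℝ ∞ f y) (hm : f y ∈ Complex.slitPlane)
    (c : ℂ) : ContDiffAt ℝ ∞ (fun y => f y ^ c) y := by
  have h1 : ContDiffAt ℝ ∞ (fun y => Complex.exp (Complex.log (f y) * c)) y :=
    Complex.contDiff_exp.contDiffAt.comp y ((((Complex.contDiffAt_log hm).restrict_scalars ℝ).comp y hf).mul
      contDiffAt_const)
  have hev : ∀ᶠ u in 𝓝 y, f u ∈ Complex.slitPlane :=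
    hf.continuousAt.eventually_mem (Complex.isOpen_slitPlane.mem_nhds hm)
  refine h1.congr_of_eventuallyEq ?_
  filter_upwards [hev] with u hu
  rw [Complex.cpow_def_of_ne_zero (Complex.slitPlane_ne_zero hu)]

lemma norm_shiftPt_pos (he : ‖e‖ = 1) (hs : 0 < (sCoord e s₀ y).re) : 0 < ‖shiftPt e s₀ y‖ ^ 2 := by
  have : 0 < ‖sCoord e s₀ y‖ := norm_pos_iff.2 (by rintro h; rw [h] at hs; simp at hs)
  rw [norm_shiftPt_sq he]; positivity

lemma contDiffAt_amp (he : ‖e‖ = 1) (hs₀ : 0 < s₀) (hs : 0 < (sCoord e s₀ y).re) (p ν μ : ℝ) :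
    ContDiffAt ℝ ∞ (amp p ν μ e s₀) y := by
  have hY := norm_shiftPt_pos he hs
  have hT := stretchSq_pos hs
  have h1 : ContDiffAt ℝ ∞ (fun y => sCoord e s₀ y / s₀) y := by
    simp only [div_eq_mul_inv]; exact contDiffAt_sCoord.mul contDiffAt_const
  have h2 : ContDiffAt ℝ ∞ (fun y => conj (sCoord e s₀ y) / s₀) y := by
    simp only [div_eq_mul_inv]
    exact (Complex.conjCLE.contDiff.contDiffAt.comp y contDiffAt_sCoord).mul contDiffAt_const
  have h3 : ContDiffAt ℝ ∞ (fun y => ((‖shiftPt e s₀ y‖ ^ 2 / s₀ ^ 2 : ℝ) : ℂ)) y :=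
    Complex.ofRealCLM.contDiff.contDiffAt.comp y ((contDiffAt_shiftPt.norm_sq ℝ).div_const _)
  have h4 : ContDiffAt ℝ ∞ (fun y => ((stretchSq e s₀ y / (2 * s₀ ^ 2) : ℝ) : ℂ)) y :=
    Complex.ofRealCLM.contDiff.contDiffAt.comp y (contDiffAt_stretchSq.div_const _)
  refine (((contDiffAt_cpow_const h1 (div_ofReal_mem_slitPlane hs hs₀) _).mul
    (contDiffAt_cpow_const h2 (div_ofReal_mem_slitPlane (by simpa) hs₀) _)).mul
    (contDiffAt_cpow_const h3 ?_ _)).mul (contDiffAt_cpow_const h4 ?_ _) <;>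
  · rw [Complex.ofReal_mem_slitPlane]; positivity

section Line

variable (e s₀) (u : Cn n)

lemma sCoord_smul (he : ‖e‖ = 1) (t : ℝ) : sCoord e s₀ (t • u) = s₀ + t * hdot u e := by
  rw [sCoord_eq he, ← Complex.coe_smul, hdot_smul_left, add_comm]

lemma norm_shiftPt_smul_sq (t : ℝ) :
    ‖shiftPt e s₀ (t • u)‖ ^ 2 = ‖u‖ ^ 2 * t ^ 2 + 2 * s₀ * t * (hdot u e).re + s₀ ^ 2 * ‖e‖ ^ 2 := by
  have h := norm_add_sq (𝕜 := ℂ) ((t : ℂ) • u) ((s₀ : ℂ) • e)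
  rw [inner_smul_left, inner_smul_right, inner_eq_hdot, norm_smul, norm_smul, Complex.norm_real,
    Complex.norm_real, mul_pow, mul_pow, Real.norm_eq_abs, Real.norm_eq_abs, sq_abs, sq_abs,
    ← hdot_conj, Complex.conj_ofReal, ← mul_assoc, ← Complex.ofReal_mul] at h
  rw [shiftPt, ← Complex.coe_smul, h]
  simp only [RCLike.re_to_complex, Complex.re_ofReal_mul, Complex.conj_re]
  ring

end Line

/-- The second derivative at the critical point of symbol times amplitude, along a unit vector. -/
lemma fderiv_fderiv_symbol_mul_amp (he : ‖e‖ = 1) (hs₀ : 0 < s₀) {β : Cn n → ℂ}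
    (hβ : ContDiff ℝ ∞ β) (p ν μ : ℝ) {u : Cn n} (hu : ‖u‖ = 1) {x y : ℝ}
    (hx : (hdot u e).re = x) (hy : (hdot u e).im = y) :
    fderiv ℝ (fderiv ℝ fun y => β (chart e s₀ y) * amp p ν μ e s₀ y) 0 u u
      = fderiv ℝ (fderiv ℝ β) (((s₀ : ℂ) ^ 2) • e)
          ((√2 * s₀) • u + ((2 - √2) * s₀) • (x • e + y • Complex.I • e))
          ((√2 * s₀) • u + ((2 - √2) * s₀) • (x • e + y • Complex.I • e))
        + fderiv ℝ β (((s₀ : ℂ) ^ 2) • e) ((2 * (x ^ 2 - y ^ 2)) • e + (4 * (x * y)) • Complex.I • e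
          + (2 * √2 * x) • (u - (x • e + y • Complex.I • e)))
        + 2 * ((((n + p - ν) + (n + p - μ)) * x + Complex.I * (((n + p - ν) - (n + p - μ)) * y)) / s₀)
          * fderiv ℝ β (((s₀ : ℂ) ^ 2) • e)
            ((√2 * s₀) • u + ((2 - √2) * s₀) • (x • e + y • Complex.I • e))
        + β (((s₀ : ℂ) ^ 2) • e) * (((3 / 2 - ν) * (1 / 2 - ν) * (x + Complex.I * y) ^ 2
          + (3 / 2 - μ) * (1 / 2 - μ) * (x - Complex.I * y) ^ 2
          + (p + 1 / 2) * (p - 1 / 2) * (4 * x ^ 2) + 2 * (p + 1 / 2)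
          + (n - 2) * (n - 3) * (4 * x ^ 2) + (n - 2) * (x ^ 2 + y ^ 2 + 1)
          + 2 * (3 / 2 - ν) * (3 / 2 - μ) * (x ^ 2 + y ^ 2)
          + 2 * ((3 / 2 - ν) * (x + Complex.I * y) + (3 / 2 - μ) * (x - Complex.I * y))
            * (2 * (p + 1 / 2) + 2 * (n - 2)) * x
          + 8 * (p + 1 / 2) * (n - 2) * x ^ 2) / s₀ ^ 2) := by
  have hs0c : (s₀ : ℂ) ≠ 0 := by exact_mod_cast hs₀.ne'
  have hσ : hdot u e = x + Complex.I * y := by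
    rw [← hx, ← hy, mul_comm Complex.I, Complex.re_add_im]
  have hI : conj Complex.I = -Complex.I := Complex.conj_I
  have hs2 : (√2 : ℂ) ^ 2 = 2 := by rw [← Complex.ofReal_pow, Real.sq_sqrt (by norm_num)]; simp
  have h1 : HasJet (fun t : ℝ => sCoord e s₀ (t • u) / s₀) 1 ((x + Complex.I * y) / s₀) 0 := by
    refine ((HasJet.quadratic 1 ((x + Complex.I * y) / s₀) 0).congr rfl (mul_zero _)).congr_fun
      fun t => ?_
    rw [sCoord_smul e s₀ u he, hσ]; field_simp; ring
  have h2 : HasJet (fun t : ℝ => conj (sCoord e s₀ (t • u)) / s₀) 1 ((x - Complex.I * y) / s₀) 0 := by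
    refine ((HasJet.quadratic 1 ((x - Complex.I * y) / s₀) 0).congr rfl (mul_zero _)).congr_fun
      fun t => ?_
    rw [sCoord_smul e s₀ u he, hσ]
    simp only [map_add, map_mul, Complex.conj_ofReal, hI]
    field_simp; ring
  have h3 : HasJet (fun t : ℝ => ((‖shiftPt e s₀ (t • u)‖ ^ 2 / s₀ ^ 2 : ℝ) : ℂ)) 1
      (2 * x / s₀) (2 * (1 / s₀ ^ 2)) := by
    refine (HasJet.quadratic 1 (2 * x / s₀) (1 / s₀ ^ 2)).congr_fun fun t => ?_
    rw [norm_shiftPt_smul_sq, hu, he, hx]; push_cast; field_simp; ring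
  have h4 : HasJet (fun t : ℝ => ((stretchSq e s₀ (t • u) / (2 * s₀ ^ 2) : ℝ) : ℂ)) 1
      (2 * x / s₀) (2 * ((x ^ 2 + y ^ 2 + 1) / (2 * s₀ ^ 2))) := by
    refine (HasJet.quadratic 1 (2 * x / s₀) ((x ^ 2 + y ^ 2 + 1) / (2 * s₀ ^ 2))).congr_fun fun t => ?_
    have : ‖sCoord e s₀ (t • u)‖ ^ 2 = (s₀ + t * x) ^ 2 + (t * y) ^ 2 := by
      rw [sCoord_smul e s₀ u he, ← Complex.normSq_eq_norm_sq, Complex.normSq_apply]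
      simp [hx, hy]; ring
    rw [stretchSq, this, norm_shiftPt_smul_sq, hu, he, hx]; push_cast; field_simp; ring
  have hamp := (((h1.cpow_const ((3 / 2 - ν : ℝ) : ℂ)).mul (h2.cpow_const ((3 / 2 - μ : ℝ) : ℂ))).mul
    (h3.cpow_const ((p + 1 / 2 : ℝ) : ℂ))).mul (h4.cpow_const ((n - 2 : ℝ) : ℂ))
  -- the two components of the chart along the line, in the directions `e` and `u - (u·e) e`
  have hf : HasJet (fun t : ℝ => sCoord e s₀ (t • u) ^ 2) ((s₀ : ℂ) ^ 2)
      (2 * s₀ * (x + Complex.I * y)) (2 * (x + Complex.I * y) ^ 2) := by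
    refine (HasJet.quadratic _ _ _).congr_fun fun t => ?_
    rw [sCoord_smul e s₀ u he, hσ]; ring
  have hg : HasJet (fun t : ℝ => (√(stretchSq e s₀ (t • u)) : ℂ) * t) 0 ((√2 * s₀ : ℝ) : ℂ)
      ((2 * √2 * x : ℝ) : ℂ) := by
    have := ((h4.cpow_const ((1 / 2 : ℝ) : ℂ)).mul (HasJet.quadratic 0 ((√2 * s₀ : ℝ) : ℂ) 0))
    rw [mul_zero] at this
    refine (this.congr ?_ ?_).congr_fun fun t => ?_
    · simp
    · push_cast; field_simp; ring
    · rw [← Complex.ofReal_cpow (by have := stretchSq_nonneg (e := e) (s₀ := s₀) (y := t • u); positivity),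
        ← Real.sqrt_eq_rpow, Real.sqrt_div stretchSq_nonneg, Real.sqrt_mul (by norm_num),
        Real.sqrt_sq hs₀.le]
      have : (√2 : ℂ) ≠ 0 := by exact_mod_cast (Real.sqrt_pos.2 two_pos).ne'
      push_cast; field_simp; ring
  have hγ : HasJet (fun t : ℝ => chart e s₀ (t • u)) (((s₀ : ℂ) ^ 2) • e)
      ((√2 * s₀) • u + ((2 - √2) * s₀) • (x • e + y • Complex.I • e))
      ((2 * (x ^ 2 - y ^ 2)) • e + (4 * (x * y)) • Complex.I • e
          + (2 * √2 * x) • (u - (x • e + y • Complex.I • e))) := by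
    set L : Cn n → ℂ →L[ℝ] Cn n := fun v => (ContinuousLinearMap.toSpanSingleton ℂ v).restrictScalars ℝ
    have hL : ∀ v c, L v c = c • v := fun v c => rfl
    have hσe : (x + Complex.I * y : ℂ) • e = x • e + y • Complex.I • e := by
      rw [add_smul, mul_comm, mul_smul, Complex.coe_smul, Complex.coe_smul]
    have := (hf.clm_comp (L e)).add (hg.clm_comp (L (u - (x + Complex.I * y : ℂ) • e)))
    simp only [hL, zero_smul, add_zero] at this
    refine (this.congr ?_ ?_).congr_fun fun t => ?_
    · rw [Complex.coe_smul, mul_smul, hσe,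
        show (2 * s₀ : ℂ) = ((2 * s₀ : ℝ) : ℂ) by push_cast; rfl, Complex.coe_smul]
      module
    · have e2 : (2 * (x + Complex.I * y) ^ 2 : ℂ) • e
          = (2 * (x ^ 2 - y ^ 2)) • e + (4 * (x * y)) • Complex.I • e := by
        rw [← Complex.coe_smul, ← Complex.coe_smul, smul_smul, ← add_smul]
        congr 1; push_cast; linear_combination (2 * (y : ℂ) ^ 2) * Complex.I_sq
      rw [e2, Complex.coe_smul, hσe]
    · rw [chart, mul_smul]
      congr 2
      rw [perpPart, shiftPt, sCoord_smul e s₀ u he, hσ, smul_sub, smul_smul, add_smul,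
        Complex.coe_smul]
      simp only [Complex.coe_smul]
      abel
  have hz : ContDiffAt ℝ ∞ (fun y => β (chart e s₀ y) * amp p ν μ e s₀ y) 0 := by
    have h0 : 0 < (sCoord e s₀ 0).re := by rw [sCoord_zero he]; simpa
    exact (hβ.contDiffAt.comp _ (contDiffAt_chart (stretchSq_pos h0))).mul (contDiffAt_amp he hs₀ h0 _ _ _)
  have hprod := (hγ.comp hβ.contDiffAt).mul hamp
  rw [(HasJet.line hz u).second_unique hprod]
  push_cast
  linear_combination (-2 * (3 / 2 - ν) * (3 / 2 - μ) * y ^ 2 * β (((s₀ : ℂ) ^ 2) • e) / s₀ ^ 2)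
    * Complex.I_sq

lemma hdot_single (i : Fin n) (c : ℂ) (e : Cn n) :
    hdot (EuclideanSpace.single i c) e = c * conj (e i) := by
  rw [hdot, Finset.sum_eq_single i]
  · simp
  · intro j _ hj; simp [hj]
  · simp

lemma hdot_realVec_re (k : Fin n × Bool) (e : Cn n) : (hdot (realVec k) e).re = realCoord k e := by
  rcases k with ⟨i, _ | _⟩ <;> simp [realVec, realCoord, hdot_single]

lemma hdot_realVec_im (k : Fin n × Bool) (e : Cn n) :
    (hdot (realVec k) e).im = realCoord k (Complex.I • e) := by
  rcases k with ⟨i, _ | _⟩ <;> simp [realVec, realCoord, hdot_single]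

lemma norm_realVec (k : Fin n × Bool) : ‖realVec k‖ = 1 := by
  rcases k with ⟨i, _ | _⟩ <;> simp [realVec]

lemma sum_realCoord_mul (L : Cn n →L[ℝ] ℂ) (v : Cn n) :
    ∑ k, (realCoord k v : ℂ) * L (realVec k) = L v := by
  conv_rhs => rw [← sum_realCoord_smul v, map_sum]
  exact Finset.sum_congr rfl fun k _ => by rw [map_smul, Complex.real_smul]

lemma sum_realCoord_sq (he : ‖e‖ = 1) : ∑ k, (realCoord k e : ℂ) ^ 2 = 1 := by
  have := norm_sq_eq_sum_realCoord e
  rw [he] at this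
  exact_mod_cast (this.symm.trans (one_pow 2))

lemma sum_realCoord_mul_I (e : Cn n) :
    ∑ k, (realCoord k e : ℂ) * (realCoord k (Complex.I • e) : ℂ) = 0 := by
  rw [Fintype.sum_prod_type]
  refine Finset.sum_eq_zero fun i _ => ?_
  simp only [Fintype.sum_bool, realCoord, cond_true, cond_false]
  simp
  ring

/-- The trace of the second derivative of symbol times amplitude at the critical point. -/
lemma sum_fderiv_fderiv_symbol_mul_amp (he : ‖e‖ = 1) (hs₀ : 0 < s₀) {β : Cn n → ℂ}
    (hβ : ContDiff ℝ ∞ β) (p ν μ : ℝ) :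
    ∑ k, fderiv ℝ (fderiv ℝ fun y => β (chart e s₀ y) * amp p ν μ e s₀ y) 0 (realVec k) (realVec k)
      = 2 * s₀ ^ 2 * ((∑ k, fderiv ℝ (fderiv ℝ β) (((s₀ : ℂ) ^ 2) • e) (realVec k) (realVec k))
          + fderiv ℝ (fderiv ℝ β) (((s₀ : ℂ) ^ 2) • e) e e
          + fderiv ℝ (fderiv ℝ β) (((s₀ : ℂ) ^ 2) • e) (Complex.I • e) (Complex.I • e))
        + 4 * (((n + p - ν) + (n + p - μ)) * fderiv ℝ β (((s₀ : ℂ) ^ 2) • e) e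
          + Complex.I * ((n + p - ν) - (n + p - μ)) * fderiv ℝ β (((s₀ : ℂ) ^ 2) • e) (Complex.I • e))
        + β (((s₀ : ℂ) ^ 2) • e) * (4 * ((n + p - ν) * (n + p - μ)
          + (n - 1) * (p + (n - 1) / 2)) / s₀ ^ 2) := by
  have hs0c : (s₀ : ℂ) ≠ 0 := by exact_mod_cast hs₀.ne'
  have hs2 : (√2 : ℂ) ^ 2 = 2 := by rw [← Complex.ofReal_pow, Real.sq_sqrt (by norm_num)]; simp
  set B := fderiv ℝ (fderiv ℝ β) (((s₀ : ℂ) ^ 2) • e) with hB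
  set D := fderiv ℝ β (((s₀ : ℂ) ^ 2) • e) with hD
  set β₀ := β (((s₀ : ℂ) ^ 2) • e)
  set P : ℂ := n + p - ν with hP
  set Q : ℂ := n + p - μ with hQ
  -- `X`, `Y`, `W` are the coefficients of `x²`, `y²` and `x y` in the second derivative along a
  -- direction `u` with `u · e = x + i y`. Over the real orthonormal basis these three monomials sum
  -- to `1`, `1` and `0`, so that `W` drops out of the trace.
  set X : ℂ := ((2 - √2) * s₀) ^ 2 * B e e + 2 * D e - 2 * √2 * D e
    + 2 * (2 - √2) * (P + Q) * D e
    + β₀ * (((3 / 2 - ν) * (1 / 2 - ν) + (3 / 2 - μ) * (1 / 2 - μ)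
      + 4 * (p + 1 / 2) * (p - 1 / 2) + 4 * (n - 2) * (n - 3) + (n - 2)
      + 2 * (3 / 2 - ν) * (3 / 2 - μ)
      + 2 * ((3 / 2 - ν) + (3 / 2 - μ)) * (2 * (p + 1 / 2) + 2 * (n - 2))
      + 8 * (p + 1 / 2) * (n - 2)) / s₀ ^ 2) with hX
  set Y : ℂ := ((2 - √2) * s₀) ^ 2 * B (Complex.I • e) (Complex.I • e) - 2 * D e
    + 2 * (2 - √2) * (Complex.I * (P - Q)) * D (Complex.I • e)
    + β₀ * ((-(3 / 2 - ν) * (1 / 2 - ν) - (3 / 2 - μ) * (1 / 2 - μ) + (n - 2)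
      + 2 * (3 / 2 - ν) * (3 / 2 - μ)) / s₀ ^ 2) with hY
  set W : ℂ := ((2 - √2) * s₀) ^ 2 * (B e (Complex.I • e) + B (Complex.I • e) e)
    + 4 * D (Complex.I • e) - 2 * √2 * D (Complex.I • e)
    + 2 * (2 - √2) * ((P + Q) * D (Complex.I • e) + Complex.I * (P - Q) * D e)
    + β₀ * ((2 * Complex.I * (3 / 2 - ν) * (1 / 2 - ν) - 2 * Complex.I * (3 / 2 - μ) * (1 / 2 - μ)
      + 2 * Complex.I * ((3 / 2 - ν) - (3 / 2 - μ)) * (2 * (p + 1 / 2) + 2 * (n - 2))) / s₀ ^ 2)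
    with hW
  have key : ∀ k, fderiv ℝ (fderiv ℝ fun y => β (chart e s₀ y) * amp p ν μ e s₀ y) 0
        (realVec k) (realVec k)
      = (√2 * s₀) ^ 2 * B (realVec k) (realVec k)
        + (√2 * s₀) * ((2 - √2) * s₀) * (realCoord k e * B.flip e (realVec k))
        + (√2 * s₀) * ((2 - √2) * s₀) * (realCoord k e * B e (realVec k))
        + (√2 * s₀) * ((2 - √2) * s₀) *
          (realCoord k (Complex.I • e) * B.flip (Complex.I • e) (realVec k))
        + (√2 * s₀) * ((2 - √2) * s₀) *
          (realCoord k (Complex.I • e) * B (Complex.I • e) (realVec k))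
        + (2 * √2 + 2 * √2 * (P + Q)) * (realCoord k e * D (realVec k))
        + (2 * √2 * Complex.I * (P - Q)) * (realCoord k (Complex.I • e) * D (realVec k))
        + X * (realCoord k e) ^ 2 + Y * (realCoord k (Complex.I • e)) ^ 2
        + W * (realCoord k e * realCoord k (Complex.I • e))
        + β₀ * ((2 * (p + 1 / 2) + (n - 2)) / s₀ ^ 2) := by
    intro k
    rw [fderiv_fderiv_symbol_mul_amp he hs₀ hβ p ν μ (norm_realVec k) (hdot_realVec_re k e)
      (hdot_realVec_im k e), ← hB, ← hD]
    simp only [map_add, map_sub, map_smul, add_apply, smul_apply,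
      ContinuousLinearMap.flip_apply, Complex.real_smul]
    rw [hX, hY, hW]
    push_cast
    field_simp
    linear_combination (4 * β₀ * (realCoord k (Complex.I • e)) ^ 2 *
      ((3 / 2 - ν) * (1 / 2 - ν) + (3 / 2 - μ) * (1 / 2 - μ))) * Complex.I_sq
  simp_rw [key, Finset.sum_add_distrib, ← Finset.mul_sum]
  have hI : ‖Complex.I • e‖ = 1 := by rw [norm_smul, he]; simp
  simp only [sum_realCoord_mul, sum_realCoord_sq he, sum_realCoord_sq hI, sum_realCoord_mul_I]
  simp only [ContinuousLinearMap.flip_apply, Finset.sum_const, Finset.card_univ, Fintype.card_prod,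
    Fintype.card_fin, Fintype.card_bool, nsmul_eq_mul]
  rw [hX, hY, hP, hQ]
  push_cast
  linear_combination (s₀ ^ 2 * (∑ k, B (realVec k) (realVec k))
    - s₀ ^ 2 * (B e e + B (Complex.I • e) (Complex.I • e))) * hs2

/-! ### The integrand in the chart -/

/-- `₀F₁` split into its normalized form and its leading exponential behaviour; `r` is the large
parameter and `x` the bounded variable. -/
lemma hyp0F1_sq_eq_normalized {b r : ℝ} (hb : 1 / 2 < b) (hr : 0 < r) {x : ℂ} (hx : x ≠ 0) :
    hyp0F1 b ((r * x) ^ 2) = hyp0F1 b ((r * x) ^ 2) * hypNormalizer b (r * x)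
      * (((Real.Gamma b / (2 * √Real.pi) * r ^ (1 / 2 - b) : ℝ) : ℂ) * x ^ ((1 / 2 - b : ℝ) : ℂ)
        * Complex.exp (2 * (r * x))) := by
  have hΓ := Real.Gamma_pos_of_pos (show 0 < b by linarith)
  have hΓc : (Real.Gamma b : ℂ) ≠ 0 := by exact_mod_cast hΓ.ne'
  have hπ : (√Real.pi : ℂ) ≠ 0 := by exact_mod_cast (Real.sqrt_pos.2 Real.pi_pos).ne'
  have h1 : x ^ ((b - 1 / 2 : ℝ) : ℂ) * x ^ ((1 / 2 - b : ℝ) : ℂ) = 1 := by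
    rw [← Complex.cpow_add _ _ hx, ← Complex.ofReal_add]; simp
  have h2 : ((r ^ (b - 1 / 2) : ℝ) : ℂ) * ((r ^ (1 / 2 - b) : ℝ) : ℂ) = 1 := by
    rw [← Complex.ofReal_mul, ← Real.rpow_add hr]; simp
  have h3 : Complex.exp (-(2 * (r * x))) * Complex.exp (2 * (r * x)) = 1 := by
    rw [← Complex.exp_add]; simp
  have h4 : hypNormalizer b (r * x) * (((Real.Gamma b / (2 * √Real.pi) * r ^ (1 / 2 - b) : ℝ) : ℂ)
      * x ^ ((1 / 2 - b : ℝ) : ℂ) * Complex.exp (2 * (r * x))) = 1 := by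
    rw [hypNormalizer, ofReal_mul_cpow hr, ← Complex.ofReal_cpow hr.le]
    push_cast at h1 h2 ⊢
    calc _ = (2 * √Real.pi / Real.Gamma b * (Real.Gamma b / (2 * √Real.pi)) : ℂ)
          * (((r ^ (b - 1 / 2) : ℝ) : ℂ) * ((r ^ (1 / 2 - b) : ℝ) : ℂ))
          * (x ^ ((b : ℂ) - 1 / 2) * x ^ (1 / 2 - (b : ℂ)))
          * (Complex.exp (-(2 * (r * x))) * Complex.exp (2 * (r * x))) := by ring
      _ = 1 := by rw [h1, h2, h3]; field_simp
  rw [mul_assoc, h4, mul_one]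

lemma besselK_eq_normalized (p : ℝ) {r x : ℝ} (hr : 0 < r) (hx : 0 < x) :
    besselK p (2 * (r * x)) = besselK p (2 * (r * x)) * besselNormalizer (2 * (r * x))
      * (√Real.pi / 2 * r ^ (-(1 / 2) : ℝ) * x ^ (-(1 / 2) : ℝ) * Real.exp (-(2 * (r * x)))) := by
  have hπ := Real.sqrt_pos.2 Real.pi_pos
  have hr' := Real.sqrt_pos.2 hr
  have hx' := Real.sqrt_pos.2 hx
  have h : besselNormalizer (2 * (r * x)) * (√Real.pi / 2 * r ^ (-(1 / 2) : ℝ)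
      * x ^ (-(1 / 2) : ℝ) * Real.exp (-(2 * (r * x)))) = 1 := by
    rw [besselNormalizer, show 2 * (2 * (r * x)) / Real.pi = 2 ^ 2 * (r * x) / Real.pi by ring,
      Real.sqrt_div' _ Real.pi_pos.le, Real.sqrt_mul (by norm_num), Real.sqrt_sq (by norm_num),
      Real.sqrt_mul hr.le, Real.rpow_neg hr.le, Real.rpow_neg hx.le, ← Real.sqrt_eq_rpow,
      ← Real.sqrt_eq_rpow, Real.exp_neg]
    have := Real.exp_pos (2 * (r * x))
    field_simp
  rw [mul_assoc, h, mul_one]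

/-- The product of the four normalized special functions occurring in the integrand. -/
def ratioFactor (p ν μ : ℝ) (e : Cn n) (s₀ : ℝ) (ħ : ℝ) (y : Cn n) : ℂ :=
  (hyp0F1 ν (((s₀ ^ 2 / ħ : ℝ) * (sCoord e s₀ y / s₀)) ^ 2)
      * hypNormalizer ν ((s₀ ^ 2 / ħ : ℝ) * (sCoord e s₀ y / s₀)))
    * (hyp0F1 μ (((s₀ ^ 2 / ħ : ℝ) * (conj (sCoord e s₀ y) / s₀)) ^ 2)
      * hypNormalizer μ ((s₀ ^ 2 / ħ : ℝ) * (conj (sCoord e s₀ y) / s₀)))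
    * ((besselK p (2 * (s₀ ^ 2 / ħ * (‖shiftPt e s₀ y‖ ^ 2 / s₀ ^ 2)))
      * besselNormalizer (2 * (s₀ ^ 2 / ħ * (‖shiftPt e s₀ y‖ ^ 2 / s₀ ^ 2))) : ℝ) : ℂ)
    * (hyp0F1 μ (((s₀ ^ 2 / ħ : ℝ) * (1 : ℂ)) ^ 2) * hypNormalizer μ ((s₀ ^ 2 / ħ : ℝ) * (1 : ℂ)))⁻¹

/-- The constant in front of the Gaussian integral. -/
def laplacePrefactor (n : ℕ) (p ν s₀ ħ : ℝ) : ℝ :=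
  Real.Gamma ν / Real.Gamma (n + p) * (s₀ ^ 2 / ħ) ^ (p - ν)
    * (2 * s₀ ^ 2 / (Real.pi * ħ ^ 2)) ^ n

lemma laplacePrefactor_mul {ħ : ℝ} (hħ : 0 < ħ) (hs₀ : 0 < s₀) (p ν : ℝ) :
    laplacePrefactor n p ν s₀ ħ * (Real.pi / (2 / ħ)) ^ n
      = (s₀ ^ 2 / ħ) ^ (n + p - ν) * (Real.Gamma ν / Real.Gamma (n + p)) := by
  have hr : 0 < s₀ ^ 2 / ħ := by positivity
  rw [laplacePrefactor, mul_assoc, ← mul_pow,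
    show 2 * s₀ ^ 2 / (Real.pi * ħ ^ 2) * (Real.pi / (2 / ħ)) = s₀ ^ 2 / ħ by field_simp,
    show (n : ℝ) + p - ν = (p - ν) + n by ring, Real.rpow_add_natCast hr.ne']
  ring

/-- In the chart, density times integrand times Jacobian is a Gaussian times symbol, amplitude and
the normalized special functions. -/
lemma jacobian_mul_integrand (hn : 2 ≤ n) (he : ‖e‖ = 1) (hs₀ : 0 < s₀) {ħ : ℝ} (hħ : 0 < ħ)
    {p ν μ : ℝ} (hν : 1 / 2 < ν) (hμ : 1 / 2 < μ) (β : Cn n → ℂ) (hs : 0 < (sCoord e s₀ y).re) :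
    ((8 * ‖sCoord e s₀ y‖ ^ 2 * ‖shiftPt e s₀ y‖ ^ 2 * stretchSq e s₀ y ^ (n - 2) : ℝ) : ℂ)
      * (mDensity n p ħ (chart e s₀ y) * integrand ν μ ħ β (((s₀ : ℂ) ^ 2) • e) (chart e s₀ y))
    = laplacePrefactor n p ν s₀ ħ * (β (chart e s₀ y) * amp p ν μ e s₀ y
      * ratioFactor p ν μ e s₀ ħ y * (Real.exp (-(2 / ħ) * ‖y‖ ^ 2) : ℂ)) := by
  have hs0c : (s₀ : ℂ) ≠ 0 := by exact_mod_cast hs₀.ne'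
  have hħc : (ħ : ℂ) ≠ 0 := by exact_mod_cast hħ.ne'
  have hphase := norm_sq_eq (s₀ := s₀) (y := y) he
  have hYpos := norm_shiftPt_pos he hs
  have hTpos := stretchSq_pos hs
  have hchart : hdot (chart e s₀ y) e = sCoord e s₀ y ^ 2 := hdot_chart he
  have hchart' : hdot e (chart e s₀ y) = conj (sCoord e s₀ y) ^ 2 := by
    rw [← hdot_conj, hchart, map_pow]
  have hnorm : ‖chart e s₀ y‖ = ‖shiftPt e s₀ y‖ ^ 2 := norm_chart he
  have hz : ‖((s₀ : ℂ) ^ 2) • e‖ = s₀ ^ 2 := by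
    rw [norm_smul, he, norm_pow, Complex.norm_real, Real.norm_of_nonneg hs₀.le, mul_one]
  set s := sCoord e s₀ y with hsdef
  set w := chart e s₀ y
  set r : ℝ := s₀ ^ 2 / ħ with hr
  set N : ℝ := ‖shiftPt e s₀ y‖ ^ 2 / s₀ ^ 2 with hN
  set T : ℝ := stretchSq e s₀ y / (2 * s₀ ^ 2) with hT
  set x : ℂ := s / s₀ with hx
  set x' : ℂ := conj s / s₀ with hx'
  have hr0 : 0 < r := by positivity
  have hN0 : 0 < N := by positivity
  have hT0 : 0 < T := by positivity
  have hsne : s ≠ 0 := by rintro h; rw [h] at hs; simp at hs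
  have hxne : x ≠ 0 := div_ne_zero hsne hs0c
  have hxne' : x' ≠ 0 := div_ne_zero ((map_ne_zero _).2 hsne) hs0c
  have a1 : hdot w (((s₀ : ℂ) ^ 2) • e) / (ħ : ℂ) ^ 2 = (r * x) ^ 2 := by
    rw [hdot_smul_right, hchart, hr, hx, map_pow, Complex.conj_ofReal]; push_cast; field_simp
  have a2 : hdot (((s₀ : ℂ) ^ 2) • e) w / (ħ : ℂ) ^ 2 = (r * x') ^ 2 := by
    rw [hdot_smul_left, hchart', hr, hx']; push_cast; field_simp
  have a3 : ((‖((s₀ : ℂ) ^ 2) • e‖ : ℝ) : ℂ) ^ 2 / (ħ : ℂ) ^ 2 = (r * 1) ^ 2 := by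
    rw [hz, hr]; push_cast; field_simp
  have a4 : ‖w‖ / ħ = r * N := by rw [hnorm, hr, hN]; field_simp
  have a5 : 2 * ‖w‖ / ħ = 2 * (r * N) := by rw [← a4]; ring
  have b1 := hyp0F1_sq_eq_normalized hν hr0 hxne
  have b2 := hyp0F1_sq_eq_normalized hμ hr0 hxne'
  have b3 := hyp0F1_sq_eq_normalized hμ hr0 (one_ne_zero (α := ℂ))
  have b4 := besselK_eq_normalized p hr0 hN0
  rw [ratioFactor, mDensity, integrand, a1, a2, a3, a4, a5]
  set A₁ := hyp0F1 ν ((r * x) ^ 2) * hypNormalizer ν (r * x)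
  set A₂ := hyp0F1 μ ((r * x') ^ 2) * hypNormalizer μ (r * x')
  set A₃ := hyp0F1 μ ((r * (1 : ℂ)) ^ 2) * hypNormalizer μ (r * (1 : ℂ))
  set A₄ := besselK p (2 * (r * N)) * besselNormalizer (2 * (r * N))
  rw [b1, b2, b3, b4]
  -- the Jacobian
  have c1 : 8 * ‖s‖ ^ 2 * ‖shiftPt e s₀ y‖ ^ 2 * stretchSq e s₀ y ^ (n - 2)
      = 2 * (2 * s₀ ^ 2) ^ n * (‖s‖ ^ 2 / s₀ ^ 2) * N * T ^ (n - 2) := by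
    obtain ⟨m, rfl⟩ := Nat.exists_eq_add_of_le hn
    rw [hN, hT, Nat.add_sub_cancel_left, div_pow, pow_add]
    field_simp; ring
  have c2 : ((‖s‖ ^ 2 / s₀ ^ 2 : ℝ) : ℂ) = x * x' := by
    rw [hx, hx', div_mul_div_comm, Complex.mul_conj, Complex.normSq_eq_norm_sq]; push_cast; ring
  have c3 : amp p ν μ e s₀ y = (x * x ^ ((1 / 2 - ν : ℝ) : ℂ)) * (x' * x' ^ ((1 / 2 - μ : ℝ) : ℂ))
      * ((N ^ p * N * N ^ (-(1 / 2) : ℝ) : ℝ) : ℂ) * ((T ^ (n - 2) : ℝ) : ℂ) := by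
    have d1 : ∀ {x : ℂ} (b : ℝ), x ≠ 0 →
        x ^ ((3 / 2 - b : ℝ) : ℂ) = x * x ^ ((1 / 2 - b : ℝ) : ℂ) := by
      intro x b hx
      rw [show ((3 / 2 - b : ℝ) : ℂ) = 1 + ((1 / 2 - b : ℝ) : ℂ) by push_cast; ring,
        Complex.cpow_add _ _ hx, Complex.cpow_one]
    have d2 : N ^ (p + 1 / 2) = N ^ p * N * N ^ (-(1 / 2) : ℝ) := by
      rw [← Real.rpow_add_one hN0.ne', ← Real.rpow_add hN0]; congr 1; ring
    have d3 : T ^ ((n : ℝ) - 2) = T ^ (n - 2) := by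
      rw [← Real.rpow_natCast, Nat.cast_sub hn]; rfl
    change x ^ _ * x' ^ _ * (N : ℂ) ^ _ * (T : ℂ) ^ _ = _
    rw [← Complex.ofReal_cpow hN0.le, ← Complex.ofReal_cpow hT0.le, d1 ν hxne, d1 μ hxne', d2, d3]
  have c4 : (r * N) ^ p = r ^ p * N ^ p := Real.mul_rpow hr0.le hN0.le
  have c5 : r ^ (p - ν) = r ^ p * r ^ (-(1 / 2) : ℝ) * r ^ (1 / 2 - ν) := by
    rw [← Real.rpow_add hr0, ← Real.rpow_add hr0]; congr 1; ring
  have c6 : (Real.exp (-(2 / ħ) * ‖y‖ ^ 2) : ℂ) = Complex.exp (2 * (r * x)) *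
      Complex.exp (2 * (r * x')) * (Complex.exp (2 * (r * 1)))⁻¹ * (Real.exp (-(2 * (r * N))) : ℂ) := by
    rw [← Complex.exp_neg, Complex.ofReal_exp, Complex.ofReal_exp, ← Complex.exp_add,
      ← Complex.exp_add, ← Complex.exp_add]
    congr 1
    have : x + x' = 2 * (s.re / s₀ : ℝ) := by
      rw [hx, hx', ← add_div, Complex.add_conj]; push_cast; ring
    rw [hphase, show (2 * (r * x) + 2 * (r * x') : ℂ) = 2 * r * (x + x') by ring, this, hr, hN]
    push_cast
    field_simp
    ring
  have hΓ : (Real.Gamma μ : ℂ) ≠ 0 := by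
    exact_mod_cast (Real.Gamma_pos_of_pos (show 0 < μ by linarith)).ne'
  have hπ : (√Real.pi : ℂ) ≠ 0 := by exact_mod_cast (Real.sqrt_pos.2 Real.pi_pos).ne'
  have hrμ : ((r ^ (1 / 2 - μ) : ℝ) : ℂ) ≠ 0 := by
    exact_mod_cast (Real.rpow_pos_of_pos hr0 _).ne'
  rw [c1, c3, c6, c4, laplacePrefactor, ← hr, c5, Complex.one_cpow]
  have c7 : (2 * s₀ ^ 2 / (Real.pi * ħ ^ 2)) ^ n = (2 * s₀ ^ 2) ^ n / (Real.pi * ħ ^ 2) ^ n :=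
    div_pow _ _ _
  rw [c7]
  have c2' : ((‖s‖ : ℝ) : ℂ) ^ 2 = x * x' * (s₀ : ℂ) ^ 2 := by
    rw [← c2]; push_cast; field_simp
  generalize Complex.exp (2 * (r * x)) = E₁
  generalize Complex.exp (2 * (r * x')) = E₂
  generalize hE₃ : Complex.exp (2 * (r * 1)) = E₃
  have hE₃0 : E₃ ≠ 0 := by rw [← hE₃]; exact Complex.exp_ne_zero _
  generalize Real.exp (-(2 * (r * N))) = E₄
  generalize x ^ ((1 / 2 - ν : ℝ) : ℂ) = X₁
  generalize x' ^ ((1 / 2 - μ : ℝ) : ℂ) = X₂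
  generalize (r ^ (1 / 2 - μ) : ℝ) = R₁ at hrμ ⊢
  generalize (r ^ (1 / 2 - ν) : ℝ) = R₂
  generalize (r ^ (-(1 / 2) : ℝ) : ℝ) = R₃
  generalize (N ^ (-(1 / 2) : ℝ) : ℝ) = N₁
  generalize (N ^ p : ℝ) = N₂
  generalize (r ^ p : ℝ) = R₄
  generalize T ^ (n - 2) = T₁
  generalize (2 * s₀ ^ 2) ^ n = S₁
  generalize (Real.pi * ħ ^ 2) ^ n = S₂
  generalize Real.Gamma ν = Γ₁
  generalize Real.Gamma (n + p) = Γ₂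
  generalize (Real.Gamma μ : ℝ) = Γ₃ at hΓ ⊢
  generalize √Real.pi = π₁ at hπ ⊢
  generalize β w = β₁
  clear_value A₁ A₂ A₃ A₄ x x' r N T
  push_cast
  rw [c2', mul_div_assoc (x * x'), div_self (pow_ne_zero 2 hs0c), mul_one]
  have hG : (Γ₃ / (2 * π₁) * R₁ : ℂ) ≠ 0 :=
    mul_ne_zero (div_ne_zero hΓ (mul_ne_zero two_ne_zero hπ)) hrμ
  generalize (Γ₃ / (2 * π₁) * R₁ : ℂ) = G at hG ⊢
  clear * - hG hπ
  have g1 := mul_inv_cancel₀ hG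
  have g2 := mul_inv_cancel₀ hπ
  calc _ = ((π₁ : ℂ) * (π₁ : ℂ)⁻¹) * (G * G⁻¹) * (Γ₁ / Γ₂ * (R₄ * R₃ * R₂) * (S₁ / S₂) *
      (β₁ * (x * X₁ * (x' * X₂) * (N₂ * N * N₁) * T₁) * (A₁ * A₂ * A₄ * A₃⁻¹)
        * (E₁ * E₂ * E₃⁻¹ * E₄))) := by ring
    _ = _ := by rw [g1, g2, one_mul, one_mul]

/-! ### First-order expansions in `ħ` of the special functions -/

/-- Multiplication of two expansions `1 + ħ a + O(ħ²)`, with an explicit remainder. -/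
lemma norm_mul_sub_le {A B a b : ℂ} {C D M N ħ : ℝ} (hħ : 0 < ħ) (hħ1 : ħ ≤ 1) (hC : 0 ≤ C)
    (hD : 0 ≤ D) (hA : ‖A - (1 + ħ * a)‖ ≤ C * ħ ^ 2) (hB : ‖B - (1 + ħ * b)‖ ≤ D * ħ ^ 2)
    (ha : ‖a‖ ≤ M) (hb : ‖b‖ ≤ N) :
    ‖A * B - (1 + ħ * (a + b))‖ ≤ (C * (1 + N + D) + (1 + M) * D + M * N) * ħ ^ 2 := by
  have hM := (norm_nonneg _).trans ha
  have hN := (norm_nonneg _).trans hb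
  have hħ2 : ħ ^ 2 ≤ 1 := pow_le_one₀ hħ.le hħ1
  have nh : ‖(ħ : ℂ)‖ = ħ := by rw [Complex.norm_real, Real.norm_of_nonneg hħ.le]
  have h1 : ∀ {c : ℂ} {L : ℝ}, ‖c‖ ≤ L → ‖1 + (ħ : ℂ) * c‖ ≤ 1 + L := fun {c L} hc => by
    refine (norm_add_le _ _).trans ?_
    rw [norm_one, norm_mul, nh]
    nlinarith [norm_nonneg c]
  have h2 : ‖B‖ ≤ 1 + N + D := by
    calc ‖B‖ = ‖(1 + (ħ : ℂ) * b) + (B - (1 + ħ * b))‖ := by ring_nf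
      _ ≤ (1 + N) + D * ħ ^ 2 := (norm_add_le _ _).trans (add_le_add (h1 hb) hB)
      _ ≤ 1 + N + D := by nlinarith
  calc ‖A * B - (1 + ħ * (a + b))‖
      = ‖(A - (1 + ħ * a)) * B + (1 + ħ * a) * (B - (1 + ħ * b)) + (ħ : ℂ) ^ 2 * (a * b)‖ := by
        ring_nf
    _ ≤ C * ħ ^ 2 * (1 + N + D) + (1 + M) * (D * ħ ^ 2) + ħ ^ 2 * (M * N) := by
        refine (norm_add₃_le).trans ?_
        rw [norm_mul, norm_mul, norm_mul, norm_mul, norm_pow, nh]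
        gcongr
        exact h1 ha
    _ = _ := by ring

/-- Inversion of an expansion `1 + ħ a + O(ħ²)`. The smallness assumption on `ħ` keeps `A` away from
zero. -/
lemma norm_inv_sub_le {A a : ℂ} {C M ħ : ℝ} (hħ : 0 < ħ) (hħ1 : ħ ≤ 1) (hC : 0 ≤ C)
    (hA : ‖A - (1 + ħ * a)‖ ≤ C * ħ ^ 2) (ha : ‖a‖ ≤ M) (hsmall : ħ * (M + C) ≤ 1 / 2) :
    ‖A⁻¹ - (1 + ħ * (-a))‖ ≤ 2 * (M ^ 2 + C * (1 + M)) * ħ ^ 2 := by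
  have hM := (norm_nonneg _).trans ha
  have nh : ‖(ħ : ℂ)‖ = ħ := by rw [Complex.norm_real, Real.norm_of_nonneg hħ.le]
  have hlow : 1 / 2 ≤ ‖A‖ := by
    have h1 : ‖(1 : ℂ)‖ ≤ ‖A‖ + ‖A - (1 + ħ * a)‖ + ‖(ħ : ℂ) * a‖ := by
      calc ‖(1 : ℂ)‖ = ‖A - (A - (1 + ħ * a)) - (ħ : ℂ) * a‖ := by ring_nf
        _ ≤ _ := (norm_sub_le _ _).trans (add_le_add (norm_sub_le _ _) le_rfl)
    rw [norm_one, norm_mul, nh] at h1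
    nlinarith [mul_le_mul_of_nonneg_left ha hħ.le, mul_nonneg hC hħ.le]
  have hA0 : A ≠ 0 := by rintro rfl; norm_num at hlow
  have h1 : ‖1 - (ħ : ℂ) * a‖ ≤ 1 + M := by
    refine (norm_sub_le _ _).trans ?_
    rw [norm_one, norm_mul, nh]
    nlinarith [norm_nonneg a]
  have hinv : ‖A⁻¹‖ ≤ 2 := by
    rw [norm_inv]; exact inv_le_of_inv_le₀ (by norm_num) (by linarith)
  calc ‖A⁻¹ - (1 + ħ * (-a))‖
      = ‖A⁻¹ * ((ħ : ℂ) ^ 2 * a ^ 2 - (A - (1 + ħ * a)) * (1 - ħ * a))‖ := by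
        congr 1; field_simp; ring
    _ ≤ 2 * (ħ ^ 2 * M ^ 2 + C * ħ ^ 2 * (1 + M)) := by
        rw [norm_mul]
        refine mul_le_mul hinv ((norm_sub_le _ _).trans ?_) (norm_nonneg _) (by norm_num)
        rw [norm_mul, norm_mul, norm_pow, norm_pow, nh]
        gcongr
    _ = _ := by ring

/-- The expansion `A ħ y = 1 + ħ a(y) + O(ħ²)` holds uniformly for `y ∈ S`, with `a` bounded. -/
def UnifExpansion {X : Type*} (S : Set X) (A : ℝ → X → ℂ) (a : X → ℂ) : Prop :=
  ∃ C, 0 ≤ C ∧ ∃ M, 0 ≤ M ∧ ∃ h₀, 0 < h₀ ∧ ∀ ħ : ℝ, 0 < ħ → ħ < h₀ → ∀ y ∈ S,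
    ‖A ħ y - (1 + ħ * a y)‖ ≤ C * ħ ^ 2 ∧ ‖a y‖ ≤ M

namespace UnifExpansion

variable {X : Type*} {S : Set X} {A B : ℝ → X → ℂ} {a b : X → ℂ}

lemma mul (hA : UnifExpansion S A a) (hB : UnifExpansion S B b) :
    UnifExpansion S (fun ħ y => A ħ y * B ħ y) (fun y => a y + b y) := by
  obtain ⟨C, hC, M, hM, h₁, hh₁, hA⟩ := hA
  obtain ⟨D, hD, N, hN, h₂, hh₂, hB⟩ := hB
  refine ⟨C * (1 + N + D) + (1 + M) * D + M * N, by positivity, M + N, by positivity,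
    min 1 (min h₁ h₂), by positivity, fun ħ hħ hlt y hy => ?_⟩
  rw [lt_min_iff, lt_min_iff] at hlt
  have h1 := hA ħ hħ hlt.2.1 y hy
  have h2 := hB ħ hħ hlt.2.2 y hy
  exact ⟨norm_mul_sub_le hħ hlt.1.le hC hD h1.1 h2.1 h1.2 h2.2,
    (norm_add_le _ _).trans (add_le_add h1.2 h2.2)⟩

lemma inv (hA : UnifExpansion S A a) :
    UnifExpansion S (fun ħ y => (A ħ y)⁻¹) (fun y => -a y) := by
  obtain ⟨C, hC, M, hM, h₁, hh₁, hA⟩ := hA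
  refine ⟨2 * (M ^ 2 + C * (1 + M)), by positivity, M, hM,
    min 1 (min h₁ (1 / (2 * (M + C + 1)))), by positivity, fun ħ hħ hlt y hy => ?_⟩
  rw [lt_min_iff, lt_min_iff] at hlt
  have h1 := hA ħ hħ hlt.2.1 y hy
  refine ⟨norm_inv_sub_le hħ hlt.1.le hC h1.1 h1.2 ?_, by rw [norm_neg]; exact h1.2⟩
  have h := hlt.2.2
  rw [lt_div_iff₀ (by positivity)] at h
  nlinarith

lemma comp {Y : Type*} {T : Set Y} (hA : UnifExpansion S A a) {f : Y → X} (hf : ∀ y ∈ T, f y ∈ S) :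
    UnifExpansion T (fun ħ y => A ħ (f y)) (fun y => a (f y)) := by
  obtain ⟨C, hC, M, hM, h₁, hh₁, hA⟩ := hA
  exact ⟨C, hC, M, hM, h₁, hh₁, fun ħ hħ hlt y hy => hA ħ hħ hlt _ (hf y hy)⟩

end UnifExpansion

lemma unifExpansion_hyp0F1 {b : ℝ} (hb : 1 / 2 < b) (hs₀ : 0 < s₀) :
    UnifExpansion {σ : ℂ | s₀ / 2 ≤ σ.re ∧ ‖σ‖ ≤ 2 * σ.re}
      (fun ħ σ => hyp0F1 b (((s₀ ^ 2 / ħ : ℝ) * (σ / s₀)) ^ 2) *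
        hypNormalizer b ((s₀ ^ 2 / ħ : ℝ) * (σ / s₀)))
      (fun σ => hypCoeff b / (s₀ * σ)) := by
  obtain ⟨C, hC, h⟩ := exists_hyp0F1_bound hb
  have hs0c : (s₀ : ℂ) ≠ 0 := by exact_mod_cast hs₀.ne'
  refine ⟨C * (4 / s₀ ^ 4), by positivity, |hypCoeff b| / (s₀ * (s₀ / 2)), by positivity,
    s₀ ^ 2 / 2, by positivity, ?_⟩
  rintro ħ hħ hħ1 σ ⟨h1, h2⟩
  have hσ : s₀ / 2 ≤ ‖σ‖ := h1.trans (Complex.re_le_norm σ)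
  have hσ0 : σ ≠ 0 := norm_pos_iff.1 (by linarith)
  have hħc : (ħ : ℂ) ≠ 0 := by exact_mod_cast hħ.ne'
  have hζ : (s₀ ^ 2 / ħ : ℝ) * (σ / s₀) = ((s₀ / ħ : ℝ) : ℂ) * σ := by
    push_cast; field_simp
  have hpos : 0 < s₀ / ħ := by positivity
  beta_reduce
  rw [hζ]
  constructor
  · have h3 := h (((s₀ / ħ : ℝ) : ℂ) * σ) ?_ ?_
    · rw [show (hypCoeff b : ℂ) / (((s₀ / ħ : ℝ) : ℂ) * σ) = ħ * (hypCoeff b / (s₀ * σ)) by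
        push_cast; field_simp] at h3
      refine h3.trans ?_
      rw [norm_mul, Complex.norm_real, Real.norm_of_nonneg hpos.le]
      calc C / (s₀ / ħ * ‖σ‖) ^ 2 ≤ C / (s₀ / ħ * (s₀ / 2)) ^ 2 := by gcongr
        _ = _ := by field_simp; norm_num
    · rw [Complex.re_ofReal_mul]
      calc (1 : ℝ) = (ħ / ħ) := (div_self hħ.ne').symm
        _ ≤ (s₀ ^ 2 / 2) / ħ := by gcongr
        _ = s₀ / ħ * (s₀ / 2) := by ring
        _ ≤ _ := by gcongr
    · rw [Complex.re_ofReal_mul, norm_mul, Complex.norm_real, Real.norm_of_nonneg hpos.le]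
      nlinarith
  · rw [norm_div, norm_mul, Complex.norm_real, Complex.norm_real, Real.norm_eq_abs,
      Real.norm_of_nonneg hs₀.le]
    gcongr

/-- The coefficient of `ħ` in the expansion of `ratioFactor`. -/
def ratioCoeff (p ν μ : ℝ) (e : Cn n) (s₀ : ℝ) (y : Cn n) : ℂ :=
  hypCoeff ν / (s₀ * sCoord e s₀ y) + hypCoeff μ / (s₀ * conj (sCoord e s₀ y))
    + ((besselCoeff p / (2 * ‖shiftPt e s₀ y‖ ^ 2) : ℝ) : ℂ) + -(hypCoeff μ / (s₀ * s₀))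

lemma unifExpansion_ratioFactor (he : ‖e‖ = 1) (hs₀ : 0 < s₀) {ν μ : ℝ} (hν : 1 / 2 < ν)
    (hμ : 1 / 2 < μ) (p : ℝ) : UnifExpansion {y : Cn n | ‖y‖ ≤ s₀ / 2}
      (ratioFactor p ν μ e s₀) (ratioCoeff p ν μ e s₀) := by
  have hs0c : (s₀ : ℂ) ≠ 0 := by exact_mod_cast hs₀.ne'
  set S : Set (Cn n) := {y | ‖y‖ ≤ s₀ / 2}
  have hre : ∀ y ∈ S, s₀ / 2 ≤ (sCoord e s₀ y).re := fun y (hy : ‖y‖ ≤ s₀ / 2) => by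
    linarith [sCoord_re_ge (e := e) (s₀ := s₀) (y := y) he]
  have hle : ∀ y ∈ S, ‖sCoord e s₀ y‖ ≤ 2 * (sCoord e s₀ y).re := by
    intro y hy
    have hy' : ‖y‖ ≤ s₀ / 2 := hy
    have h1 := Complex.norm_le_abs_re_add_abs_im (sCoord e s₀ y)
    have h2 := (Complex.abs_im_le_norm (sCoord e s₀ y - s₀)).trans (norm_sCoord_sub_le he)
    rw [Complex.sub_im, Complex.ofReal_im, sub_zero] at h2
    have h3 := hre y hy
    rw [abs_of_nonneg (by linarith : 0 ≤ (sCoord e s₀ y).re)] at h1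
    linarith
  have h1 := (unifExpansion_hyp0F1 hν hs₀).comp (T := S) (f := sCoord e s₀)
    fun y hy => ⟨hre y hy, hle y hy⟩
  have h2 := (unifExpansion_hyp0F1 hμ hs₀).comp (T := S) (f := fun y => conj (sCoord e s₀ y))
    fun y hy => ⟨by simpa using hre y hy, by simpa using hle y hy⟩
  have h4 := (unifExpansion_hyp0F1 hμ hs₀).comp (T := S) (f := fun _ => (s₀ : ℂ))
    fun y hy => ⟨by simp; linarith, by simp [abs_of_pos hs₀]; linarith⟩
  simp only [div_self hs0c] at h4
  have h3 : UnifExpansion S (fun ħ y =>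
      ((besselK p (2 * (s₀ ^ 2 / ħ * (‖shiftPt e s₀ y‖ ^ 2 / s₀ ^ 2)))
        * besselNormalizer (2 * (s₀ ^ 2 / ħ * (‖shiftPt e s₀ y‖ ^ 2 / s₀ ^ 2))) : ℝ) : ℂ))
      fun y => ((besselCoeff p / (2 * ‖shiftPt e s₀ y‖ ^ 2) : ℝ) : ℂ) := by
    obtain ⟨C, hC, h⟩ := exists_besselK_bound p
    refine ⟨C * (4 / s₀ ^ 4), by positivity, |besselCoeff p| / (2 * (s₀ / 2) ^ 2), by positivity,
      s₀ ^ 2 / 2, by positivity, fun ħ hħ hħ2 y hy => ?_⟩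
    have hY : (s₀ / 2) ^ 2 ≤ ‖shiftPt e s₀ y‖ ^ 2 := by
      rw [norm_shiftPt_sq he]
      have : (s₀ / 2) ^ 2 ≤ ‖sCoord e s₀ y‖ ^ 2 := by
        gcongr; exact (hre y hy).trans (Complex.re_le_norm _)
      linarith [sq_nonneg ‖perpPart e s₀ y‖]
    have hYpos : 0 < ‖shiftPt e s₀ y‖ ^ 2 := lt_of_lt_of_le (by positivity) hY
    beta_reduce
    generalize ‖shiftPt e s₀ y‖ ^ 2 = Y at hY hYpos ⊢
    have hx : 2 * (s₀ ^ 2 / ħ * (Y / s₀ ^ 2)) = 2 * Y / ħ := by field_simp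
    have h' := h (2 * Y / ħ) (by rw [le_div_iff₀ hħ]; linarith)
    rw [hx, Complex.norm_real, Real.norm_eq_abs, abs_div, abs_of_pos (by positivity : 0 < 2 * Y),
      ← Complex.ofReal_mul, ← Complex.ofReal_one, ← Complex.ofReal_add, ← Complex.ofReal_sub,
      Complex.norm_real, Real.norm_eq_abs,
      show ħ * (besselCoeff p / (2 * Y)) = besselCoeff p / (2 * Y / ħ) by field_simp]
    constructor
    · refine h'.trans ?_
      calc C / (2 * Y / ħ) ^ 2 ≤ C / (2 * (s₀ / 2) ^ 2 / ħ) ^ 2 := by gcongr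
        _ = _ := by field_simp; norm_num
    · gcongr
  exact ((h1.mul h2).mul h3).mul h4.inv

/-! ### The contribution of a neighbourhood of the critical point -/

lemma norm_sq_smul_unit (he : ‖e‖ = 1) : ‖((s₀ : ℂ) ^ 2) • e‖ = s₀ ^ 2 := by
  rw [norm_smul, he, norm_pow, Complex.norm_real, mul_one, Real.norm_eq_abs, sq_abs]

/-- The coefficient of `ħ` produced by Laplace's method is the one of the expansion. -/
lemma trace_add_ratioCoeff_eq (he : ‖e‖ = 1) (hs₀ : 0 < s₀) {β : Cn n → ℂ} (hβ : ContDiff ℝ ∞ β)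
    (p ν μ : ℝ) :
    (∑ k, fderiv ℝ (fderiv ℝ fun y => β (chart e s₀ y) * amp p ν μ e s₀ y) 0
        (realVec k) (realVec k)) / 8
      + β (chart e s₀ 0) * amp p ν μ e s₀ 0 * ratioCoeff p ν μ e s₀ 0
      = firstCoeff p ν μ β (((s₀ : ℂ) ^ 2) • e) := by
  have hs0c : (s₀ : ℂ) ≠ 0 := by exact_mod_cast hs₀.ne'
  have hz : ((s₀ : ℂ) ^ 2) • e ≠ 0 := by
    rw [← norm_pos_iff, norm_sq_smul_unit he]; positivity
  have hzr : ((s₀ : ℂ) ^ 2) • e = (s₀ ^ 2) • e := by rw [← Complex.ofReal_pow, Complex.coe_smul]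
  have hzI : Complex.I • ((s₀ ^ 2) • e) = (s₀ ^ 2) • Complex.I • e := smul_comm _ _ _
  rw [sum_fderiv_fderiv_symbol_mul_amp he hs₀ hβ, firstCoeff_eq hβ hz, norm_sq_smul_unit he,
    chart_zero he, amp_zero he hs₀, ratioCoeff, sCoord_zero he, norm_shiftPt_zero_sq he,
    hypCoeff, hypCoeff, besselCoeff, hzr, hzI]
  simp only [map_smul, smul_apply, Complex.real_smul, Complex.conj_ofReal]
  push_cast
  field_simp
  ring

lemma measurable_ratioFactor {ν μ : ℝ} (hν : 1 / 2 < ν) (hμ : 1 / 2 < μ) (p ħ : ℝ) :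
    Measurable (ratioFactor p ν μ e s₀ ħ) := by
  have h1 := measurable_hyp0F1 hν
  have h2 := measurable_hyp0F1 hμ
  have h3 := measurable_besselK p
  have h4 : Measurable (sCoord e s₀) :=
    (continuous_iff_continuousAt.2 fun y => contDiffAt_sCoord.continuousAt).measurable
  have h5 : Measurable (shiftPt e s₀) :=
    (continuous_iff_continuousAt.2 fun y => contDiffAt_shiftPt.continuousAt).measurable
  have h6 : ∀ b, Measurable (hypNormalizer b) := fun b => by unfold hypNormalizer; fun_prop
  have h7 : Measurable besselNormalizer := by unfold besselNormalizer; fun_prop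
  have a1 : Measurable fun y => ((s₀ ^ 2 / ħ : ℝ) : ℂ) * (sCoord e s₀ y / s₀) :=
    (h4.div_const _).const_mul _
  have a2 : Measurable fun y => ((s₀ ^ 2 / ħ : ℝ) : ℂ) * (conj (sCoord e s₀ y) / s₀) :=
    ((Complex.continuous_conj.measurable.comp h4).div_const _).const_mul _
  have a3 : Measurable fun y => 2 * (s₀ ^ 2 / ħ * (‖shiftPt e s₀ y‖ ^ 2 / s₀ ^ 2)) :=
    (((h5.norm.pow_const 2).div_const _).const_mul _).const_mul _
  exact ((((h1.comp (a1.pow_const 2)).mul ((h6 ν).comp a1)).mul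
    ((h2.comp (a2.pow_const 2)).mul ((h6 μ).comp a2))).mul
    (Complex.measurable_ofReal.comp ((h3.comp a3).mul (h7.comp a3)))).mul_const _

/-- Laplace's method for a smooth amplitude: the leading term and the first correction. -/
lemma exists_laplace_expansion {H : Cn n → ℂ} {δ₀ : ℝ} (hδ₀ : 0 < δ₀)
    (hH : ∀ y, ‖y‖ ≤ δ₀ → ContDiffAt ℝ ∞ H y) :
    ∃ r, 0 < r ∧ ∀ δ, 0 < δ → δ ≤ r → ∃ K, 0 ≤ K ∧ ∀ b : ℝ, 0 < b →
      ‖(∫ y in Metric.ball 0 δ, H y * (Real.exp (-b * ‖y‖ ^ 2) : ℂ))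
        - ((Real.pi / b) ^ n : ℝ) * (H 0 + (∑ i, fderiv ℝ (fderiv ℝ H) 0 (realVec i) (realVec i))
          / (4 * b))‖ ≤ K * ((Real.pi / b) ^ n / b ^ 2) := by
  obtain ⟨C, hC, r, hr, hT⟩ := eventually_norm_symm_sub_le (hH 0 (by simpa using hδ₀.le))
  have hcont : ContinuousOn H (Metric.closedBall 0 δ₀) := fun y hy =>
    (hH y (by simpa using hy)).continuousAt.continuousWithinAt
  obtain ⟨M, hM⟩ := (isCompact_closedBall (0 : Cn n) δ₀).exists_bound_of_continuousOn hcont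
  refine ⟨min r δ₀, by positivity, fun δ hδ hδr => ?_⟩
  have h1 := hδr.trans (min_le_left _ _)
  have h2 := hδr.trans (min_le_right _ _)
  exact exists_laplace_bound hδ hC
    (hcont.mono (Metric.ball_subset_closedBall.trans (Metric.closedBall_subset_closedBall h2)))
    (fun y hy => hM y (by simpa using hy.le.trans h2)) fun y hy => hT y (hy.trans_le h1)

lemma integrableOn_mul_gaussian {H : Cn n → ℂ} {δ M : ℝ}
    (hH : ContinuousOn H (Metric.ball 0 δ)) (hM : ∀ y, ‖y‖ < δ → ‖H y‖ ≤ M) {b : ℝ} (hb : 0 < b) :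
    IntegrableOn (fun y => H y * (Real.exp (-b * ‖y‖ ^ 2) : ℂ)) (Metric.ball 0 δ) := by
  refine (((integrable_gaussian_Cn hb).const_mul M).integrableOn).mono' ?_ ?_
  · refine (hH.mul (Continuous.continuousOn ?_)).aestronglyMeasurable measurableSet_ball
    fun_prop
  · refine (ae_restrict_mem measurableSet_ball).mono fun y hy => ?_
    rw [norm_mul, Complex.norm_real, Real.norm_of_nonneg (Real.exp_pos _).le]
    gcongr
    exact hM y (by simpa using hy)

/-- The expansion of the integral over a sublevel set of the phase. -/
lemma exists_near_bound (hn : 2 ≤ n) (he : ‖e‖ = 1) (hs₀ : 0 < s₀) {ν μ : ℝ} (hν : 1 / 2 < ν)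
    (hμ : 1 / 2 < μ) (p : ℝ) {β : Cn n → ℂ} (hβ : ContDiff ℝ ∞ β) :
    ∃ δ, 0 < δ ∧ ∃ K, 0 ≤ K ∧ ∃ h₀, 0 < h₀ ∧ ∀ ħ : ℝ, 0 < ħ → ħ < h₀ →
      ‖(∫ w in {w | phase e s₀ w < δ ^ 2},
          (mDensity n p ħ w : ℂ) * integrand ν μ ħ β (((s₀ : ℂ) ^ 2) • e) w)
        - (((s₀ ^ 2 / ħ) ^ (n + p - ν) * (Real.Gamma ν / Real.Gamma (n + p)) : ℝ) : ℂ)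
          * (β (((s₀ : ℂ) ^ 2) • e) + ħ * firstCoeff p ν μ β (((s₀ : ℂ) ^ 2) • e))‖
      ≤ K * ((s₀ ^ 2 / ħ) ^ (n + p - ν) * ħ ^ 2) := by
  -- The amplitude is `H` times the normalized special functions, that is `H + ħ G + O(ħ²)`. Two
  -- orders of Laplace's method are needed for `H`, and only the first matters for `ħ G`.
  set H : Cn n → ℂ := fun y => β (chart e s₀ y) * amp p ν μ e s₀ y with hHdef
  set G : Cn n → ℂ := fun y => H y * ratioCoeff p ν μ e s₀ y with hGdef
  have hre : ∀ y : Cn n, ‖y‖ ≤ s₀ / 2 → 0 < (sCoord e s₀ y).re := fun y hy => by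
    linarith [sCoord_re_ge (e := e) (s₀ := s₀) (y := y) he]
  have hHs : ∀ y : Cn n, ‖y‖ ≤ s₀ / 2 → ContDiffAt ℝ ∞ H y := fun y hy =>
    (hβ.contDiffAt.comp y (contDiffAt_chart (stretchSq_pos (hre y hy)))).mul
      (contDiffAt_amp he hs₀ (hre y hy) p ν μ)
  have hqs : ∀ y : Cn n, ‖y‖ ≤ s₀ / 2 → ContDiffAt ℝ ∞ (ratioCoeff p ν μ e s₀) y := by
    intro y hy
    have hs := hre y hy
    have hsne : sCoord e s₀ y ≠ 0 := by rintro h; rw [h] at hs; simp at hs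
    have hs0c : (s₀ : ℂ) ≠ 0 := by exact_mod_cast hs₀.ne'
    have h1 : ContDiffAt ℝ ∞ (fun y => hypCoeff ν / (s₀ * sCoord e s₀ y)) y := by
      simp only [div_eq_mul_inv]
      exact contDiffAt_const.mul ((contDiffAt_const.mul contDiffAt_sCoord).inv
        (mul_ne_zero hs0c hsne))
    have h2 : ContDiffAt ℝ ∞ (fun y => hypCoeff μ / (s₀ * conj (sCoord e s₀ y))) y := by
      simp only [div_eq_mul_inv]
      exact contDiffAt_const.mul ((contDiffAt_const.mul
        (Complex.conjCLE.contDiff.contDiffAt.comp y contDiffAt_sCoord)).inv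
        (mul_ne_zero hs0c (show conj (sCoord e s₀ y) ≠ 0 from (map_ne_zero _).2 hsne)))
    have h3 : ContDiffAt ℝ ∞
        (fun y => ((besselCoeff p / (2 * ‖shiftPt e s₀ y‖ ^ 2) : ℝ) : ℂ)) y :=
      Complex.ofRealCLM.contDiff.contDiffAt.comp y (contDiffAt_const.div
        (contDiffAt_const.mul (contDiffAt_shiftPt.norm_sq ℝ))
        (mul_ne_zero two_ne_zero (norm_shiftPt_pos he hs).ne'))
    exact ((h1.add h2).add h3).add contDiffAt_const
  have hGs : ∀ y : Cn n, ‖y‖ ≤ s₀ / 2 → ContDiffAt ℝ ∞ G y := fun y hy =>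
    (hHs y hy).mul (hqs y hy)
  have hs2 : 0 < s₀ / 2 := by positivity
  obtain ⟨r₁, hr₁, hL₁⟩ := exists_laplace_expansion hs2 hHs
  obtain ⟨r₂, hr₂, hL₂⟩ := exists_laplace_expansion hs2 hGs
  set δ := min (s₀ / 2) (min r₁ r₂) with hδdef
  have hδ : 0 < δ := by positivity
  have hδs : δ ≤ s₀ / 2 := min_le_left _ _
  obtain ⟨K₁, hK₁, hL₁⟩ := hL₁ δ hδ ((min_le_right _ _).trans (min_le_left _ _))
  obtain ⟨K₂, hK₂, hL₂⟩ := hL₂ δ hδ ((min_le_right _ _).trans (min_le_right _ _))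
  obtain ⟨C, hC, Mq, hMq, h₁, hh₁, hR⟩ := unifExpansion_ratioFactor he hs₀ hν hμ p
  have hHc : ContinuousOn H (Metric.closedBall 0 (s₀ / 2)) := fun y hy =>
    (hHs y (by simpa using hy)).continuousAt.continuousWithinAt
  have hGc : ContinuousOn G (Metric.closedBall 0 (s₀ / 2)) := fun y hy =>
    (hGs y (by simpa using hy)).continuousAt.continuousWithinAt
  have hqc : ContinuousOn (ratioCoeff p ν μ e s₀) (Metric.closedBall 0 (s₀ / 2)) := fun y hy =>
    (hqs y (by simpa using hy)).continuousAt.continuousWithinAt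
  have hsub : Metric.ball (0 : Cn n) δ ⊆ Metric.closedBall 0 (s₀ / 2) :=
    Metric.ball_subset_closedBall.trans (Metric.closedBall_subset_closedBall hδs)
  obtain ⟨M, hM⟩ := (isCompact_closedBall (0 : Cn n) (s₀ / 2)).exists_bound_of_continuousOn hHc
  obtain ⟨M', hM'⟩ := (isCompact_closedBall (0 : Cn n) (s₀ / 2)).exists_bound_of_continuousOn hGc
  have hM0 : 0 ≤ M := (norm_nonneg _).trans (hM 0 (by simpa using hs2.le))
  set tG := ∑ i, fderiv ℝ (fderiv ℝ G) 0 (realVec i) (realVec i) with htG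
  set tH := ∑ i, fderiv ℝ (fderiv ℝ H) 0 (realVec i) (realVec i) with htH
  have hfc : tH / 8 + G 0 = firstCoeff p ν μ β (((s₀ : ℂ) ^ 2) • e) :=
    trace_add_ratioCoeff_eq he hs₀ hβ p ν μ
  have hH0 : H 0 = β (((s₀ : ℂ) ^ 2) • e) := by
    rw [hHdef]; simp only [chart_zero he, amp_zero he hs₀, mul_one]
  refine ⟨δ, hδ, |Real.Gamma ν / Real.Gamma (n + p)| * (K₁ / 4 + K₂ / 4 + ‖tG‖ / 8 + M * C),
    by positivity, min 1 h₁, by positivity, fun ħ hħ hlt => ?_⟩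
  have hħ1 : ħ ≤ 1 := (hlt.trans_le (min_le_left _ _)).le
  have hb : 0 < 2 / ħ := by positivity
  have hħc : (ħ : ℂ) ≠ 0 := by exact_mod_cast hħ.ne'
  have nh : ‖(ħ : ℂ)‖ = ħ := by rw [Complex.norm_real, Real.norm_of_nonneg hħ.le]
  set g : Cn n → ℂ := fun y => (Real.exp (-(2 / ħ) * ‖y‖ ^ 2) : ℂ) with hg
  set D : Cn n → ℂ := fun y =>
    H y * (ratioFactor p ν μ e s₀ ħ y - (1 + ħ * ratioCoeff p ν μ e s₀ y)) * g y with hD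
  set L : ℝ := (Real.pi / (2 / ħ)) ^ n with hL
  have hL0 : 0 ≤ L := by have := Real.pi_pos; positivity
  have hgn : ∀ y, ‖g y‖ = Real.exp (-(2 / ħ) * ‖y‖ ^ 2) := fun y => by
    simp only [hg]
    rw [Complex.norm_real, Real.norm_of_nonneg (Real.exp_pos _).le]
  have hgc : Continuous g := by simp only [hg]; fun_prop
  have hDb : ∀ y ∈ Metric.ball (0 : Cn n) δ,
      ‖D y‖ ≤ M * (C * ħ ^ 2) * Real.exp (-(2 / ħ) * ‖y‖ ^ 2) := by
    intro y hy
    have hy' : ‖y‖ ≤ s₀ / 2 := by simpa using hsub hy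
    simp only [hD]
    rw [norm_mul, norm_mul, hgn]
    gcongr
    · exact hM y (hsub hy)
    · exact (hR ħ hħ (hlt.trans_le (min_le_right _ _)) y hy').1
  have hIg := (integrable_gaussian_Cn (n := n) hb).const_mul (M * (C * ħ ^ 2))
  have hDi : IntegrableOn D (Metric.ball 0 δ) := by
    refine hIg.integrableOn.mono' ?_ ((ae_restrict_mem measurableSet_ball).mono hDb)
    refine (((hHc.mono hsub).aestronglyMeasurable measurableSet_ball).mul
      ((measurable_ratioFactor hν hμ p ħ).aestronglyMeasurable.sub
        (((hqc.mono hsub).aestronglyMeasurable measurableSet_ball).const_mul _ |>.const_add _))).mul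
      hgc.aestronglyMeasurable
  have hHi := integrableOn_mul_gaussian (hHc.mono hsub)
    (fun y hy => hM y (hsub (by simpa using hy))) hb
  have hGi := integrableOn_mul_gaussian (hGc.mono hsub)
    (fun y hy => hM' y (hsub (by simpa using hy))) hb
  have hHGi : IntegrableOn (fun y => H y * g y + ħ * (G y * g y)) (Metric.ball 0 δ) :=
    hHi.add (hGi.const_mul _)
  have hDint : ‖∫ y in Metric.ball 0 δ, D y‖ ≤ M * (C * ħ ^ 2) * L := by
    refine (norm_integral_le_of_norm_le hIg.integrableOn
      ((ae_restrict_mem measurableSet_ball).mono hDb)).trans ?_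
    refine (setIntegral_le_integral hIg (Eventually.of_forall fun y => ?_)).trans ?_
    · have := Real.exp_pos (-(2 / ħ) * ‖y‖ ^ 2); simp only [Pi.zero_apply]; positivity
    · rw [integral_const_mul, integral_gaussian_Cn hb]
  have hint : ∫ w in {w | phase e s₀ w < δ ^ 2},
      (mDensity n p ħ w : ℂ) * integrand ν μ ħ β (((s₀ : ℂ) ^ 2) • e) w
      = laplacePrefactor n p ν s₀ ħ * ((∫ y in Metric.ball 0 δ, H y * g y)
        + ħ * (∫ y in Metric.ball 0 δ, G y * g y) + ∫ y in Metric.ball 0 δ, D y) := by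
    rw [setIntegral_phase_lt he hn hδ (hδs.trans (by linarith)), ← integral_const_mul (ħ : ℂ),
      ← integral_add hHi (hGi.const_mul _), ← integral_add hHGi hDi, ← integral_const_mul]
    refine setIntegral_congr_fun measurableSet_ball fun y hy => ?_
    have hy' : ‖y‖ ≤ s₀ / 2 := by simpa using hsub hy
    have := jacobian_mul_integrand hn he hs₀ hħ (p := p) hν hμ β (hre y hy')
    simp only [this, hHdef, hGdef, hD, hg]
    ring
  have hpre := laplacePrefactor_mul (n := n) hħ hs₀ p ν
  rw [← hL] at hpre
  have hpren : |laplacePrefactor n p ν s₀ ħ| * L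
      = (s₀ ^ 2 / ħ) ^ (n + p - ν) * |Real.Gamma ν / Real.Gamma (n + p)| := by
    rw [← abs_of_nonneg hL0, ← abs_mul, hpre, abs_mul,
      abs_of_nonneg (Real.rpow_nonneg (by positivity) _)]
  have e1 := hL₁ (2 / ħ) hb
  have e2 := hL₂ (2 / ħ) hb
  rw [← hL] at e1 e2
  have h4b : (4 * ((2 / ħ : ℝ) : ℂ)) = 8 / ħ := by push_cast; ring
  rw [h4b, show L / (2 / ħ) ^ 2 = L * ħ ^ 2 / 4 by field_simp; norm_num] at e1 e2
  set I₁ := ∫ y in Metric.ball 0 δ, H y * g y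
  set I₂ := ∫ y in Metric.ball 0 δ, G y * g y
  set I₃ := ∫ y in Metric.ball 0 δ, D y
  have hsplit : laplacePrefactor n p ν s₀ ħ * (I₁ + ħ * I₂ + I₃)
      - (((s₀ ^ 2 / ħ) ^ (n + p - ν) * (Real.Gamma ν / Real.Gamma (n + p)) : ℝ) : ℂ)
          * (β (((s₀ : ℂ) ^ 2) • e) + ħ * firstCoeff p ν μ β (((s₀ : ℂ) ^ 2) • e))
      = laplacePrefactor n p ν s₀ ħ * ((I₁ - L * (H 0 + tH / (8 / ħ)))
        + ħ * (I₂ - L * (G 0 + tG / (8 / ħ))) + (ħ : ℂ) ^ 2 * L * (tG / 8) + I₃) := by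
    rw [← hpre, ← hfc, ← hH0]
    push_cast
    field_simp
    ring
  rw [hint, hsplit, norm_mul, Complex.norm_real, Real.norm_eq_abs]
  have hbound : ‖(I₁ - L * (H 0 + tH / (8 / ħ))) + ħ * (I₂ - L * (G 0 + tG / (8 / ħ)))
      + (ħ : ℂ) ^ 2 * L * (tG / 8) + I₃‖ ≤ L * ħ ^ 2 * (K₁ / 4 + K₂ / 4 + ‖tG‖ / 8 + M * C) := by
    have n1 : ‖(ħ : ℂ) * (I₂ - L * (G 0 + tG / (8 / ħ)))‖ ≤ K₂ * (L * ħ ^ 2 / 4) := by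
      rw [norm_mul, nh]
      exact (mul_le_of_le_one_left (norm_nonneg _) hħ1).trans e2
    have n2 : ‖(ħ : ℂ) ^ 2 * L * (tG / 8)‖ = ħ ^ 2 * L * (‖tG‖ / 8) := by
      rw [norm_mul, norm_mul, norm_pow, nh, Complex.norm_real, Real.norm_of_nonneg hL0, norm_div]
      simp
    refine (norm_add_le _ _).trans ((add_le_add (norm_add₃_le.trans
      (add_le_add (add_le_add e1 n1) n2.le)) hDint).trans (le_of_eq ?_))
    ring
  calc |laplacePrefactor n p ν s₀ ħ| * _
      ≤ |laplacePrefactor n p ν s₀ ħ| * (L * ħ ^ 2 * (K₁ / 4 + K₂ / 4 + ‖tG‖ / 8 + M * C)) := by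
        gcongr
    _ = (|laplacePrefactor n p ν s₀ ħ| * L) * (ħ ^ 2 * (K₁ / 4 + K₂ / 4 + ‖tG‖ / 8 + M * C)) := by
        ring
    _ = _ := by rw [hpren]; ring

/-! ### Decay away from the critical point -/

lemma mDensity_nonneg {p : ℝ} (hp : -(n : ℝ) < p) {ħ : ℝ} (hħ : 0 < ħ) (w : Cn n) :
    0 ≤ mDensity n p ħ w := by
  have hΓ := Real.Gamma_pos_of_pos (show 0 < (n : ℝ) + p by linarith)
  have hK := besselK_nonneg p (2 * ‖w‖ / ħ)
  have hπ := Real.pi_pos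
  have := Real.rpow_nonneg (show 0 ≤ ‖w‖ / ħ by positivity) p
  unfold mDensity
  positivity

lemma measurable_mDensity (n : ℕ) (p ħ : ℝ) : Measurable (mDensity n p ħ) := by
  unfold mDensity
  exact (((measurable_norm.div_const ħ).pow_const p).const_mul _).mul
    ((measurable_besselK p).comp ((measurable_norm.const_mul 2).div_const ħ))

lemma integrable_mMeasure_iff {p : ℝ} (hp : -(n : ℝ) < p) {ħ : ℝ} (hħ : 0 < ħ) (f : Cn n → ℂ) :
    Integrable f (mMeasure n p ħ) ↔ Integrable fun w => (mDensity n p ħ w : ℂ) * f w := by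
  rw [mMeasure, integrable_withDensity_iff_integrable_smul'
    (measurable_mDensity n p ħ).ennreal_ofReal (Eventually.of_forall fun _ => ENNReal.ofReal_lt_top)]
  simp_rw [ENNReal.toReal_ofReal (mDensity_nonneg hp hħ _), Complex.real_smul]

lemma integral_mMeasure {p : ℝ} (hp : -(n : ℝ) < p) {ħ : ℝ} (hħ : 0 < ħ) (f : Cn n → ℂ) :
    ∫ w, f w ∂mMeasure n p ħ = ∫ w, (mDensity n p ħ w : ℂ) * f w := by
  rw [mMeasure, integral_withDensity_eq_integral_toReal_smul
    (measurable_mDensity n p ħ).ennreal_ofReal (Eventually.of_forall fun _ => ENNReal.ofReal_lt_top)]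
  simp_rw [ENNReal.toReal_ofReal (mDensity_nonneg hp hħ _), Complex.real_smul]

/-- Comparison of the densities for two values of `ħ`. -/
lemma mDensity_le {p : ℝ} (hp : -(n : ℝ) < p) {ħ ħ₀ : ℝ} (hħ : 0 < ħ) (hle : ħ ≤ ħ₀) {w : Cn n}
    (hw : w ≠ 0) : mDensity n p ħ w ≤ (ħ₀ / ħ) ^ (2 * n + p)
      * Real.exp (-(2 * ‖w‖ * (1 / ħ - 1 / ħ₀))) * mDensity n p ħ₀ w := by
  have hħ₀ : 0 < ħ₀ := hħ.trans_le hle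
  have hw' := norm_pos_iff.2 hw
  have hΓ := Real.Gamma_pos_of_pos (show 0 < (n : ℝ) + p by linarith)
  have hπ := Real.pi_pos
  have hy : 0 ≤ 2 * ‖w‖ * (1 / ħ - 1 / ħ₀) := by
    have := one_div_le_one_div_of_le hħ hle
    have : 0 ≤ 1 / ħ - 1 / ħ₀ := by linarith
    positivity
  have h := besselK_add_le p (show 0 < 2 * ‖w‖ / ħ₀ by positivity) hy
  rw [show 2 * ‖w‖ / ħ₀ + 2 * ‖w‖ * (1 / ħ - 1 / ħ₀) = 2 * ‖w‖ / ħ by ring] at h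
  have e1 : (‖w‖ / ħ) ^ p = (ħ₀ / ħ) ^ p * (‖w‖ / ħ₀) ^ p := by
    rw [← Real.mul_rpow (by positivity) (by positivity)]; congr 1; field_simp
  have e2 : 2 / (Real.pi * ħ ^ 2) ^ n = (ħ₀ / ħ) ^ (2 * (n : ℝ)) * (2 / (Real.pi * ħ₀ ^ 2) ^ n) := by
    rw [show (2 * (n : ℝ)) = ((2 * n : ℕ) : ℝ) by push_cast; rfl, Real.rpow_natCast, pow_mul,
      mul_pow, mul_pow, div_pow, div_pow]
    field_simp
  have e3 : (ħ₀ / ħ) ^ (2 * n + p) = (ħ₀ / ħ) ^ (2 * (n : ℝ)) * (ħ₀ / ħ) ^ p :=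
    Real.rpow_add (by positivity) _ _
  have hc : 0 ≤ 1 / Real.Gamma (n + p) * (2 / (Real.pi * ħ ^ 2) ^ n) * (‖w‖ / ħ) ^ p := by
    have := Real.rpow_nonneg (show 0 ≤ ‖w‖ / ħ by positivity) p
    positivity
  calc mDensity n p ħ w ≤ 1 / Real.Gamma (n + p) * (2 / (Real.pi * ħ ^ 2) ^ n) * (‖w‖ / ħ) ^ p
        * (Real.exp (-(2 * ‖w‖ * (1 / ħ - 1 / ħ₀))) * besselK p (2 * ‖w‖ / ħ₀)) :=
        mul_le_mul_of_nonneg_left h hc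
    _ = _ := by rw [e1, e2, e3, mDensity]; ring

/-- The reproducing-kernel factor grows at most like `e^(4 Re √(w·z) / ħ)`. -/
lemma norm_hyp0F1_mul_le {ν μ : ℝ} (hν : 1 / 2 < ν) (hμ : 1 / 2 < μ) (hs₀ : 0 < s₀) {ħ : ℝ}
    (hħ : 0 < ħ) (w : Cn n) :
    ‖hyp0F1 ν (hdot w (((s₀ : ℂ) ^ 2) • e) / (ħ : ℂ) ^ 2)
      * hyp0F1 μ (hdot (((s₀ : ℂ) ^ 2) • e) w / (ħ : ℂ) ^ 2)‖
      ≤ Real.exp (4 * s₀ * (hdot w e ^ (1 / 2 : ℂ)).re / ħ) := by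
  set x := hdot w e ^ (1 / 2 : ℂ) with hx
  have hx2 : x ^ 2 = hdot w e := cpow_half_sq _
  have h1 : hdot w (((s₀ : ℂ) ^ 2) • e) / (ħ : ℂ) ^ 2 = (((s₀ / ħ : ℝ) : ℂ) * x) ^ 2 := by
    rw [hdot_smul_right, mul_pow, hx2, map_pow, Complex.conj_ofReal]; push_cast; ring
  have h2 : hdot (((s₀ : ℂ) ^ 2) • e) w / (ħ : ℂ) ^ 2 = (((s₀ / ħ : ℝ) : ℂ) * conj x) ^ 2 := by
    rw [hdot_smul_left, mul_pow, ← map_pow, hx2, hdot_conj]; push_cast; ring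
  have hre : 0 ≤ (s₀ / ħ) * x.re := mul_nonneg (by positivity) (cpow_half_re_nonneg _)
  rw [h1, h2, norm_mul]
  have b1 := norm_hyp0F1_sq_le hν (((s₀ / ħ : ℝ) : ℂ) * x)
  have b2 := norm_hyp0F1_sq_le hμ (((s₀ / ħ : ℝ) : ℂ) * conj x)
  rw [Complex.re_ofReal_mul, abs_of_nonneg hre] at b1
  rw [Complex.re_ofReal_mul, Complex.conj_re, abs_of_nonneg hre] at b2
  calc _ ≤ Real.exp (2 * (s₀ / ħ * x.re)) * Real.exp (2 * (s₀ / ħ * x.re)) := by gcongr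
    _ = _ := by rw [← Real.exp_add]; congr 1; ring

/-- Lower bound for the normalizing factor in the denominator. -/
lemma exists_norm_inv_hyp0F1_le {μ : ℝ} (hμ : 1 / 2 < μ) :
    ∃ A, 0 ≤ A ∧ ∃ R, 0 < R ∧ ∀ r : ℝ, R ≤ r →
      ‖(hyp0F1 μ ((r : ℂ) ^ 2))⁻¹‖ ≤ A * r ^ (μ - 1 / 2) * Real.exp (-(2 * r)) := by
  obtain ⟨C, hC, h⟩ := exists_hyp0F1_bound hμ
  have hΓ := Real.Gamma_pos_of_pos (show 0 < μ by linarith)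
  refine ⟨2 * (2 * √Real.pi / Real.Gamma μ), by positivity, max 1 (2 * (C + |hypCoeff μ|)),
    by positivity, fun r hr => ?_⟩
  have hr1 : 1 ≤ r := (le_max_left _ _).trans hr
  have hr2 : 2 * (C + |hypCoeff μ|) ≤ r := (le_max_right _ _).trans hr
  have hr0 : 0 < r := by linarith
  have h1 := h r (by simpa) (by simp [abs_of_pos hr0]; linarith)
  have hN : ‖hypNormalizer μ r‖ = 2 * √Real.pi / Real.Gamma μ * r ^ (μ - 1 / 2)
      * Real.exp (-(2 * r)) := by
    rw [hypNormalizer, ← Complex.ofReal_cpow hr0.le, norm_mul, norm_mul, Complex.norm_real,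
      Complex.norm_real, Complex.norm_exp, Real.norm_of_nonneg (by positivity),
      Real.norm_of_nonneg (by positivity)]
    simp
  have h2 : 1 / 2 ≤ ‖hyp0F1 μ ((r : ℂ) ^ 2) * hypNormalizer μ r‖ := by
    set P := hyp0F1 μ ((r : ℂ) ^ 2) * hypNormalizer μ r
    have h3 : ‖(1 : ℂ)‖ ≤ ‖P‖ + ‖P - (1 + hypCoeff μ / r)‖ + ‖(hypCoeff μ / r : ℂ)‖ := by
      calc ‖(1 : ℂ)‖ = ‖P - (P - (1 + hypCoeff μ / r)) - (hypCoeff μ / r : ℂ)‖ := by ring_nf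
        _ ≤ _ := (norm_sub_le _ _).trans (add_le_add (norm_sub_le _ _) le_rfl)
    rw [norm_one, norm_div, Complex.norm_real, Complex.norm_real, Real.norm_of_nonneg hr0.le,
      Real.norm_eq_abs] at h3
    rw [Complex.norm_real, Real.norm_of_nonneg hr0.le] at h1
    have h4 : C / r ^ 2 ≤ C / r := by
      gcongr; nlinarith
    have h5 : (C + |hypCoeff μ|) / r ≤ 1 / 2 := by
      rw [div_le_iff₀ hr0]; linarith
    rw [add_div] at h5
    linarith
  have hF : hyp0F1 μ ((r : ℂ) ^ 2) ≠ 0 := by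
    intro h0; rw [h0, zero_mul, norm_zero] at h2; norm_num at h2
  have hF' := norm_pos_iff.2 hF
  rw [norm_mul] at h2
  rw [norm_inv, inv_le_iff_one_le_mul₀ hF']
  rw [hN] at h2
  nlinarith

/-- The phase is nonnegative and grows linearly at infinity. -/
lemma norm_le_phase (he : ‖e‖ = 1) (hs₀ : 0 < s₀) (w : Cn n) :
    0 ≤ phase e s₀ w ∧ ‖w‖ ≤ 2 * phase e s₀ w + 2 * s₀ ^ 2 := by
  set x := hdot w e ^ (1 / 2 : ℂ) with hx
  have h1 : ‖x‖ ^ 2 ≤ ‖w‖ := by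
    rw [← norm_pow, hx, cpow_half_sq]
    simpa [he] using norm_hdot_le w e
  have h2 := Complex.re_le_norm x
  have h3 : phase e s₀ w = s₀ ^ 2 + ‖w‖ - 2 * s₀ * x.re := rfl
  constructor <;> nlinarith [sq_nonneg (s₀ - ‖x‖), sq_nonneg (2 * s₀ - ‖x‖)]

/-- Pointwise domination of density times integrand, for small `ħ`, by the density for `ħ₀` with
a factor decaying exponentially in the phase. -/
lemma exists_integrand_bound (he : ‖e‖ = 1) (hs₀ : 0 < s₀) {ν μ p : ℝ} (hν : 1 / 2 < ν)
    (hμ : 1 / 2 < μ) (hp : -(n : ℝ) < p) (β : Cn n → ℂ) {ħ₀ : ℝ} (hħ₀ : 0 < ħ₀) :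
    ∃ A, 0 ≤ A ∧ ∃ h₁, 0 < h₁ ∧ ∀ ħ : ℝ, 0 < ħ → ħ < h₁ → ∀ w : Cn n, w ≠ 0 →
      ‖(mDensity n p ħ w : ℂ) * integrand ν μ ħ β (((s₀ : ℂ) ^ 2) • e) w‖
        ≤ A * (1 / ħ) ^ (2 * n + p + (μ - 1 / 2)) * Real.exp (-(phase e s₀ w / ħ))
          * ‖(mDensity n p ħ₀ w : ℂ) * β w‖ := by
  obtain ⟨A, hA, R, hR, hinv⟩ := exists_norm_inv_hyp0F1_le hμ
  refine ⟨ħ₀ ^ (2 * n + p) * (A * (s₀ ^ 2) ^ (μ - 1 / 2)) * Real.exp (4 * s₀ ^ 2 / ħ₀),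
    by positivity, min (ħ₀ / 4) (s₀ ^ 2 / R), by positivity, fun ħ hħ hlt w hw => ?_⟩
  have hħ4 : ħ ≤ ħ₀ / 4 := (hlt.trans_le (min_le_left _ _)).le
  have hħR : R ≤ s₀ ^ 2 / ħ := by
    have := (hlt.trans_le (min_le_right _ _)).le
    rw [le_div_iff₀ hR] at this
    rw [le_div_iff₀ hħ]; linarith
  have hd := mDensity_le hp hħ (by linarith : ħ ≤ ħ₀) hw
  have hd0 := mDensity_nonneg hp hħ w
  have hd00 := mDensity_nonneg hp hħ₀ w
  have hF := norm_hyp0F1_mul_le (e := e) hν hμ hs₀ hħ w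
  have hG := hinv _ hħR
  obtain ⟨hph, hwp⟩ := norm_le_phase he hs₀ w
  have hz : ((‖((s₀ : ℂ) ^ 2) • e‖ : ℝ) : ℂ) ^ 2 / (ħ : ℂ) ^ 2 = ((s₀ ^ 2 / ħ : ℝ) : ℂ) ^ 2 := by
    rw [norm_sq_smul_unit he]; push_cast; ring
  rw [integrand, hz, norm_mul, norm_mul, norm_mul, div_eq_mul_inv, norm_mul _ (_)⁻¹,
    Complex.norm_real, Complex.norm_real, Real.norm_of_nonneg hd0, Real.norm_of_nonneg hd00]
  have e1 : (ħ₀ / ħ) ^ (2 * n + p) = ħ₀ ^ (2 * n + p) * (1 / ħ) ^ (2 * n + p) := by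
    rw [← Real.mul_rpow hħ₀.le (by positivity)]; congr 1; ring
  have e2 : (s₀ ^ 2 / ħ) ^ (μ - 1 / 2) = (s₀ ^ 2) ^ (μ - 1 / 2) * (1 / ħ) ^ (μ - 1 / 2) := by
    rw [← Real.mul_rpow (by positivity) (by positivity)]; congr 1; ring
  have e3 : (1 / ħ) ^ (2 * n + p + (μ - 1 / 2)) = (1 / ħ) ^ (2 * n + p) * (1 / ħ) ^ (μ - 1 / 2) :=
    Real.rpow_add (by positivity) _ _
  have hexp : Real.exp (-(2 * ‖w‖ * (1 / ħ - 1 / ħ₀)))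
      * (Real.exp (4 * s₀ * (hdot w e ^ (1 / 2 : ℂ)).re / ħ) * Real.exp (-(2 * (s₀ ^ 2 / ħ))))
      ≤ Real.exp (4 * s₀ ^ 2 / ħ₀) * Real.exp (-(phase e s₀ w / ħ)) := by
    rw [← Real.exp_add, ← Real.exp_add, ← Real.exp_add, Real.exp_le_exp]
    have t1 : -(2 * ‖w‖ * (1 / ħ - 1 / ħ₀)) + (4 * s₀ * (hdot w e ^ (1 / 2 : ℂ)).re / ħ
        + -(2 * (s₀ ^ 2 / ħ))) = -(2 * phase e s₀ w / ħ) + 2 * ‖w‖ / ħ₀ := by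
      rw [phase]; ring
    have t2 : 2 * ‖w‖ / ħ₀ ≤ 4 * phase e s₀ w / ħ₀ + 4 * s₀ ^ 2 / ħ₀ := by
      rw [← add_div]; gcongr; linarith
    have t3 : 4 * phase e s₀ w / ħ₀ ≤ phase e s₀ w / ħ := by
      rw [div_le_div_iff₀ hħ₀ hħ]; nlinarith
    have t4 : 2 * phase e s₀ w / ħ = phase e s₀ w / ħ + phase e s₀ w / ħ := by ring
    linarith
  calc mDensity n p ħ w * (‖β w‖ * (‖hyp0F1 ν _ * hyp0F1 μ _‖ * ‖(hyp0F1 μ _)⁻¹‖))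
      ≤ ((ħ₀ / ħ) ^ (2 * n + p) * Real.exp (-(2 * ‖w‖ * (1 / ħ - 1 / ħ₀))) * mDensity n p ħ₀ w)
        * (‖β w‖ * (Real.exp (4 * s₀ * (hdot w e ^ (1 / 2 : ℂ)).re / ħ)
          * (A * (s₀ ^ 2 / ħ) ^ (μ - 1 / 2) * Real.exp (-(2 * (s₀ ^ 2 / ħ)))))) := by
        gcongr
    _ = (ħ₀ ^ (2 * n + p) * (A * (s₀ ^ 2) ^ (μ - 1 / 2)) * (1 / ħ) ^ (2 * n + p + (μ - 1 / 2))
        * (mDensity n p ħ₀ w * ‖β w‖)) * (Real.exp (-(2 * ‖w‖ * (1 / ħ - 1 / ħ₀)))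
        * (Real.exp (4 * s₀ * (hdot w e ^ (1 / 2 : ℂ)).re / ħ) * Real.exp (-(2 * (s₀ ^ 2 / ħ))))) := by
        rw [e1, e2, e3]; ring
    _ ≤ (ħ₀ ^ (2 * n + p) * (A * (s₀ ^ 2) ^ (μ - 1 / 2)) * (1 / ħ) ^ (2 * n + p + (μ - 1 / 2))
        * (mDensity n p ħ₀ w * ‖β w‖)) * (Real.exp (4 * s₀ ^ 2 / ħ₀)
          * Real.exp (-(phase e s₀ w / ħ))) := by gcongr
    _ = _ := by ring

lemma measurable_hdot_left (z : Cn n) : Measurable fun w => hdot w z := by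
  unfold hdot; fun_prop

lemma measurable_hdot_right (z : Cn n) : Measurable fun w => hdot z w := by
  simp_rw [← fun w => hdot_conj w z]
  exact Complex.continuous_conj.measurable.comp (measurable_hdot_left z)

lemma measurable_phase (e : Cn n) (s₀ : ℝ) : Measurable (phase e s₀) := by
  have := measurable_hdot_left e
  unfold phase
  fun_prop

lemma measurable_integrand {ν μ : ℝ} (hν : 1 / 2 < ν) (hμ : 1 / 2 < μ) (ħ : ℝ) {β : Cn n → ℂ}
    (hβ : Measurable β) (z : Cn n) : Measurable (integrand ν μ ħ β z) :=
  hβ.mul ((((measurable_hyp0F1 hν).comp ((measurable_hdot_left z).div_const _)).mul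
    ((measurable_hyp0F1 hμ).comp ((measurable_hdot_right z).div_const _))).div_const _)

/-! ### Assembling the expansion -/

/-- Absolute convergence for small `ħ`, with respect to Lebesgue measure. -/
lemma eventually_integrable (hn : 2 ≤ n) (he : ‖e‖ = 1) (hs₀ : 0 < s₀) {ν μ p : ℝ}
    (hν : 1 / 2 < ν) (hμ : 1 / 2 < μ) (hp : -(n : ℝ) < p) {β : Cn n → ℂ} (hβ : Measurable β)
    {ħ₀ : ℝ} (hħ₀ : 0 < ħ₀) (hint : Integrable fun w => (mDensity n p ħ₀ w : ℂ) * β w) :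
    ∃ h₁, 0 < h₁ ∧ ∀ ħ : ℝ, 0 < ħ → ħ < h₁ →
      Integrable fun w => (mDensity n p ħ w : ℂ) * integrand ν μ ħ β (((s₀ : ℂ) ^ 2) • e) w := by
  have : NeZero n := ⟨by omega⟩
  obtain ⟨A, hA, h₁, hh₁, hbd⟩ := exists_integrand_bound he hs₀ hν hμ hp β hħ₀
  refine ⟨h₁, hh₁, fun ħ hħ hlt => ?_⟩
  refine (hint.norm.const_mul (A * (1 / ħ) ^ (2 * n + p + (μ - 1 / 2)))).mono' ?_ ?_
  · exact ((Complex.measurable_ofReal.comp (measurable_mDensity n p ħ)).mul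
      (measurable_integrand hν hμ ħ hβ _)).aestronglyMeasurable
  · filter_upwards [Measure.ae_ne volume (0 : Cn n)] with w hw
    refine (hbd ħ hħ hlt w hw).trans ?_
    have h1 : Real.exp (-(phase e s₀ w / ħ)) ≤ 1 := by
      rw [Real.exp_le_one_iff, neg_nonpos]
      exact div_nonneg (norm_le_phase he hs₀ w).1 hħ.le
    have h2 : 0 ≤ A * (1 / ħ) ^ (2 * n + p + (μ - 1 / 2)) := by positivity
    exact mul_le_mul_of_nonneg_right (mul_le_of_le_one_right h2 h1) (norm_nonneg _)

/-- The region where the phase is bounded below contributes less than any power of `ħ`. -/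
lemma exists_far_bound (hn : 2 ≤ n) (he : ‖e‖ = 1) (hs₀ : 0 < s₀) {ν μ p : ℝ}
    (hν : 1 / 2 < ν) (hμ : 1 / 2 < μ) (hp : -(n : ℝ) < p) {β : Cn n → ℂ}
    {ħ₀ : ℝ} (hħ₀ : 0 < ħ₀) (hint : Integrable fun w => (mDensity n p ħ₀ w : ℂ) * β w)
    {δ : ℝ} (hδ : 0 < δ) (k : ℝ) :
    ∃ K, 0 ≤ K ∧ ∃ h₁, 0 < h₁ ∧ ∀ ħ : ℝ, 0 < ħ → ħ < h₁ →
      ‖∫ w in {w | phase e s₀ w < δ ^ 2}ᶜ,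
        (mDensity n p ħ w : ℂ) * integrand ν μ ħ β (((s₀ : ℂ) ^ 2) • e) w‖ ≤ K * ħ ^ k := by
  have : NeZero n := ⟨by omega⟩
  obtain ⟨A, hA, h₁, hh₁, hbd⟩ := exists_integrand_bound he hs₀ hν hμ hp β hħ₀
  generalize (2 * n + p + (μ - 1 / 2) : ℝ) = m at hbd
  obtain ⟨C, hC, hexp⟩ := exists_rpow_mul_exp_neg_le (m + k)
  set J := ∫ w, ‖(mDensity n p ħ₀ w : ℂ) * β w‖ with hJ
  have hJ0 : 0 ≤ J := integral_nonneg fun _ => norm_nonneg _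
  refine ⟨A * C * (δ ^ 2) ^ (-(m + k)) * J, by positivity, min h₁ (δ ^ 2), by positivity,
    fun ħ hħ hlt => ?_⟩
  have hlt1 := hlt.trans_le (min_le_left _ _)
  have hlt2 := (hlt.trans_le (min_le_right _ _)).le
  set S := {w : Cn n | phase e s₀ w < δ ^ 2} with hS
  have hSm : MeasurableSet S := measurableSet_lt (measurable_phase e s₀) measurable_const
  have hb : ∀ᵐ w ∂volume.restrict Sᶜ,
      ‖(mDensity n p ħ w : ℂ) * integrand ν μ ħ β (((s₀ : ℂ) ^ 2) • e) w‖
        ≤ A * (1 / ħ) ^ m * Real.exp (-(δ ^ 2 / ħ)) * ‖(mDensity n p ħ₀ w : ℂ) * β w‖ := by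
    filter_upwards [ae_restrict_mem hSm.compl, ae_restrict_of_ae (Measure.ae_ne volume (0 : Cn n))]
      with w hwS hw
    have hwS : δ ^ 2 ≤ phase e s₀ w := not_lt.1 hwS
    refine (hbd ħ hħ hlt1 w hw).trans ?_
    gcongr
  have hpow : (1 / ħ) ^ m * Real.exp (-(δ ^ 2 / ħ)) ≤ C * (δ ^ 2) ^ (-(m + k)) * ħ ^ k := by
    have h := hexp (δ ^ 2 / ħ) (by rwa [le_div_iff₀ hħ, one_mul])
    have e1 : (1 / ħ) ^ m = (δ ^ 2) ^ (-(m + k)) * ħ ^ k * (δ ^ 2 / ħ) ^ (m + k) := by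
      rw [one_div, Real.inv_rpow hħ.le, Real.div_rpow (by positivity) hħ.le,
        Real.rpow_neg (by positivity), Real.rpow_add hħ m k]
      have := Real.rpow_pos_of_pos hħ m
      have := Real.rpow_pos_of_pos hħ k
      have := Real.rpow_pos_of_pos (show 0 < δ ^ 2 by positivity) (m + k)
      field_simp
    have h0 : 0 ≤ (δ ^ 2) ^ (-(m + k)) * ħ ^ k := by positivity
    calc _ = (δ ^ 2) ^ (-(m + k)) * ħ ^ k * ((δ ^ 2 / ħ) ^ (m + k) * Real.exp (-(δ ^ 2 / ħ))) := by
          rw [e1]; ring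
      _ ≤ (δ ^ 2) ^ (-(m + k)) * ħ ^ k * C := mul_le_mul_of_nonneg_left h h0
      _ = _ := by ring
  refine (norm_integral_le_of_norm_le (hint.norm.const_mul _).integrableOn hb).trans ?_
  refine (setIntegral_le_integral (hint.norm.const_mul _)
    (Eventually.of_forall fun w => by simp only [Pi.zero_apply]; positivity)).trans ?_
  rw [integral_const_mul, ← hJ]
  calc A * (1 / ħ) ^ m * Real.exp (-(δ ^ 2 / ħ)) * J
      = A * J * ((1 / ħ) ^ m * Real.exp (-(δ ^ 2 / ħ))) := by ring
    _ ≤ A * J * (C * (δ ^ 2) ^ (-(m + k)) * ħ ^ k) :=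
      mul_le_mul_of_nonneg_left hpow (by positivity)
    _ = _ := by ring

end BerezinSphere

end

theorem mainTheorem4 (n : ℕ) (hn : 2 ≤ n) (z : BerezinSphere.Cn n) (hz : z ≠ 0)
    (p μ ν : ℝ) (hp : -(n : ℝ) < p) (hμ : 1 / 2 < μ) (hν : 1 / 2 < ν)
    (β : BerezinSphere.Cn n → ℂ) (hβ : ContDiff ℝ ∞ β)
    (hβint : ∃ ħ₀ : ℝ, 0 < ħ₀ ∧ Integrable β (BerezinSphere.mMeasure n p ħ₀)) :
    (∀ᶠ ħ : ℝ in 𝓝[>] 0,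
      Integrable (BerezinSphere.integrand ν μ ħ β z) (BerezinSphere.mMeasure n p ħ)) ∧
    (fun ħ : ℝ =>
        (∫ w, BerezinSphere.integrand ν μ ħ β z w ∂(BerezinSphere.mMeasure n p ħ))
          - (((‖z‖ / ħ) ^ (n + p - ν) * (Real.Gamma ν / Real.Gamma (n + p)) : ℝ) : ℂ)
            * (β z + (ħ : ℂ) * BerezinSphere.firstCoeff p ν μ β z))
      =O[𝓝[>] 0] (fun ħ : ℝ => (‖z‖ / ħ) ^ (n + p - ν) * ħ ^ 2) := by
  open BerezinSphere in
  obtain ⟨ħ₀, hħ₀, hint⟩ := hβint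
  rw [integrable_mMeasure_iff hp hħ₀] at hint
  have hz' : 0 < ‖z‖ := norm_pos_iff.2 hz
  obtain ⟨e, s₀, he, hs₀, hzs, rfl⟩ : ∃ (e : Cn n) (s₀ : ℝ), ‖e‖ = 1 ∧ 0 < s₀ ∧ ‖z‖ = s₀ ^ 2 ∧
      z = ((s₀ : ℂ) ^ 2) • e := by
    have hzc : (‖z‖ : ℂ) ≠ 0 := by exact_mod_cast hz'.ne'
    refine ⟨(‖z‖ : ℂ)⁻¹ • z, √‖z‖, ?_, Real.sqrt_pos.2 hz', (Real.sq_sqrt hz'.le).symm, ?_⟩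
    · rw [norm_smul, norm_inv, Complex.norm_real, norm_norm, inv_mul_cancel₀ hz'.ne']
    · rw [smul_smul, ← Complex.ofReal_pow, Real.sq_sqrt hz'.le, mul_inv_cancel₀ hzc, one_smul]
  rw [hzs]
  obtain ⟨h₁, hh₁, hI⟩ :=
    eventually_integrable hn he hs₀ hν hμ hp hβ.continuous.measurable hħ₀ hint
  obtain ⟨δ, hδ, K, hK, h₂, hh₂, hnear⟩ := exists_near_bound hn he hs₀ hν hμ p hβ
  obtain ⟨K', hK', h₃, hh₃, hfar⟩ :=
    exists_far_bound hn he hs₀ hν hμ hp hħ₀ hint hδ (2 - (n + p - ν))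
  have hmem : ∀ {h : ℝ}, 0 < h → ∀ᶠ ħ : ℝ in 𝓝[>] 0, 0 < ħ ∧ ħ < h := fun hh =>
    Ioo_mem_nhdsGT hh
  constructor
  · filter_upwards [hmem hh₁] with ħ hħ
    exact (integrable_mMeasure_iff hp hħ.1 _).2 (hI ħ hħ.1 hħ.2)
  · refine IsBigO.of_bound (K + K' / (s₀ ^ 2) ^ (n + p - ν)) ?_
    filter_upwards [hmem hh₁, hmem hh₂, hmem hh₃] with ħ ⟨hħ, hlt₁⟩ ⟨_, hlt₂⟩ ⟨_, hlt₃⟩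
    have hSm : MeasurableSet {w : Cn n | phase e s₀ w < δ ^ 2} :=
      measurableSet_lt (measurable_phase e s₀) measurable_const
    have hpow : ħ ^ (2 - (n + p - ν)) = (s₀ ^ 2 / ħ) ^ (n + p - ν) * ħ ^ 2
        / (s₀ ^ 2) ^ (n + p - ν) := by
      have := Real.rpow_pos_of_pos (show 0 < s₀ ^ 2 by positivity) (n + p - ν)
      have := Real.rpow_pos_of_pos hħ (n + p - ν)
      rw [Real.rpow_sub hħ, Real.div_rpow (by positivity) hħ.le, Real.rpow_two]
      field_simp
    rw [integral_mMeasure hp hħ, ← integral_add_compl hSm (hI ħ hħ hlt₁), add_sub_right_comm,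
      Real.norm_of_nonneg (by positivity)]
    refine (norm_add_le _ _).trans
      ((add_le_add (hnear ħ hħ hlt₂) (hfar ħ hħ hlt₃)).trans (le_of_eq ?_))
    rw [hpow]
    ring
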